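/- **Setting.** A credal sum-product network (CSPN) over Boolean variables $X_1,\dots,X_n$ is a rooted directed acyclic graph whose leaves are the indicators $x_v,\overline{x}_v$ and whose internal nodes are products and sums; each sum node $i$ carries a credal set $K_i$ (the convex hull of a finite list of rational probability vectors, one coordinate per outgoing edge). For weights $w=(w_i)\in C=\prod_i K_i$, $S_w(\lambda)$ denotes the value of the resulting sum-product network at the indicator configuration $\lambda$; $S_w(e)$ is its value when the indicators contradicting a partial assignment (evidence) $e$ are $0$ and all others are $1$, and $S_w(x,e)$ is the value for the event "$X_q=x$ and $e$". For a query variable $X_q$ and $f:\{0,1\}\to\mathbb{Q}$ (e.g. $f(x)=x$), let $E_w[f(X_q)\mid e]=\sum_x f(x)\,S_w(x,e)/S_w(e)$. The lower (upper) conditional expectation is the minimum (maximum) of $E_w[f(X_q)\mid e]$ over all $w\in C$ with $S_w(e)>0$; the evidence is assumed to have positive upper probability, i.e. $S_w(e)>0$ for some $w\in C$. **LearnCSPN$(T,V)$**, on a set $T$ of instances with possibly missing values and a set $V$ of variables: * If $V=\{X_v\}$, return a sum node over $x_v,\overline{x}_v$ with credal set generated by distributions within the estimated intervals $\left[\frac{k_b+s}{|T|+2s},\frac{k_b+u+s}{|T|+2s}\right]$,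 $b\in\{0,1\}$, where $k_b$ counts the instances with $X_v=b$, $u$ those with $X_v$ missing, and $s\ge 0$ is a smoothing parameter. * Otherwise, if $V$ can be partitioned into at least two nonempty subsets $V_j$ such that variables in different subsets have $G$-value (computed on $T$, with the mean of the counts that ignore and that include missing values) at most a threshold $\theta$, return $\prod_j \mathrm{LearnCSPN}(T,V_j)$ for such a partition. * Otherwise, cluster $T$ into nonempty clusters $T_i$ that cover $T$, where only incomplete instances may belong to several clusters, and return $\sum_i K_i * \mathrm{LearnCSPN}(T_i,V)$, where $K_i$ is generated by a nonempty finite list of distributions (e.g. extreme points) within the intervals $\left[\frac{\#\{\text{complete instances in }T_i\}}{|T|},\frac{|T_i|}{|T|}\right]$. Each call creates a new internal node; only the indicators are shared. **Statement.** There are an algorithm and a polynomial $p$ such that, for every $n$, every CSPN $S$ over $n$ variables that LearnCSPN can produce (from any dataset, with any $\theta$, $s$, and any choices of partitions, clusterings and extracted distributions as above), all evidence $e$ of positive upper probability, every query variable $X_q$ and every $f:\{0,1\}\to\mathbb{Q}$, the algorithm, on input $(S,e,q,f)$ with all numbers in binary, outputs the lower conditional expectation of $f(X_q)$ given $e$,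 exactly, as a quotient of two integers, after at most $p(N)$ steps, where $N$ is the bit size of the input. The same holds for the upper conditional expectation. (Running time is counted for while-programs on binary trees with integer leaves, where an arithmetic operation costs the product of the bit lengths, each increased by one, of its operands.) -/

import Mathlib

/-! ### Credal sum-product networks over Boolean variables `X_0, …, X_{n-1}` -/

/-- A node of a credal sum-product network. Children are given by their positions in the node table
of the network. A sum node carries the finite list of points that generates its credal set (one
coordinate for each outgoing edge). -/
inductive CSPNNode (n : ℕ) : Type
  | ind (v : Fin n) (b : Bool) : CSPNNode n
  | prod (children : List ℕ) : CSPNNode n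
  | sum (children : List ℕ) (points : List (List ℚ)) : CSPNNode n

/-- A credal sum-product network: a directed graph given by its table of nodes, in which children
stand before their parents, and the position of its root. Several parents may share a child. -/
structure CSPN (n : ℕ) : Type where
  nodes : List (CSPNNode n)
  root : ℕ

namespace CSPN

/-- The credal set generated by a finite list of points: their convex hull. -/
def credalSet (points : List (List ℚ)) : Set (ℕ → ℝ) :=
  convexHull ℝ {x | ∃ p ∈ points, x = fun j => ((p.getD j 0 : ℚ) : ℝ)}

/-- The admissible weight choices `w`, where `w i j` is the weight of the `j`-th edge out of
node `i`: the weights at each sum node range, independently, over its credal set. -/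
def weights {n : ℕ} (S : CSPN n) : Set (ℕ → ℕ → ℝ) :=
  {w | ∀ i children points, S.nodes[i]? = some (CSPNNode.sum children points) →
    w i ∈ credalSet points}

/-- The value of a node, from the values `vals` of the nodes standing before it. -/
noncomputable def nodeValue {n : ℕ} (lam : Fin n → Bool → ℝ) (wi : ℕ → ℝ) (vals : List ℝ) :
    CSPNNode n → ℝ
  | .ind v b => lam v b
  | .prod ch => (ch.map fun c => vals.getD c 0).prod
  | .sum ch _ => ∑ j ∈ Finset.range ch.length, wi j * vals.getD (ch.getD j 0) 0

/-- The list of the values of all nodes, computed from the leaves toward the root. -/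
noncomputable def nodeValues {n : ℕ} (lam : Fin n → Bool → ℝ) (w : ℕ → ℕ → ℝ)
    (nodes : List (CSPNNode n)) : List ℝ :=
  nodes.foldl (fun vals nd => vals ++ [nodeValue lam (w vals.length) vals nd]) []

/-- `S_w(λ)`: the value of the sum-product network with weights `w` at the configuration `λ` of the
indicators; `λ v true` and `λ v false` are the values of `x_v` and of its negation. -/
noncomputable def value {n : ℕ} (S : CSPN n) (w : ℕ → ℕ → ℝ) (lam : Fin n → Bool → ℝ) : ℝ :=
  (nodeValues lam w S.nodes).getD S.root 0

end CSPN

/-! ### Conditional expectations -/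

/-- The indicator configuration of evidence `e`, a partial assignment: an indicator is `0` if it
contradicts `e`, and `1` otherwise. -/
def evidenceConfig {n : ℕ} (e : Fin n → Option Bool) (v : Fin n) (b : Bool) : ℝ :=
  if e v = some (!b) then 0 else 1

/-- The indicator configuration of the event "`e` and `X_q = x`". -/
def queryConfig {n : ℕ} (e : Fin n → Option Bool) (q : Fin n) (x : Bool) (v : Fin n) (b : Bool) :
    ℝ :=
  if v = q ∧ b ≠ x then 0 else evidenceConfig e v b

/-- `E_w[f(X_q) | e] = (∑ x, f(x) S_w(x, e)) / S_w(e)` (meaningful if `S_w(e) > 0`). -/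
noncomputable def condExpectation {n : ℕ} (S : CSPN n) (w : ℕ → ℕ → ℝ) (e : Fin n → Option Bool)
    (q : Fin n) (f : Bool → ℚ) : ℝ :=
  (∑ x : Bool, (f x : ℝ) * S.value w (queryConfig e q x)) / S.value w (evidenceConfig e)

/-- The conditional expectations of `f(X_q)` given `e` under all members of the credal
network under which the evidence has positive probability. -/
def condExpectations {n : ℕ} (S : CSPN n) (e : Fin n → Option Bool) (q : Fin n) (f : Bool → ℚ) :
    Set ℝ :=
  {y | ∃ w ∈ S.weights, 0 < S.value w (evidenceConfig e) ∧ y = condExpectation S w e q f}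

/-! ### The learning algorithm

A dataset with missing values is a map `D : Fin m → Fin n → Option Bool`: `D t v` is the value of
the variable `v` in the instance `t`, or `none` if it is missing. Sets of instances and of variables
are finsets. -/

namespace LearnCSPN

variable {m n : ℕ}

/-- The instance `t` has no missing value among the variables in `V`. -/
def Complete (D : Fin m → Fin n → Option Bool) (V : Finset (Fin n)) (t : Fin m) : Prop :=
  ∀ v ∈ V, D t v ≠ none

instance (D : Fin m → Fin n → Option Bool) (V : Finset (Fin n)) :
    DecidablePred (Complete D V) := fun _ => by unfold Complete; infer_instance

/-- The number of instances in `T` at which the variables `i`, `j` have the (possibly missing)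
values `a`, `b`. -/
def count (D : Fin m → Fin n → Option Bool) (T : Finset (Fin m)) (i j : Fin n)
    (a b : Option Bool) : ℕ :=
  (T.filter fun t => D t i = a ∧ D t j = b).card

/-- Mean of the lower count (only instances in which both values are known) and the upper count
(also those in which one of the two values is missing) of `X_i = a, X_j = b`. -/
noncomputable def meanCount (D : Fin m → Fin n → Option Bool) (T : Finset (Fin m)) (i j : Fin n)
    (a b : Bool) : ℝ :=
  ((count D T i j (some a) (some b) : ℝ) +
    (count D T i j (some a) (some b) + count D T i j none (some b) +
      count D T i j (some a) none)) / 2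

/-- Mean of the lower count of `X_i = a` (only instances in which both `X_i` and `X_j` are known)
and its upper count (all instances with `X_i = a`, or with `X_i` missing). -/
noncomputable def meanCountSingle (D : Fin m → Fin n → Option Bool) (T : Finset (Fin m))
    (i j : Fin n) (a : Bool) : ℝ :=
  (((T.filter fun t => D t i = some a ∧ D t j ≠ none).card : ℝ) +
    (T.filter fun t => D t i = some a ∨ D t i = none).card) / 2

/-- The `G`-value of two variables on the instances in `T`. -/
noncomputable def gValue (D : Fin m → Fin n → Option Bool) (T : Finset (Fin m)) (i j : Fin n) : ℝ :=
  2 * ∑ a : Bool, ∑ b : Bool, meanCount D T i j a b *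
    Real.log (meanCount D T i j a b * T.card /
      (meanCountSingle D T i j a * meanCountSingle D T j i b))

/-- `Vs` is a partition of `V` into at least two approximately independent nonempty subsets:
variables in different subsets pass the independence test with threshold `θ`. -/
def IsIndependentSplit (D : Fin m → Fin n → Option Bool) (θ : ℝ) (T : Finset (Fin m))
    (V : Finset (Fin n)) (Vs : List (Finset (Fin n))) : Prop :=
  2 ≤ Vs.length ∧ (∀ A ∈ Vs, A.Nonempty) ∧ (∀ v, v ∈ V ↔ ∃ A ∈ Vs, v ∈ A) ∧
    Vs.Pairwise fun A B => Disjoint A B ∧ ∀ i ∈ A, ∀ j ∈ B, gValue D T i j ≤ θ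

/-- `Ts` is a clustering of the instances in `T`: nonempty clusters that cover `T`, such that only
an instance with a missing value may belong to several clusters. (Nothing else is required, so that
every result of the clustering heuristic is allowed, whatever the order of the instances, the number
of passes, the smoothing and the cluster penalty.) -/
def IsClustering (D : Fin m → Fin n → Option Bool) (T : Finset (Fin m)) (V : Finset (Fin n))
    (Ts : List (Finset (Fin m))) : Prop :=
  (∀ A ∈ Ts, A.Nonempty ∧ A ⊆ T) ∧ (∀ t ∈ T, ∃ A ∈ Ts, t ∈ A) ∧
    Ts.Pairwise fun A B => ∀ t, t ∈ A → t ∈ B → ¬ Complete D V t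

/-- `points` is a nonempty finite list of probability distributions that satisfy the interval
constraints `bounds` (in particular, any extracted list of extreme points of that polytope). -/
def IsExtracted (bounds : List (ℚ × ℚ)) (points : List (List ℚ)) : Prop :=
  points ≠ [] ∧ ∀ p ∈ points, p.sum = 1 ∧ List.Forall₂ (fun x lu => lu.1 ≤ x ∧ x ≤ lu.2) p bounds

/-- The interval weight of the cluster `A` of `T`: proportion of the complete instances in `A`, and
of all instances in `A`. -/
def clusterBounds (D : Fin m → Fin n → Option Bool) (T : Finset (Fin m)) (V : Finset (Fin n))
    (A : Finset (Fin m)) : ℚ × ℚ :=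
  (((A.filter (Complete D V)).card : ℚ) / T.card, (A.card : ℚ) / T.card)

/-- The smoothed interval probability of `X_v = b` estimated from `T`: proportion of the instances
that are known to have that value, and of those that may have it. -/
def valueBounds (D : Fin m → Fin n → Option Bool) (s : ℚ) (T : Finset (Fin m)) (v : Fin n)
    (b : Bool) : ℚ × ℚ :=
  (((T.filter fun t => D t v = some b).card + s) / (T.card + 2 * s),
    ((T.filter fun t => D t v = some b ∨ D t v = none).card + s) / (T.card + 2 * s))

mutual

/-- `Run D θ s T V N N' r`: a run of the recursive learning algorithm on instances `T` and variables
`V`, with threshold `θ` and smoothing `s`, starting with the node table `N`, may end with the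
node table `N'`, the learned network having its root at position `r`. The indicator nodes of
`X_v` are at the positions `2 * v` and `2 * v + 1`. -/
inductive Run (D : Fin m → Fin n → Option Bool) (θ : ℝ) (s : ℚ) :
    Finset (Fin m) → Finset (Fin n) → List (CSPNNode n) → List (CSPNNode n) → ℕ → Prop
  | univariate (T : Finset (Fin m)) (v : Fin n) (N : List (CSPNNode n)) (points : List (List ℚ)) :
      IsExtracted [valueBounds D s T v true, valueBounds D s T v false] points →
      Run D θ s T {v} N
        (N ++ [CSPNNode.sum [2 * (v : ℕ), 2 * (v : ℕ) + 1] points]) N.length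
  | product (T : Finset (Fin m)) (V : Finset (Fin n)) (N N' : List (CSPNNode n))
      (Vs : List (Finset (Fin n))) (roots : List ℕ) :
      V.card ≠ 1 → IsIndependentSplit D θ T V Vs →
      RunAll D θ s (Vs.map fun A => (T, A)) N N' roots →
      Run D θ s T V N (N' ++ [CSPNNode.prod roots]) N'.length
  | sum (T : Finset (Fin m)) (V : Finset (Fin n)) (N N' : List (CSPNNode n))
      (Ts : List (Finset (Fin m))) (roots : List ℕ) (points : List (List ℚ)) :
      V.card ≠ 1 → (¬ ∃ Vs, IsIndependentSplit D θ T V Vs) → IsClustering D T V Ts →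
      IsExtracted (Ts.map (clusterBounds D T V)) points →
      RunAll D θ s (Ts.map fun A => (A, V)) N N' roots →
      Run D θ s T V N (N' ++ [CSPNNode.sum roots points]) N'.length

/-- Consecutive runs of the learning algorithm on a list of pairs of sets of instances and of
variables, collecting the positions of the roots. -/
inductive RunAll (D : Fin m → Fin n → Option Bool) (θ : ℝ) (s : ℚ) :
    List (Finset (Fin m) × Finset (Fin n)) → List (CSPNNode n) → List (CSPNNode n) → List ℕ → Prop
  | nil (N : List (CSPNNode n)) : RunAll D θ s [] N N []
  | cons (T : Finset (Fin m)) (V : Finset (Fin n)) (L : List (Finset (Fin m) × Finset (Fin n)))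
      (N N' N'' : List (CSPNNode n)) (r : ℕ) (roots : List ℕ) :
      Run D θ s T V N N' r → RunAll D θ s L N' N'' roots →
      RunAll D θ s ((T, V) :: L) N N'' (r :: roots)

end

end LearnCSPN

/-- The `2 * n` indicator nodes. -/
def indicatorNodes (n : ℕ) : List (CSPNNode n) :=
  (List.finRange n).flatMap fun v => [CSPNNode.ind v true, CSPNNode.ind v false]

/-- `S` is learned by the algorithm from some dataset with missing values, with some threshold of
the independence test and some smoothing parameter. -/
def CSPN.IsLearned {n : ℕ} (S : CSPN n) : Prop :=
  ∃ (m : ℕ) (D : Fin m → Fin n → Option Bool) (θ : ℝ) (s : ℚ), 0 ≤ s ∧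
    LearnCSPN.Run D θ s Finset.univ Finset.univ (indicatorNodes n) S.nodes S.root

/-! ### Polynomial time

The machine model: while-programs on binary trees with integers at the leaves. Operations on
pointers take one step, and an arithmetic operation takes as many steps as the product of the
bit lengths of its operands (logarithmic cost). -/

/-- Binary trees with integers at the leaves. -/
inductive Data : Type
  | int (z : ℤ) : Data
  | pair (a b : Data) : Data

/-- Bit length of an integer. -/
def bitLength (z : ℤ) : ℕ := z.natAbs.size

/-- The size of a tree, in bits. -/
def Data.size : Data → ℕ
  | .int z => 1 + bitLength z
  | .pair a b => 1 + a.size + b.size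

/-- Programs. Each maps an input tree to an output tree. -/
inductive Prog : Type
  | id : Prog
  | const (z : ℤ) : Prog
  | fst : Prog
  | snd : Prog
  | isPair : Prog
  | add : Prog
  | sub : Prog
  | mul : Prog
  | pair (f g : Prog) : Prog
  | seq (f g : Prog) : Prog
  | cond (c f g : Prog) : Prog
  | loop (c f : Prog) : Prog

/-- The cost of an arithmetic operation. -/
def arithCost (a b : ℤ) : ℕ := (1 + bitLength a) * (1 + bitLength b)

/-- `P.Runs x y t`: on the input `x` the program `P` halts after `t` steps with the output `y`. -/
inductive Prog.Runs : Prog → Data → Data → ℕ → Prop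
  | id (x : Data) : Runs .id x x 1
  | const (z : ℤ) (x : Data) : Runs (.const z) x (.int z) 1
  | fst (a b : Data) : Runs .fst (.pair a b) a 1
  | snd (a b : Data) : Runs .snd (.pair a b) b 1
  | isPair_pair (a b : Data) : Runs .isPair (.pair a b) (.int 1) 1
  | isPair_int (z : ℤ) : Runs .isPair (.int z) (.int 0) 1
  | add (a b : ℤ) : Runs .add (.pair (.int a) (.int b)) (.int (a + b)) (arithCost a b)
  | sub (a b : ℤ) : Runs .sub (.pair (.int a) (.int b)) (.int (a - b)) (arithCost a b)
  | mul (a b : ℤ) : Runs .mul (.pair (.int a) (.int b)) (.int (a * b)) (arithCost a b)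
  | pair (f g : Prog) (x y z : Data) (t t' : ℕ) : Runs f x y t → Runs g x z t' →
      Runs (.pair f g) x (.pair y z) (t + t' + 1)
  | seq (f g : Prog) (x y z : Data) (t t' : ℕ) : Runs f x y t → Runs g y z t' →
      Runs (.seq f g) x z (t + t' + 1)
  | cond_pos (c f g : Prog) (x y : Data) (k : ℤ) (t t' : ℕ) : 0 < k → Runs c x (.int k) t →
      Runs f x y t' → Runs (.cond c f g) x y (t + t' + 1)
  | cond_nonpos (c f g : Prog) (x y : Data) (k : ℤ) (t t' : ℕ) : k ≤ 0 → Runs c x (.int k) t →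
      Runs g x y t' → Runs (.cond c f g) x y (t + t' + 1)
  | loop_done (c f : Prog) (x : Data) (k : ℤ) (t : ℕ) : k ≤ 0 → Runs c x (.int k) t →
      Runs (.loop c f) x x (t + 1)
  | loop_step (c f : Prog) (x y z : Data) (k : ℤ) (t t' t'' : ℕ) : 0 < k → Runs c x (.int k) t →
      Runs f x y t' → Runs (.loop c f) y z t'' → Runs (.loop c f) x z (t + t' + t'' + 1)

/-- The problem with the inputs `x` satisfying `valid x`, encoded by `encode x`, and the correct
outputs `correct x`, is solved by one program in time polynomial in the size of the input. -/
def SolvableInPolyTime {ι : Type} (encode : ι → Data) (valid : ι → Prop)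
    (correct : ι → Data → Prop) : Prop :=
  ∃ (P : Prog) (p : Polynomial ℕ), ∀ x, valid x →
    ∃ (y : Data) (t : ℕ), P.Runs (encode x) y t ∧ t ≤ p.eval (encode x).size ∧ correct x y

/-! ### Encodings -/

namespace Data

def ofNat (k : ℕ) : Data := .int (k : ℤ)

def ofBool (b : Bool) : Data := .int (if b then 1 else 0)

/-- A missing value is encoded by `2`. -/
def ofOptionBool : Option Bool → Data
  | none => .int 2
  | some b => ofBool b

def ofRat (r : ℚ) : Data := .pair (.int r.num) (.int (r.den : ℤ))

def ofList {α : Type} (g : α → Data) : List α → Data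
  | [] => .int 0
  | a :: l => .pair (g a) (ofList g l)

def ofNode {n : ℕ} : CSPNNode n → Data
  | .ind v b => .pair (.int 0) (.pair (ofNat v) (ofBool b))
  | .prod ch => .pair (.int 1) (ofList ofNat ch)
  | .sum ch points => .pair (.int 2) (.pair (ofList ofNat ch) (ofList (ofList ofRat) points))

def ofCSPN {n : ℕ} (S : CSPN n) : Data := .pair (ofList ofNode S.nodes) (ofNat S.root)

/-- A tree that represents the rational number `r`, as a quotient of two integers. -/
def Represents (y : Data) (r : ℚ) : Prop :=
  ∃ a b : ℤ, y = .pair (.int a) (.int b) ∧ 0 < b ∧ r = (a : ℚ) / (b : ℚ)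

end Data

/-- An input of the inference problem: a network, evidence, a query variable and a function of the
query variable. -/
structure CondExpQuery : Type where
  n : ℕ
  net : CSPN n
  evidence : Fin n → Option Bool
  var : Fin n
  f : Bool → ℚ

namespace CondExpQuery

def encode (Q : CondExpQuery) : Data :=
  .pair (Data.ofCSPN Q.net) (.pair (Data.ofList Data.ofOptionBool (List.ofFn Q.evidence))
    (.pair (Data.ofNat Q.var) (.pair (Data.ofRat (Q.f true)) (Data.ofRat (Q.f false)))))

/-- The network is learned by the algorithm, and the evidence has positive upper probability. -/
def Valid (Q : CondExpQuery) : Prop :=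
  Q.net.IsLearned ∧ ∃ w ∈ Q.net.weights, 0 < Q.net.value w (evidenceConfig Q.evidence)

/-- `y` represents the lower (that is, the least) conditional expectation. -/
def IsLower (Q : CondExpQuery) (y : Data) : Prop :=
  ∃ r : ℚ, y.Represents r ∧ IsLeast (condExpectations Q.net Q.evidence Q.var Q.f) (r : ℝ)

/-- `y` represents the upper (that is, the greatest) conditional expectation. -/
def IsUpper (Q : CondExpQuery) (y : Data) : Prop :=
  ∃ r : ℚ, y.Represents r ∧ IsGreatest (condExpectations Q.net Q.evidence Q.var Q.f) (r : ℝ)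

end CondExpQuery

/-! ### Bit lengths and sizes -/

-- Fix a value x of the query variable, and let A and B be the probabilities of the evidence
-- together with x and together with the other value. In a learned network S_w(e) = A + B, so the
-- conditional expectation is the mean of the two values of f with weights A and B. If x is a value
-- at which f is smallest (largest), the lower (upper) expectation is reached where A : B is
-- greatest, so it remains to maximise A / (A + B) over the weights (`answer_spec`).
--
-- This fractional problem is solved by Dinkelbach's method. For the current pair (a, b), starting
-- with (0, 1), maximise the linear objective b * A - a * B, replace (a, b) by the maximiser, and
-- stop when the maximum is not positive: then no weights give a greater ratio than a : b
-- (`iter_steps_spec`). The number of rounds is linear in the bit length because the product of the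
-- current maximum and the current A + B, suitably normalised, drops by a factor of 4 in each round
-- (`dinkelbach_steps_le`).
--
-- The linear problem is solved in one pass from the leaves to the root. Internal nodes have one
-- parent, and the shared indicators carry no weights, so the weights below different children are
-- chosen independently. A node without the query variable below it needs only its least and
-- greatest evidence probability; a node with the query variable below it needs one optimal pair (A,
-- B). At a product at most one factor contains the query variable, and the sign of its optimum
-- decides whether the other factors are made large or small (`inside_scale`). At a sum all children
-- have the same variables, and by linearity an optimum occurs at a generator of the credal set
-- (`evalNode_sum_spec`). `subnetwork_of_run` assembles this by induction on the run of the learning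
-- algorithm.
--
-- Fractions are never reduced. As internal nodes form a tree, the bits at a node are paid for by
-- the encoding of what lies below it, whatever a and b are, so numbers do not grow from round to
-- round (`bitLength_next_le`). The programs are built with the closure properties of `PolyFrom`.

theorem natAbs_lt_two_pow_bitLength (a : ℤ) : a.natAbs < 2 ^ bitLength a := Nat.lt_size_self _

theorem bitLength_le_iff {a : ℤ} {k : ℕ} : bitLength a ≤ k ↔ a.natAbs < 2 ^ k := Nat.size_le

theorem bitLength_add_le (a b : ℤ) : bitLength (a + b) ≤ max (bitLength a) (bitLength b) + 1 := by
  rw [bitLength_le_iff, pow_succ]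
  have ha := (natAbs_lt_two_pow_bitLength a).trans_le
    (Nat.pow_le_pow_right two_pos (le_max_left (bitLength a) (bitLength b)))
  have hb := (natAbs_lt_two_pow_bitLength b).trans_le
    (Nat.pow_le_pow_right two_pos (le_max_right (bitLength a) (bitLength b)))
  have := Int.natAbs_add_le a b
  omega

theorem bitLength_neg (a : ℤ) : bitLength (-a) = bitLength a := by simp [bitLength]

theorem bitLength_sub_le (a b : ℤ) : bitLength (a - b) ≤ max (bitLength a) (bitLength b) + 1 := by
  simpa [sub_eq_add_neg, bitLength_neg] using bitLength_add_le a (-b)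

theorem bitLength_mul_le (a b : ℤ) : bitLength (a * b) ≤ bitLength a + bitLength b := by
  rw [bitLength_le_iff, pow_add, Int.natAbs_mul]
  exact Nat.mul_lt_mul'' (natAbs_lt_two_pow_bitLength a) (natAbs_lt_two_pow_bitLength b)

theorem bitLength_natCast_le (k : ℕ) : bitLength k ≤ k := by
  rw [bitLength_le_iff]; simpa using Nat.lt_two_pow_self

@[simp] theorem bitLength_zero : bitLength 0 = 0 := rfl

@[simp] theorem bitLength_one : bitLength 1 = 1 := rfl

namespace Data

@[simp] theorem size_int (z : ℤ) : (Data.int z).size = 1 + bitLength z := rfl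

@[simp] theorem size_pair (a b : Data) : (Data.pair a b).size = 1 + a.size + b.size := rfl

theorem size_ofNat_le (k : ℕ) : (ofNat k).size ≤ 1 + k := by
  have := bitLength_natCast_le k
  simp only [ofNat, size_int]; omega

theorem size_ofBool_le (b : Bool) : (ofBool b).size ≤ 2 := by cases b <;> simp [ofBool]

theorem size_ofList {α : Type} (g : α → Data) (l : List α) :
    (ofList g l).size = 1 + (l.map fun a => 1 + (g a).size).sum := by
  induction l with
  | nil => simp [ofList]
  | cons a l ih => simp only [ofList, size_pair, ih, List.map_cons, List.sum_cons]; omega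

theorem length_le_size_ofList {α : Type} (g : α → Data) (l : List α) :
    l.length ≤ (ofList g l).size := by
  induction l with
  | nil => simp
  | cons a l ih => simp only [ofList, size_pair, List.length_cons]; omega

theorem size_le_size_ofList {α : Type} (g : α → Data) {l : List α} {a : α} (h : a ∈ l) :
    (g a).size ≤ (ofList g l).size := by
  induction l with
  | nil => simp at h
  | cons b l ih =>
    simp only [ofList, size_pair]
    rcases List.mem_cons.1 h with rfl | h
    · omega
    · have := ih h; omega

theorem size_ofList_drop_le {α : Type} (g : α → Data) (l : List α) (k : ℕ) :
    (ofList g (l.drop k)).size ≤ (ofList g l).size := by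
  rw [size_ofList, size_ofList]
  gcongr
  exact ((List.drop_sublist k l).map _).sum_le_sum (fun _ _ => Nat.zero_le _)

end Data

/-! ### Polynomial bounds -/

/-- `k i` is bounded by a polynomial in the size of `x i`. -/
def PolyBdd {ι : Type} (x : ι → Data) (k : ι → ℕ) : Prop :=
  ∃ p : Polynomial ℕ, ∀ i, k i ≤ p.eval (x i).size

/-- The coefficients are natural numbers, hence nonnegative. Monotonicity is what lets polynomial
bounds be composed. -/
theorem Polynomial.eval_nat_mono (p : Polynomial ℕ) : Monotone fun k => p.eval k := by
  intro a b h
  simp only [Polynomial.eval_eq_sum, Polynomial.sum]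
  gcongr

namespace PolyBdd

variable {ι κ : Type} {x y : ι → Data} {k k' : ι → ℕ}

theorem mono (hk : PolyBdd x k') (h : ∀ i, k i ≤ k' i) : PolyBdd x k :=
  hk.imp fun _ hp i => (h i).trans (hp i)

theorem const (c : ℕ) : PolyBdd x fun _ => c := ⟨Polynomial.C c, by simp⟩

theorem size : PolyBdd x fun i => (x i).size := ⟨Polynomial.X, by simp⟩

theorem add (hk : PolyBdd x k) (hk' : PolyBdd x k') : PolyBdd x fun i => k i + k' i := by
  obtain ⟨p, hp⟩ := hk
  obtain ⟨p', hp'⟩ := hk'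
  exact ⟨p + p', fun i => by simpa using Nat.add_le_add (hp i) (hp' i)⟩

theorem mul (hk : PolyBdd x k) (hk' : PolyBdd x k') : PolyBdd x fun i => k i * k' i := by
  obtain ⟨p, hp⟩ := hk
  obtain ⟨p', hp'⟩ := hk'
  exact ⟨p * p', fun i => by simpa using Nat.mul_le_mul (hp i) (hp' i)⟩

theorem trans (hk : PolyBdd y k) (h : PolyBdd x fun i => (y i).size) : PolyBdd x k := by
  obtain ⟨p, hp⟩ := hk
  obtain ⟨q, hq⟩ := h
  refine ⟨p.comp q, fun i => (hp i).trans ?_⟩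
  rw [Polynomial.eval_comp]
  exact p.eval_nat_mono (hq i)

theorem reindex (hk : PolyBdd x k) (φ : κ → ι) : PolyBdd (fun j => x (φ j)) fun j => k (φ j) :=
  hk.imp fun _ hp j => hp (φ j)

end PolyBdd

/-! ### Polynomial-time computable families of trees -/

/-- One program computes `y i` from `x i`, for every `i`, in polynomial time (and the outputs have
polynomial size). -/
def PolyFrom {ι : Type} (x y : ι → Data) : Prop :=
  ∃ (P : Prog) (t : ι → ℕ), (∀ i, P.Runs (x i) (y i) (t i)) ∧ PolyBdd x t ∧
    PolyBdd x fun i => (y i).size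

namespace PolyFrom

open Data

variable {ι κ : Type} {x y z : ι → Data}

theorem size_bdd (h : PolyFrom x y) : PolyBdd x fun i => (y i).size := h.choose_spec.choose_spec.2.2

theorem refl (x : ι → Data) : PolyFrom x x :=
  ⟨.id, fun _ => 1, fun _ => .id _, .const 1, .size⟩

theorem trans (hxy : PolyFrom x y) (hyz : PolyFrom y z) : PolyFrom x z := by
  obtain ⟨P, t, hP, ht, hs⟩ := hxy
  obtain ⟨P', t', hP', ht', hs'⟩ := hyz
  exact ⟨.seq P P', fun i => t i + t' i + 1, fun i => .seq _ _ _ _ _ _ _ (hP i) (hP' i),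
    (ht.add (ht'.trans hs)).add (.const 1), hs'.trans hs⟩

/-- Stating computability for families, not for functions on all trees, allows a program to be
correct only on a restricted set of inputs; changing the index set expresses such restrictions. -/
theorem reindex (h : PolyFrom x y) (φ : κ → ι) : PolyFrom (fun j => x (φ j)) fun j => y (φ j) := by
  obtain ⟨P, t, hP, ht, hs⟩ := h
  exact ⟨P, fun j => t (φ j), fun j => hP _, ht.reindex φ, hs.reindex φ⟩

theorem congr {y' : ι → Data} (h : PolyFrom x y) (e : ∀ i, y' i = y i) : PolyFrom x y' := by
  rwa [funext e]

theorem int (c : ℤ) : PolyFrom x fun _ => .int c :=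
  ⟨.const c, fun _ => 1, fun _ => .const _ _, .const 1, .const _⟩

theorem pair (hy : PolyFrom x y) (hz : PolyFrom x z) : PolyFrom x fun i => .pair (y i) (z i) := by
  obtain ⟨P, t, hP, ht, hs⟩ := hy
  obtain ⟨P', t', hP', ht', hs'⟩ := hz
  exact ⟨.pair P P', fun i => t i + t' i + 1, fun i => .pair _ _ _ _ _ _ _ (hP i) (hP' i),
    (ht.add ht').add (.const 1), ((PolyBdd.const 1).add hs).add hs'⟩

theorem fst (h : PolyFrom x fun i => .pair (y i) (z i)) : PolyFrom x y :=
  h.trans ⟨.fst, fun _ => 1, fun _ => .fst _ _, .const 1,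
    PolyBdd.size.mono fun i => by simp only [size_pair]; omega⟩

theorem snd (h : PolyFrom x fun i => .pair (y i) (z i)) : PolyFrom x z :=
  h.trans ⟨.snd, fun _ => 1, fun _ => .snd _ _, .const 1,
    PolyBdd.size.mono fun i => by simp only [size_pair]; omega⟩

-- Arithmetic on integer leaves

section arithmetic

variable {a b : ι → ℤ}

theorem polyBdd_left (a b : ι → ℤ) :
    PolyBdd (fun i => Data.pair (.int (a i)) (.int (b i))) fun i => 1 + bitLength (a i) :=
  PolyBdd.size.mono fun i => by simp only [size_pair, size_int]; omega

theorem polyBdd_right (a b : ι → ℤ) :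
    PolyBdd (fun i => Data.pair (.int (a i)) (.int (b i))) fun i => 1 + bitLength (b i) :=
  PolyBdd.size.mono fun i => by simp only [size_pair, size_int]; omega

theorem add (ha : PolyFrom x fun i => .int (a i)) (hb : PolyFrom x fun i => .int (b i)) :
    PolyFrom x fun i => .int (a i + b i) :=
  (ha.pair hb).trans ⟨.add, fun i => arithCost (a i) (b i), fun i => .add _ _,
    (polyBdd_left a b).mul (polyBdd_right a b), ((polyBdd_left a b).add (polyBdd_right a b)).mono
        fun i => by
      have := bitLength_add_le (a i) (b i)
      simp only [size_int]; omega⟩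

theorem sub (ha : PolyFrom x fun i => .int (a i)) (hb : PolyFrom x fun i => .int (b i)) :
    PolyFrom x fun i => .int (a i - b i) :=
  (ha.pair hb).trans ⟨.sub, fun i => arithCost (a i) (b i), fun i => .sub _ _,
    (polyBdd_left a b).mul (polyBdd_right a b), ((polyBdd_left a b).add (polyBdd_right a b)).mono
        fun i => by
      have := bitLength_sub_le (a i) (b i)
      simp only [size_int]; omega⟩

theorem mul (ha : PolyFrom x fun i => .int (a i)) (hb : PolyFrom x fun i => .int (b i)) :
    PolyFrom x fun i => .int (a i * b i) :=
  (ha.pair hb).trans ⟨.mul, fun i => arithCost (a i) (b i), fun i => .mul _ _,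
    (polyBdd_left a b).mul (polyBdd_right a b), ((polyBdd_left a b).add (polyBdd_right a b)).mono
        fun i => by
      have := bitLength_mul_le (a i) (b i)
      simp only [size_int]; omega⟩

end arithmetic

/-- Case distinction in which each branch has to work only where it is used. -/
theorem cond {c : ι → ℤ} (hc : PolyFrom x fun i => .int (c i))
    (hp : PolyFrom (fun i : {i // 0 < c i} => x i) fun i => y i)
    (hn : PolyFrom (fun i : {i // c i ≤ 0} => x i) fun i => y i) : PolyFrom x y := by
  obtain ⟨C, t, hC, ht, -⟩ := hc
  obtain ⟨P, t₁, hP, ⟨p₁, ht₁⟩, ⟨q₁, hs₁⟩⟩ := hp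
  obtain ⟨P', t₂, hP', ⟨p₂, ht₂⟩, ⟨q₂, hs₂⟩⟩ := hn
  refine ⟨.cond C P P', fun i => t i + (if h : 0 < c i then t₁ ⟨i, h⟩ else
    t₂ ⟨i, not_lt.1 h⟩) + 1, fun i => ?_, (ht.add ⟨p₁ + p₂, fun i => ?_⟩).add (.const 1),
    ⟨q₁ + q₂, fun i => ?_⟩⟩
  · dsimp only
    split_ifs with h
    · exact .cond_pos _ _ _ _ _ _ _ _ h (hC i) (hP ⟨i, h⟩)
    · exact .cond_nonpos _ _ _ _ _ _ _ _ (not_lt.1 h) (hC i) (hP' ⟨i, not_lt.1 h⟩)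
  · rw [Polynomial.eval_add]
    split_ifs with h
    · exact (ht₁ ⟨i, h⟩).trans (Nat.le_add_right _ _)
    · exact (ht₂ ⟨i, not_lt.1 h⟩).trans (Nat.le_add_left _ _)
  · rw [Polynomial.eval_add]
    by_cases h : 0 < c i
    · exact (hs₁ ⟨i, h⟩).trans (Nat.le_add_right _ _)
    · exact (hs₂ ⟨i, not_lt.1 h⟩).trans (Nat.le_add_left _ _)

theorem ite {q : ι → Prop} [DecidablePred q] (hq : PolyFrom x fun i => ofBool (decide (q i)))
    (hy : PolyFrom x y) (hz : PolyFrom x z) : PolyFrom x fun i => if q i then y i else z i := by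
  refine cond hq ((hy.reindex _).congr fun i => ?_) ((hz.reindex _).congr fun i => ?_)
  · have := i.2
    by_cases h : q i <;> simp_all
  · have := i.2
    by_cases h : q i <;> simp_all

theorem ofBool_pos {a : ι → ℤ} (ha : PolyFrom x fun i => .int (a i)) :
    PolyFrom x fun i => ofBool (decide (0 < a i)) :=
  cond ha ((int 1).congr fun i => by simp [i.2, ofBool])
    ((int 0).congr fun i => by simp [i.2, ofBool])

theorem ofBool_lt {a b : ι → ℤ} (ha : PolyFrom x fun i => .int (a i))
    (hb : PolyFrom x fun i => .int (b i)) : PolyFrom x fun i => ofBool (decide (a i < b i)) :=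
  (ofBool_pos (hb.sub ha)).congr fun i => by simp

theorem ofBool_le {a b : ι → ℤ} (ha : PolyFrom x fun i => .int (a i))
    (hb : PolyFrom x fun i => .int (b i)) : PolyFrom x fun i => ofBool (decide (a i ≤ b i)) :=
  (ofBool_lt ha (hb.add (int 1))).congr fun i => by simp

theorem ofBool_and {a b : ι → Bool} (ha : PolyFrom x fun i => ofBool (a i))
    (hb : PolyFrom x fun i => ofBool (b i)) : PolyFrom x fun i => ofBool (a i && b i) :=
  (mul ha hb).congr fun i => by cases a i <;> cases b i <;> rfl

theorem ofBool_not {a : ι → Bool} (ha : PolyFrom x fun i => ofBool (a i)) :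
    PolyFrom x fun i => ofBool (!a i) :=
  (sub (int 1) ha).congr fun i => by cases a i <;> rfl

theorem ofBool_eq {a b : ι → ℤ} (ha : PolyFrom x fun i => .int (a i))
    (hb : PolyFrom x fun i => .int (b i)) : PolyFrom x fun i => ofBool (decide (a i = b i)) :=
  (ofBool_and (ofBool_le ha hb) (ofBool_le hb ha)).congr fun i => by
    rw [← Bool.decide_and, decide_eq_decide.2 le_antisymm_iff]

/-- The empty list is encoded by a leaf and every other list by a pair, so the pair test decides
emptiness. -/
theorem ofBool_isEmpty {α : ι → Type} {g : ∀ i, α i → Data} {l : ∀ i, List (α i)}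
    (h : PolyFrom x fun i => ofList (g i) (l i)) : PolyFrom x fun i => ofBool (l i).isEmpty :=
  have h' : PolyFrom x fun i => ofBool (!(l i).isEmpty) :=
    h.trans ⟨.isPair, fun _ => 1, fun i => by
      dsimp only
      rcases l i with _ | ⟨a, l'⟩
      · exact .isPair_int _
      · exact .isPair_pair _ _, .const 1, .mono (.const 2) fun _ => size_ofBool_le _⟩
  (ofBool_not h').congr fun i => by rw [Bool.not_not]

/-- Iterates the step from `s i k` to `s i (k + 1)` until `k = K i`. -/
theorem loop (s : ι → ℕ → Data) (K : ι → ℕ) (c : ι → ℕ → ℤ) (h0 : PolyFrom x fun i => s i 0)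
    (hK : PolyBdd x K)
    (hs : PolyBdd (fun z : {z : ι × ℕ // z.2 ≤ K z.1} => x z.1.1) fun z => (s z.1.1 z.1.2).size)
    (hc : PolyFrom (fun z : {z : ι × ℕ // z.2 ≤ K z.1} => s z.1.1 z.1.2)
      fun z => .int (c z.1.1 z.1.2))
    (hpos : ∀ i k, k < K i → 0 < c i k) (hneg : ∀ i, c i (K i) ≤ 0)
    (hf : PolyFrom (fun z : {z : ι × ℕ // z.2 < K z.1} => s z.1.1 z.1.2)
      fun z => s z.1.1 (z.1.2 + 1)) : PolyFrom x fun i => s i (K i) := by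
  obtain ⟨C, t, hC, ht, -⟩ := hc
  obtain ⟨F, u, hF, hu, -⟩ := hf
  -- Through the uniform bound on the states, each test and each step costs at most a polynomial in
  -- the original input, not merely in the current state.
  obtain ⟨p, hp⟩ := ht.trans hs
  obtain ⟨q, hq⟩ := hu.trans (hs.reindex fun z : {z : ι × ℕ // z.2 < K z.1} => ⟨z.1, z.2.le⟩)
  -- Induction on the number `d` of remaining steps, since a run of a loop unfolds from its first
  -- step.
  have key : ∀ i d k, k + d = K i → ∃ T, (Prog.loop C F).Runs (s i k) (s i (K i)) T ∧
      T ≤ (d + 1) * (p.eval (x i).size + q.eval (x i).size + 1) := by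
    intro i d
    induction d with
    | zero =>
      intro k hk
      obtain rfl : k = K i := hk
      refine ⟨_, .loop_done _ _ _ _ _ (hneg i) (hC ⟨(i, K i), le_rfl⟩), ?_⟩
      have := hp ⟨(i, K i), le_rfl⟩
      simp only at this
      omega
    | succ d ih =>
      intro k hk
      obtain ⟨T, hT, hT'⟩ := ih (k + 1) (by omega)
      have hlt : k < K i := by omega
      refine ⟨_, .loop_step _ _ _ _ _ _ _ _ _ (hpos i k hlt) (hC ⟨(i, k), hlt.le⟩)
        (hF ⟨(i, k), hlt⟩) hT, ?_⟩
      have h1 := hp ⟨(i, k), hlt.le⟩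
      have h2 := hq ⟨(i, k), hlt⟩
      simp only at h1 h2
      rw [Nat.succ_mul]
      omega
  choose T hT hT' using fun i => key i (K i) 0 (zero_add _)
  obtain ⟨P, v, hP, hv, -⟩ := h0
  refine ⟨.seq P (.loop C F), fun i => v i + T i + 1,
    fun i => .seq _ _ _ _ _ _ _ (hP i) (hT i), (hv.add (.mono ?_ hT')).add (.const 1),
    hs.reindex fun i => ⟨(i, K i), le_rfl⟩⟩
  exact (hK.add (.const 1)).mul (.add (.add ⟨p, fun _ => le_rfl⟩ ⟨q, fun _ => le_rfl⟩) (.const 1))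

/-- Left folds over lists. The step is computed from the context `c`, the element and the state. -/
theorem foldl {α σ : ι → Type} {c : ι → Data} {g : ∀ i, α i → Data} {h : ∀ i, σ i → Data}
    {l : ∀ i, List (α i)} {s : ∀ i, σ i} {f : ∀ i, σ i → α i → σ i}
    (hc : PolyFrom x c) (hl : PolyFrom x fun i => ofList (g i) (l i))
    (hs : PolyFrom x fun i => h i (s i))
    (hb : PolyBdd (fun z : ι × ℕ => x z.1)
      fun z => (h z.1 (((l z.1).take z.2).foldl (f z.1) (s z.1))).size)
    (step : PolyFrom (fun z : Σ i, α i × σ i => .pair (c z.1) (.pair (g _ z.2.1) (h _ z.2.2)))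
      fun z => h _ (f _ z.2.2 z.2.1)) : PolyFrom x fun i => h i ((l i).foldl (f i) (s i)) := by
  -- The loop state consists of the context, the rest of the list and the accumulator; the loop runs
  -- as long as the rest is nonempty.
  have main := loop (x := x)
    (fun i k => .pair (c i) (.pair (ofList (g i) ((l i).drop k))
      (h i (((l i).take k).foldl (f i) (s i)))))
    (fun i => (l i).length) (fun i k => if !((l i).drop k).isEmpty then 1 else 0)
    (hc.pair (hl.pair hs)) (hl.size_bdd.mono fun i => length_le_size_ofList _ _) ?_ ?_ ?_ ?_ ?_
  · simpa using main.snd.snd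
  · let π : {z : ι × ℕ // z.2 ≤ (l z.1).length} → ι := fun z => z.1.1
    refine ((((PolyBdd.const 2).add (hc.size_bdd.reindex π)).add
      (hl.size_bdd.reindex π)).add (hb.reindex Subtype.val)).mono fun z => ?_
    have := size_ofList_drop_le (g z.1.1) (l z.1.1) z.1.2
    simp only [size_pair, π]
    omega
  · exact ofBool_not (ofBool_isEmpty (PolyFrom.refl _).snd.fst)
  · intro i k hk
    simp [hk]
  · intro i
    simp
  · have e : ∀ z : {z : ι × ℕ // z.2 < (l z.1).length}, (l z.1.1).drop z.1.2 =
        (l z.1.1)[z.1.2]'z.2 :: (l z.1.1).drop (z.1.2 + 1) := fun z => List.drop_eq_getElem_cons z.2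
    simp only [e, ofList]
    have r := PolyFrom.refl (fun z : {z : ι × ℕ // z.2 < (l z.1).length} =>
      Data.pair (c z.1.1) (.pair (.pair (g _ ((l z.1.1)[z.1.2]'z.2))
        (ofList (g z.1.1) ((l z.1.1).drop (z.1.2 + 1))))
        (h _ (((l z.1.1).take z.1.2).foldl (f z.1.1) (s z.1.1)))))
    refine r.fst.pair (r.snd.fst.snd.pair ?_)
    refine (((r.fst.pair (r.snd.fst.fst.pair r.snd.snd)).trans (step.reindex fun
      z : {z : ι × ℕ // z.2 < (l z.1).length} => ⟨z.1.1, (l z.1.1)[z.1.2]'z.2,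
        ((l z.1.1).take z.1.2).foldl (f z.1.1) (s z.1.1)⟩))).congr fun z => ?_
    rw [List.take_succ_eq_append_getElem z.2, List.foldl_append]
    rfl

/-- Additive growth per step is harmless: after at most as many steps as the list has elements, the
measure is still polynomial. Bounding the output of a single step by a polynomial in its state would
not suffice, since such bounds compound. -/
theorem foldl_of_measure {α σ : ι → Type} {c : ι → Data} {g : ∀ i, α i → Data}
    {h : ∀ i, σ i → Data} {l : ∀ i, List (α i)} {s : ∀ i, σ i} {f : ∀ i, σ i → α i → σ i}
    (μ : ∀ i, σ i → ℕ) (C : ℕ) (B : ι → ℕ)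
    (hc : PolyFrom x c) (hl : PolyFrom x fun i => ofList (g i) (l i))
    (hs : PolyFrom x fun i => h i (s i)) (hB : PolyBdd x B) (hμ : PolyBdd x fun i => μ i (s i))
    (hh : ∀ i s, (h i s).size ≤ C * μ i s + C)
    (hf : ∀ i s, ∀ a ∈ l i, μ i (f i s a) ≤ μ i s + B i)
    (step : PolyFrom (fun z : Σ i, α i × σ i => .pair (c z.1) (.pair (g _ z.2.1) (h _ z.2.2)))
      fun z => h _ (f _ z.2.2 z.2.1)) : PolyFrom x fun i => h i ((l i).foldl (f i) (s i)) := by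
  refine foldl hc hl hs ?_ step
  have hlen : PolyBdd x fun i => (l i).length :=
    hl.size_bdd.mono fun i => length_le_size_ofList _ _
  refine ((((PolyBdd.const C).mul (hμ.add (hlen.mul hB))).add (.const C)).reindex Prod.fst).mono ?_
  rintro ⟨i, k⟩
  have key : ∀ (l' : List (α i)) (s : σ i), l' ⊆ l i →
      μ i (l'.foldl (f i) s) ≤ μ i s + l'.length * B i := by
    intro l'
    induction l' with
    | nil => simp
    | cons a l' ih =>
      intro s hs
      rw [List.cons_subset] at hs
      have h1 := ih (f i s a) hs.2
      have h2 := hf i s a hs.1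
      rw [List.foldl_cons, List.length_cons, Nat.succ_mul]
      omega
  refine (hh _ _).trans ?_
  have h1 := key _ (s i) (List.take_subset k (l i))
  have h2 : ((l i).take k).length ≤ (l i).length := by simp
  simp only
  gcongr
  exact h1.trans (by gcongr)

-- Operations on encoded lists

section lists

variable {α β : ι → Type} {g : ∀ i, α i → Data} {g' : ∀ i, β i → Data} {l : ∀ i, List (α i)}
  {l' : ∀ i, List (β i)}

theorem reverse (hl : PolyFrom x fun i => ofList (g i) (l i)) :
    PolyFrom x fun i => ofList (g i) (l i).reverse := by
  have e : ∀ i, (l i).reverse = (l i).foldl (fun acc a => a :: acc) [] := fun i => by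
    rw [List.foldl_eq_foldr_reverse, List.foldr_cons_eq_append, List.append_nil]
    simp
  simp only [e]
  refine foldl_of_measure (fun i s => (ofList (g i) s).size) 1
    (fun i => 1 + (ofList (g i) (l i)).size) (int 0) hl (int 0) ((PolyBdd.const 1).add hl.size_bdd)
    (.const 1) (fun i s => by omega) (fun i s a ha => ?_)
    ((refl _).snd.fst.pair (refl _).snd.snd)
  have := size_le_size_ofList (g i) ha
  simp only [ofList, size_pair]
  omega

theorem append_singleton {a : ∀ i, α i} (hl : PolyFrom x fun i => ofList (g i) (l i))
    (ha : PolyFrom x fun i => g i (a i)) : PolyFrom x fun i => ofList (g i) (l i ++ [a i]) :=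
  (reverse (l := fun i => a i :: (l i).reverse) (ha.pair hl.reverse)).congr fun i => by simp

theorem of_cons {y : ι → Data} (hl : PolyFrom x fun i => ofList (g i) (l i))
    (hnil : PolyFrom (fun i : {i // l i = []} => x i) fun i => y i)
    (hcons : PolyFrom (fun i : {i // l i ≠ []} => x i) fun i => y i) : PolyFrom x y :=
  cond hl.ofBool_isEmpty
    (hnil.reindex fun i : {i // (0 : ℤ) < if (l i).isEmpty = true then 1 else 0} =>
      ⟨i.1, List.isEmpty_iff.1 (by_contra fun h => by simpa [h] using i.2)⟩)
    (hcons.reindex fun i : {i // (if (l i).isEmpty = true then (1 : ℤ) else 0) ≤ 0} =>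
      ⟨i.1, fun h => by simpa [h] using i.2⟩)

theorem head (h : ∀ i, l i ≠ []) (hl : PolyFrom x fun i => ofList (g i) (l i)) :
    PolyFrom x fun i => g i ((l i).head (h i)) :=
  fst (z := fun i => ofList (g i) (l i).tail) (hl.congr fun i => by
    conv_rhs => rw [← List.cons_head_tail (h i)]
    rfl)

theorem tail (hl : PolyFrom x fun i => ofList (g i) (l i)) :
    PolyFrom x fun i => ofList (g i) (l i).tail := by
  refine of_cons hl ((int 0).congr fun i => by simp [i.2, ofList])
    (snd (y := fun i => g i.1 ((l i.1).head i.2)) ((hl.reindex Subtype.val).congr fun i => ?_))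
  conv_rhs => rw [← List.cons_head_tail i.2]
  rfl

theorem headD {d : ∀ i, α i} (hl : PolyFrom x fun i => ofList (g i) (l i))
    (hd : PolyFrom x fun i => g i (d i)) : PolyFrom x fun i => g i ((l i).headD (d i)) := by
  refine of_cons hl ((hd.reindex Subtype.val).congr fun i => by simp [i.2])
    ((head (l := fun i : {i // l i ≠ []} => l i) Subtype.prop (hl.reindex Subtype.val)).congr
      fun i => by rw [List.headD_eq_head?_getD, List.head?_eq_some_head i.2]; rfl)

theorem getD {k : ι → ℕ} {d : ∀ i, α i} (hl : PolyFrom x fun i => ofList (g i) (l i))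
    (hk : PolyFrom x fun i => ofNat (k i)) (hd : PolyFrom x fun i => g i (d i)) :
    PolyFrom x fun i => g i ((l i).getD (k i) (d i)) := by
  -- The state is a counter together with the answer found so far, initially the default.
  have main := foldl_of_measure (σ := fun i => ℕ × α i) (s := fun i => (0, d i))
    (h := fun i s => .pair (ofNat s.1) (g i s.2))
    (f := fun i s a => (s.1 + 1, if s.1 = k i then a else s.2))
    (fun i s => s.1 + (g i s.2).size) 2 (fun i => 1 + (ofList (g i) (l i)).size)
    hk hl ((int 0).pair hd) ((PolyBdd.const 1).add hl.size_bdd)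
    (hd.size_bdd.mono fun i => by simp) (fun i s => ?_) (fun i s a ha => ?_) ?_
  · refine main.snd.congr fun i => ?_
    have key : ∀ (l : List (α i)) (j : ℕ) (d : α i),
        (l.foldl (fun s a => (s.1 + 1, if s.1 = k i then a else s.2)) (j, d)).2 =
          if j ≤ k i then l.getD (k i - j) d else d := by
      intro l
      induction l with
      | nil => simp
      | cons a l ih =>
        intro j d
        rw [List.foldl_cons, ih]
        rcases lt_trichotomy j (k i) with h | h | h
        · rw [if_pos (by omega), if_pos h.le, if_neg h.ne,
            show k i - j = k i - (j + 1) + 1 by omega, List.getD_cons_succ]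
        · subst h
          simp
        · rw [if_neg (by omega), if_neg (by omega), if_neg (by omega)]
    rw [key, if_pos (Nat.zero_le _), Nat.sub_zero]
  · have := size_ofNat_le s.1
    simp only [size_pair]
    omega
  · have := size_le_size_ofList (g i) ha
    simp only
    split_ifs <;> omega
  · refine pair ((refl _).snd.snd.fst.add (int 1)) ?_
    refine (ite (ofBool_eq (refl _).snd.snd.fst (refl _).fst) (refl _).snd.fst
      (refl _).snd.snd.snd).congr fun z => ?_
    simp only [Nat.cast_inj]
    exact apply_ite _ _ _ _

/-- A fold over the first list whose state holds the unused part of the second list and the pairs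
formed so far, in reverse order. -/
theorem zip (hl : PolyFrom x fun i => ofList (g i) (l i))
    (hl' : PolyFrom x fun i => ofList (g' i) (l' i)) :
    PolyFrom x fun i => ofList (fun z => .pair (g i z.1) (g' i z.2)) ((l i).zip (l' i)) := by
  let h : ∀ i, List (β i) × List (α i × β i) → Data := fun i s =>
    .pair (ofList (g' i) s.1) (ofList (fun z => .pair (g i z.1) (g' i z.2)) s.2)
  let f : ∀ i, List (β i) × List (α i × β i) → α i → List (β i) × List (α i × β i) :=
    fun i s a => (s.1.tail, match s.1 with
      | [] => s.2
      | b :: _ => (a, b) :: s.2)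
  have main := foldl_of_measure (σ := fun i => List (β i) × List (α i × β i))
    (s := fun i => (l' i, [])) (h := h) (f := f) (fun i s => (h i s).size) 1
    (fun i => 2 + (ofList (g i) (l i)).size) (int 0) hl (hl'.pair (int 0))
    ((PolyBdd.const 2).add hl.size_bdd)
    (((PolyBdd.const 2).add hl'.size_bdd).mono fun i => by
      simp only [h, size_pair, ofList, size_int, bitLength_zero]; omega)
    (fun i s => by omega) (fun i s a ha => ?_) ?_
  · refine main.snd.reverse.congr fun i => ?_
    have key : ∀ (l : List (α i)) (s : List (β i) × List (α i × β i)),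
        (l.foldl (f i) s).2 = (l.zip s.1).reverse ++ s.2 := by
      intro l
      induction l with
      | nil => simp
      | cons a l ih =>
        rintro ⟨_ | ⟨b, t⟩, acc⟩ <;> simp [ih, f]
    rw [key]
    simp
  -- The element `b` only moves from the second list to the output, so the total size grows by
  -- little more than that of `a`.
  · have := size_le_size_ofList (g i) ha
    rcases s with ⟨_ | ⟨b, t⟩, acc⟩ <;> simp only [f, h, ofList, size_pair, List.tail] <;> omega
  · have r := refl fun z : Σ i, α i × (List (β i) × List (α i × β i)) =>
      Data.pair (.int 0) (.pair (g _ z.2.1) (h _ z.2.2))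
    refine pair r.snd.snd.fst.tail ?_
    refine of_cons r.snd.snd.fst ((r.snd.snd.snd.reindex _).congr fun z => ?_)
      ((pair ((r.snd.fst.reindex _).pair (head Subtype.prop (r.snd.snd.fst.reindex _)))
        (r.snd.snd.snd.reindex _)).congr fun z => ?_)
    · obtain ⟨⟨i, a, s, acc⟩, hz : s = []⟩ := z
      subst hz
      rfl
    · obtain ⟨⟨i, a, s, acc⟩, hz : s ≠ []⟩ := z
      obtain ⟨b, t, rfl⟩ := List.exists_cons_of_ne_nil hz
      rfl

end lists

end PolyFrom

/-! ### Tables whose entries are computed from the preceding ones -/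

section table

variable {α β : Type*} (F : List β → α → β)

theorem foldl_table_append (M : List α) (L : List β) :
    ∃ L', (M.foldl (fun vals a => vals ++ [F vals a]) L) = L ++ L' ∧ L'.length = M.length := by
  induction M generalizing L with
  | nil => exact ⟨[], by simp⟩
  | cons a M ih =>
    obtain ⟨L', h, h'⟩ := ih (L ++ [F L a])
    exact ⟨F L a :: L', by simp [h], by simp [h']⟩

theorem length_foldl_table (N : List α) :
    (N.foldl (fun vals a => vals ++ [F vals a]) []).length = N.length := by
  obtain ⟨L', h, h'⟩ := foldl_table_append F N []
  rw [h, List.nil_append, h']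

theorem foldl_table_prefix {N N' : List α} (h : N <+: N') :
    N.foldl (fun vals a => vals ++ [F vals a]) [] <+:
      N'.foldl (fun vals a => vals ++ [F vals a]) [] := by
  obtain ⟨M, rfl⟩ := h
  rw [List.foldl_append]
  obtain ⟨L', h, -⟩ := foldl_table_append F M (N.foldl (fun vals a => vals ++ [F vals a]) [])
  exact ⟨L', h.symm⟩

/-- Entries depend only on earlier ones, so appending nodes never changes what was computed for the
old nodes. -/
theorem getD_foldl_table_of_prefix {N N' : List α} (h : N <+: N') {i : ℕ} (hi : i < N.length)
    (d : β) : (N'.foldl (fun vals a => vals ++ [F vals a]) []).getD i d =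
      (N.foldl (fun vals a => vals ++ [F vals a]) []).getD i d := by
  obtain ⟨L, hL⟩ := foldl_table_prefix F h
  rw [← hL, List.getD_append _ _ _ _ (by rwa [length_foldl_table])]

theorem getD_foldl_table_length (N : List α) (a : α) (d : β) :
    ((N ++ [a]).foldl (fun vals a => vals ++ [F vals a]) []).getD N.length d =
      F (N.foldl (fun vals a => vals ++ [F vals a]) []) a := by
  rw [List.foldl_append, List.foldl_cons, List.foldl_nil,
    List.getD_append_right _ _ _ _ (by rw [length_foldl_table]), length_foldl_table]
  simp

end table

/-! ### Unnormalised fractions -/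

/-- A quotient of two integers, not necessarily in lowest terms. -/
abbrev Fraction : Type := ℤ × ℤ

namespace Fraction

def add (a b : Fraction) : Fraction := (a.1 * b.2 + b.1 * a.2, a.2 * b.2)

def mul (a b : Fraction) : Fraction := (a.1 * b.1, a.2 * b.2)

def le (a b : Fraction) : Bool := decide (a.1 * b.2 ≤ b.1 * a.2)

def ofRat (r : ℚ) : Fraction := (r.num, r.den)

def bits (a : Fraction) : ℕ := max (bitLength a.1) (bitLength a.2)

def toData (a : Fraction) : Data := .pair (.int a.1) (.int a.2)

/-- Without reduction to lowest terms, bit lengths add up in sums as well as in products. This is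
affordable when every intermediate result is used once. -/
theorem bits_add_le (a b : Fraction) : (add a b).bits ≤ a.bits + b.bits + 1 := by
  have h1 := bitLength_add_le (a.1 * b.2) (b.1 * a.2)
  have h2 := bitLength_mul_le a.1 b.2
  have h3 := bitLength_mul_le b.1 a.2
  have h4 := bitLength_mul_le a.2 b.2
  simp only [bits, add]
  omega

theorem bits_mul_le (a b : Fraction) : (mul a b).bits ≤ a.bits + b.bits := by
  have h1 := bitLength_mul_le a.1 b.1
  have h2 := bitLength_mul_le a.2 b.2
  simp only [bits, mul]
  omega

theorem size_toData_le (a : Fraction) : a.toData.size ≤ 3 + 2 * a.bits := by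
  simp only [toData, Data.size_pair, Data.size_int, bits]
  omega

theorem bits_add_three_le_size (a : Fraction) : a.bits + 3 ≤ a.toData.size := by
  simp only [toData, Data.size_pair, Data.size_int, bits]
  omega

end Fraction

namespace PolyFrom

variable {ι : Type} {x : ι → Data} {a b : ι → Fraction}

theorem fractionAdd (ha : PolyFrom x fun i => (a i).toData) (hb : PolyFrom x fun i => (b i).toData)
    :
    PolyFrom x fun i => (Fraction.add (a i) (b i)).toData :=
  pair (add (mul ha.fst hb.snd) (mul hb.fst ha.snd)) (mul ha.snd hb.snd)

theorem fractionMul (ha : PolyFrom x fun i => (a i).toData) (hb : PolyFrom x fun i => (b i).toData)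
    :
    PolyFrom x fun i => (Fraction.mul (a i) (b i)).toData :=
  pair (mul ha.fst hb.fst) (mul ha.snd hb.snd)

theorem fractionLe (ha : PolyFrom x fun i => (a i).toData) (hb : PolyFrom x fun i => (b i).toData) :
    PolyFrom x fun i => .ofBool (Fraction.le (a i) (b i)) :=
  ofBool_le (mul ha.fst hb.snd) (mul hb.fst ha.snd)

end PolyFrom

/-! ### The evaluation of a network -/

/-- Evidence, a query variable with the value whose conditional probability is to be maximised, and
the objective `b * A - a * B` for the pairs `(A, B)` of probabilities of the evidence together with
the target value and with the other value of the query variable. -/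
structure Objective (n : ℕ) : Type where
  evidence : Fin n → Option Bool
  var : Fin n
  target : Bool
  a : ℤ
  b : ℤ

/-- What is stored for a node. If the query variable is below the node (`hasQuery`), a pair `(A, B)`
that maximises the objective, and otherwise the lower and the upper probability of the evidence. -/
structure NodeBound : Type where
  hasQuery : Bool
  fst : Fraction
  snd : Fraction

namespace NodeBound

def bits (u : NodeBound) : ℕ := max u.fst.bits u.snd.bits

def toData (u : NodeBound) : Data := .pair (.ofBool u.hasQuery) (.pair u.fst.toData u.snd.toData)

theorem size_toData_le (u : NodeBound) : u.toData.size ≤ 10 * u.bits + 10 := by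
  have h1 := u.fst.size_toData_le
  have h2 := u.snd.size_toData_le
  have h3 := Data.size_ofBool_le u.hasQuery
  simp only [toData, Data.size_pair, bits]
  omega

theorem bits_le_size (u : NodeBound) : u.bits ≤ u.toData.size := by
  have h1 := u.fst.bits_add_three_le_size
  have h2 := u.snd.bits_add_three_le_size
  simp only [toData, Data.size_pair, bits]
  omega

def zero : NodeBound := ⟨false, (0, 1), (0, 1)⟩

def one : NodeBound := ⟨false, (1, 1), (1, 1)⟩

theorem bits_getD_le (vals : List NodeBound) (c : ℕ) :
    (vals.getD c zero).bits ≤ (Data.ofList toData vals).size := by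
  by_cases h : c < vals.length
  · rw [List.getD_eq_getElem _ _ h]
    exact (bits_le_size _).trans (Data.size_le_size_ofList toData (List.getElem_mem h))
  · rw [List.getD_eq_default _ _ (not_lt.1 h), Data.size_ofList]
    exact Nat.le_add_right _ _

/-- The sum of `u` and the multiple of `v` by `r`. -/
def addMul (u : NodeBound) (r : Fraction) (v : NodeBound) : NodeBound :=
  ⟨v.hasQuery, u.fst.add (r.mul v.fst), u.snd.add (r.mul v.snd)⟩

theorem bits_addMul_le (u : NodeBound) (r : Fraction) (v : NodeBound) :
    (u.addMul r v).bits ≤ u.bits + (r.bits + v.bits + 1) := by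
  have h1 := Fraction.bits_add_le u.fst (r.mul v.fst)
  have h2 := Fraction.bits_add_le u.snd (r.mul v.snd)
  have h3 := Fraction.bits_mul_le r v.fst
  have h4 := Fraction.bits_mul_le r v.snd
  simp only [bits, addMul]
  omega

end NodeBound

namespace Objective

variable {n : ℕ} (o : Objective n)

def toData : Data :=
  .pair (.ofList .ofOptionBool (List.ofFn o.evidence)) (.pair (.ofNat o.var)
    (.pair (.ofBool o.target) (.pair (.int o.a) (.int o.b))))

/-- The value of the objective at a pair of fractions. -/
def score (A B : Fraction) : Fraction := (o.b * A.1 * B.2 - o.a * B.1 * A.2, A.2 * B.2)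

/-- An indicator of the query variable vanishes under one of the two query values, which accounts
for the entry 0. -/
def leaf (v : Fin n) (b : Bool) : NodeBound :=
  let z : Fraction := if o.evidence v = some (!b) then (0, 1) else (1, 1)
  if v = o.var then (if b = o.target then ⟨true, z, (0, 1)⟩ else ⟨true, (0, 1), z⟩) else ⟨false, z,
      z⟩

/-- The product of `u`, below which the query variable is, with `v`, below which it is not. -/
def scale (u v : NodeBound) : NodeBound :=
  if 0 ≤ (o.score u.fst u.snd).1 then ⟨true, u.fst.mul v.snd, u.snd.mul v.snd⟩
  else ⟨true, u.fst.mul v.fst, u.snd.mul v.fst⟩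

def mul (u v : NodeBound) : NodeBound :=
  if u.hasQuery then o.scale u v
  else if v.hasQuery then o.scale v u else ⟨false, u.fst.mul v.fst, u.snd.mul v.snd⟩

/-- With the query variable, the better of two optimal pairs; without it, the smallest interval
containing both. The flags of `u` and `v` are meant to agree. -/
def join (u v : NodeBound) : NodeBound :=
  if v.hasQuery then (if (o.score u.fst u.snd).le (o.score v.fst v.snd) then v else u)
  else ⟨false, if v.fst.le u.fst then v.fst else u.fst, if u.snd.le v.snd then v.snd else u.snd⟩

/-- The value of a sum node with the weights `p`. -/
def dot (vals : List NodeBound) (ch : List ℕ) (p : List ℚ) : NodeBound :=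
  (ch.zip p).foldl (fun u z => u.addMul (.ofRat z.2) (vals.getD z.1 .zero)) .zero

/-- At a sum node the fold starts from the first generator and meets it again, which does no harm;
the default `[]` matters only for an empty list of generators. -/
def evalNode (vals : List NodeBound) : CSPNNode n → NodeBound
  | .ind v b => o.leaf v b
  | .prod ch => ch.foldl (fun u c => o.mul u (vals.getD c .zero)) .one
  | .sum ch points => points.foldl (fun u p => o.join u (dot vals ch p)) (dot vals ch (points.headD
      []))

/-- The bounds for all nodes of a table. -/
def evalTable (N : List (CSPNNode n)) : List NodeBound :=
  N.foldl (fun vals nd => vals ++ [o.evalNode vals nd]) []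

theorem bits_leaf_le (v : Fin n) (b : Bool) : (o.leaf v b).bits ≤ 1 := by
  unfold leaf
  split_ifs <;> decide

theorem bits_scale_le (u v : NodeBound) : (o.scale u v).bits ≤ u.bits + v.bits := by
  have h1 := Fraction.bits_mul_le u.fst v.fst
  have h2 := Fraction.bits_mul_le u.fst v.snd
  have h3 := Fraction.bits_mul_le u.snd v.fst
  have h4 := Fraction.bits_mul_le u.snd v.snd
  unfold scale
  split_ifs <;> simp only [NodeBound.bits] <;> omega

theorem bits_mul_le (u v : NodeBound) : (o.mul u v).bits ≤ u.bits + v.bits := by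
  unfold mul
  split_ifs
  · exact o.bits_scale_le u v
  · exact (o.bits_scale_le v u).trans (add_comm _ _).le
  · have h1 := Fraction.bits_mul_le u.fst v.fst
    have h4 := Fraction.bits_mul_le u.snd v.snd
    simp only [NodeBound.bits]
    omega

/-- A join selects among existing fractions and computes no new ones, so the number of generators
does not affect the bit length. -/
theorem bits_join_le (u v : NodeBound) : (o.join u v).bits ≤ max u.bits v.bits := by
  unfold join
  split_ifs <;> simp only [NodeBound.bits] <;> omega

theorem bits_dot_le (vals : List NodeBound) (ch : List ℕ) (p : List ℚ) :
    (dot vals ch p).bits ≤ 1 + ((ch.zip p).map fun z =>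
      (Fraction.ofRat z.2).bits + (vals.getD z.1 .zero).bits + 1).sum := by
  have key : ∀ (l : List (ℕ × ℚ)) (u : NodeBound),
      (l.foldl (fun u z => u.addMul (.ofRat z.2) (vals.getD z.1 .zero)) u).bits ≤ u.bits +
        (l.map fun z => (Fraction.ofRat z.2).bits + (vals.getD z.1 .zero).bits + 1).sum := by
    intro l
    induction l with
    | nil => simp
    | cons z l ih =>
      intro u
      have h1 := ih (u.addMul (.ofRat z.2) (vals.getD z.1 .zero))
      have h2 := u.bits_addMul_le (.ofRat z.2) (vals.getD z.1 .zero)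
      rw [List.foldl_cons, List.map_cons, List.sum_cons]
      omega
  exact key _ _

theorem bits_prod_le (vals : List NodeBound) (ch : List ℕ) :
    (ch.foldl (fun u c => o.mul u (vals.getD c .zero)) .one).bits ≤
      1 + (ch.map fun c => (vals.getD c .zero).bits).sum := by
  have key : ∀ (ch : List ℕ) (u : NodeBound),
      (ch.foldl (fun u c => o.mul u (vals.getD c .zero)) u).bits ≤ u.bits +
        (ch.map fun c => (vals.getD c .zero).bits).sum := by
    intro l
    induction l with
    | nil => simp
    | cons c l ih =>
      intro u
      have h1 := ih (o.mul u (vals.getD c .zero))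
      have h2 := o.bits_mul_le u (vals.getD c .zero)
      rw [List.foldl_cons, List.map_cons, List.sum_cons]
      omega
  exact key _ _

theorem bits_sum_le (vals : List NodeBound) (ch : List ℕ) {points : List (List ℚ)} {k : ℕ}
    (h0 : points ≠ []) (h : ∀ p ∈ points, (dot vals ch p).bits ≤ k) :
    (o.evalNode vals (.sum ch points)).bits ≤ k := by
  have key : ∀ (l : List (List ℚ)) (u : NodeBound), u.bits ≤ k → (∀ p ∈ l, (dot vals ch p).bits ≤
      k) →
      (l.foldl (fun u p => o.join u (dot vals ch p)) u).bits ≤ k := by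
    intro l
    induction l with
    | nil => simp
    | cons p l ih =>
      intro u hu hl
      refine ih _ ((o.bits_join_le _ _).trans (max_le hu (hl p (by simp)))) fun p hp => hl p (by
          simp [hp])
  refine key _ _ ?_ h
  obtain ⟨p, l, rfl⟩ := List.exists_cons_of_ne_nil h0
  exact h p (by simp)

end Objective

/-- The tag of a node in its encoding. -/
def CSPNNode.kind {n : ℕ} : CSPNNode n → ℤ
  | .ind _ _ => 0
  | .prod _ => 1
  | .sum _ _ => 2

/-- The encoding of a node without its tag. -/
def CSPNNode.payload {n : ℕ} : CSPNNode n → Data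
  | .ind v b => .pair (.ofNat v) (.ofBool b)
  | .prod ch => .ofList .ofNat ch
  | .sum ch points => .pair (.ofList .ofNat ch) (.ofList (.ofList .ofRat) points)

/-! ### The evaluation takes polynomial time -/

namespace PolyFrom

variable {ι : Type} {x : ι → Data}

theorem fractionIte {q : ι → Bool} {a b : ι → Fraction} (hq : PolyFrom x fun i => .ofBool (q i))
    (ha : PolyFrom x fun i => (a i).toData) (hb : PolyFrom x fun i => (b i).toData) :
    PolyFrom x fun i => (if q i then a i else b i).toData :=
  (ite (q := fun i => q i = true) (by simpa using hq) ha hb).congr fun i => apply_ite _ _ _ _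

theorem boundIte {q : ι → Bool} {a b : ι → NodeBound} (hq : PolyFrom x fun i => .ofBool (q i))
    (ha : PolyFrom x fun i => (a i).toData) (hb : PolyFrom x fun i => (b i).toData) :
    PolyFrom x fun i => (if q i then a i else b i).toData :=
  (ite (q := fun i => q i = true) (by simpa using hq) ha hb).congr fun i => apply_ite _ _ _ _

theorem boundMk {q : ι → Bool} {a b : ι → Fraction} (hq : PolyFrom x fun i => .ofBool (q i))
    (ha : PolyFrom x fun i => (a i).toData) (hb : PolyFrom x fun i => (b i).toData) :
    PolyFrom x fun i => (NodeBound.mk (q i) (a i) (b i)).toData :=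
  pair hq (pair ha hb)

theorem bool (b : Bool) : PolyFrom x fun _ => .ofBool b := int _

theorem fraction (a : Fraction) : PolyFrom x fun _ => a.toData := pair (int _) (int _)

theorem bound (u : NodeBound) : PolyFrom x fun _ => u.toData := boundMk (bool _) (fraction _)
    (fraction _)

section nodes

variable {n : ι → ℕ} {o : ∀ i, Objective (n i)} {u v : ι → NodeBound} {r : ι → Fraction}
  {vals : ι → List NodeBound}

theorem addMul (hu : PolyFrom x fun i => (u i).toData) (hr : PolyFrom x fun i => (r i).toData)
    (hv : PolyFrom x fun i => (v i).toData) :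
    PolyFrom x fun i => ((u i).addMul (r i) (v i)).toData :=
  boundMk hv.fst (fractionAdd hu.snd.fst (fractionMul hr hv.snd.fst))
    (fractionAdd hu.snd.snd (fractionMul hr hv.snd.snd))

theorem score {A B : ι → Fraction} (ho : PolyFrom x fun i => (o i).toData)
    (hA : PolyFrom x fun i => (A i).toData) (hB : PolyFrom x fun i => (B i).toData) :
    PolyFrom x fun i => ((o i).score (A i) (B i)).toData :=
  pair (sub (mul (mul ho.snd.snd.snd.snd hA.fst) hB.snd) (mul (mul ho.snd.snd.snd.fst hB.fst)
      hA.snd))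
    (mul hA.snd hB.snd)

theorem scale (ho : PolyFrom x fun i => (o i).toData) (hu : PolyFrom x fun i => (u i).toData)
    (hv : PolyFrom x fun i => (v i).toData) : PolyFrom x fun i => ((o i).scale (u i) (v i)).toData
        :=
  (boundIte (ofBool_le (int 0) (score ho hu.snd.fst hu.snd.snd).fst)
    (boundMk (bool true) (fractionMul hu.snd.fst hv.snd.snd) (fractionMul hu.snd.snd hv.snd.snd))
    (boundMk (bool true) (fractionMul hu.snd.fst hv.snd.fst)
      (fractionMul hu.snd.snd hv.snd.fst))).congr fun i => by simp [Objective.scale]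

theorem boundMul (ho : PolyFrom x fun i => (o i).toData) (hu : PolyFrom x fun i => (u i).toData)
    (hv : PolyFrom x fun i => (v i).toData) : PolyFrom x fun i => ((o i).mul (u i) (v i)).toData :=
  boundIte hu.fst (scale ho hu hv) (boundIte hv.fst (scale ho hv hu)
    (boundMk (bool false) (fractionMul hu.snd.fst hv.snd.fst) (fractionMul hu.snd.snd hv.snd.snd)))

theorem join (ho : PolyFrom x fun i => (o i).toData) (hu : PolyFrom x fun i => (u i).toData)
    (hv : PolyFrom x fun i => (v i).toData) : PolyFrom x fun i => ((o i).join (u i) (v i)).toData :=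
  boundIte hv.fst (boundIte (fractionLe (score ho hu.snd.fst hu.snd.snd)
      (score ho hv.snd.fst hv.snd.snd)) hv hu)
    (boundMk (bool false) (fractionIte (fractionLe hv.snd.fst hu.snd.fst) hv.snd.fst hu.snd.fst)
      (fractionIte (fractionLe hu.snd.snd hv.snd.snd) hv.snd.snd hu.snd.snd))

theorem leaf {w : ∀ i, Fin (n i)} {b : ι → Bool} (ho : PolyFrom x fun i => (o i).toData)
    (hw : PolyFrom x fun i => .ofNat (w i)) (hb : PolyFrom x fun i => .ofBool (b i)) :
    PolyFrom x fun i => ((o i).leaf (w i) (b i)).toData := by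
  -- The code 2 of a missing value differs from both codes of known values, so comparing the code
  -- with that of the negated indicator value decides whether the evidence contradicts the
  -- indicator.
  let code : Option Bool → ℤ := fun e => match e with
    | none => 2
    | some b => if b then 1 else 0
  have he : PolyFrom x fun i => .int (code ((o i).evidence (w i))) :=
    (getD ho.fst hw (d := fun _ => none) (int 2)).congr fun i => by
      rw [List.getD_eq_getElem _ _ (by simp)]
      simp only [List.getElem_ofFn, Fin.eta]
      rcases (o i).evidence (w i) with _ | b <;> rfl
  have hz : PolyFrom x fun i =>
      (if (o i).evidence (w i) = some (!b i) then (0, 1) else (1, 1) : Fraction).toData :=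
    (fractionIte (ofBool_eq he (ofBool_not hb)) (fraction (0, 1)) (fraction (1, 1))).congr fun i =>
        by
      congr 1
      rcases (o i).evidence (w i) with _ | c
      · cases b i <;> rfl
      · cases b i <;> cases c <;> rfl
  refine (boundIte (ofBool_eq hw ho.snd.fst)
    (boundIte (ofBool_eq hb ho.snd.snd.fst) (boundMk (bool true) hz (fraction (0, 1)))
      (boundMk (bool true) (fraction (0, 1)) hz)) (boundMk (bool false) hz hz)).congr fun i => ?_
  unfold Objective.leaf
  congr 1
  have h1 : (((w i : ℕ) : ℤ) = ((o i).var : ℕ)) ↔ w i = (o i).var := by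
    rw [Nat.cast_inj, Fin.val_inj]
  have h2 : ((if b i = true then 1 else 0 : ℤ) = if (o i).target = true then 1 else 0) ↔
      b i = (o i).target := by
    cases b i <;> cases (o i).target <;> simp
  simp only [h1, h2, decide_eq_true_eq]

theorem dot {ch : ι → List ℕ} {p : ι → List ℚ}
    (hvals : PolyFrom x fun i => .ofList NodeBound.toData (vals i))
    (hch : PolyFrom x fun i => .ofList .ofNat (ch i)) (hp : PolyFrom x fun i => .ofList .ofRat (p
        i)) :
    PolyFrom x fun i => (Objective.dot (vals i) (ch i) (p i)).toData := by
  have hz := zip hch hp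
  refine foldl_of_measure (fun _ u => u.bits) 10 (fun i =>
      (Data.ofList Data.ofRat (p i)).size + (Data.ofList NodeBound.toData (vals i)).size + 2)
    hvals hz (bound .zero) ((hp.size_bdd.add hvals.size_bdd).add (.const 2)) (.const 1)
    (fun _ u => u.size_toData_le) (fun i u z hz => ?_) ?_
  · have h1 := u.bits_addMul_le (.ofRat z.2) ((vals i).getD z.1 .zero)
    have h2 := NodeBound.bits_getD_le (vals i) z.1
    have h3 := Data.size_le_size_ofList Data.ofRat (List.of_mem_zip hz).2
    have h4 := (Fraction.ofRat z.2).bits_add_three_le_size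
    have h5 : (Fraction.ofRat z.2).toData = Data.ofRat z.2 := rfl
    rw [h5] at h4
    omega
  · exact addMul (refl _).snd.snd (refl _).snd.fst.snd (getD (refl _).fst (refl _).snd.fst.fst
        (bound _))

theorem prodNode {ch : ι → List ℕ} (ho : PolyFrom x fun i => (o i).toData)
    (hvals : PolyFrom x fun i => .ofList NodeBound.toData (vals i))
    (hch : PolyFrom x fun i => .ofList .ofNat (ch i)) :
    PolyFrom x fun i => ((o i).evalNode (vals i) (.prod (ch i))).toData := by
  refine foldl_of_measure (c := fun i => .pair (o i).toData (.ofList NodeBound.toData (vals i)))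
    (fun _ u => u.bits) 10 (fun i => (Data.ofList NodeBound.toData (vals i)).size)
    (ho.pair hvals) hch (bound .one) hvals.size_bdd (.const 1) (fun _ u => u.size_toData_le)
    (fun i u c _ => ?_) ?_
  · have h1 := (o i).bits_mul_le u ((vals i).getD c .zero)
    have h2 := NodeBound.bits_getD_le (vals i) c
    omega
  · exact boundMul (refl _).fst.fst (refl _).snd.snd (getD (refl _).fst.snd (refl _).snd.fst (bound
        _))

theorem sumNode {ch : ι → List ℕ} {points : ι → List (List ℚ)}
    (ho : PolyFrom x fun i => (o i).toData)
    (hvals : PolyFrom x fun i => .ofList NodeBound.toData (vals i))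
    (hch : PolyFrom x fun i => .ofList .ofNat (ch i))
    (hp : PolyFrom x fun i => .ofList (.ofList .ofRat) (points i)) :
    PolyFrom x fun i => ((o i).evalNode (vals i) (.sum (ch i) (points i))).toData := by
  have h0 : PolyFrom x fun i => (Objective.dot (vals i) (ch i) ((points i).headD [])).toData :=
    dot hvals hch (headD hp (int 0))
  refine foldl_of_measure (c := fun i => .pair (o i).toData
      (.pair (.ofList NodeBound.toData (vals i)) (.ofList .ofNat (ch i))))
    (fun _ u => u.bits) 10 (fun i => 1 + (Data.ofList Data.ofNat (ch i)).size *
      ((Data.ofList (Data.ofList Data.ofRat) (points i)).size +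
        (Data.ofList NodeBound.toData (vals i)).size + 1))
    (ho.pair (hvals.pair hch)) hp h0 ((PolyBdd.const 1).add (hch.size_bdd.mul
      ((hp.size_bdd.add hvals.size_bdd).add (.const 1))))
    (h0.size_bdd.mono fun i => NodeBound.bits_le_size _) (fun _ u => u.size_toData_le)
    (fun i u p hpi => ?_) ?_
  · have h1 := (o i).bits_join_le u (Objective.dot (vals i) (ch i) p)
    have h2 := Objective.bits_dot_le (vals i) (ch i) p
    have h3 : (((ch i).zip p).map fun z => (Fraction.ofRat z.2).bits +
        ((vals i).getD z.1 .zero).bits + 1).sum ≤ (Data.ofList Data.ofNat (ch i)).size *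
      ((Data.ofList (Data.ofList Data.ofRat) (points i)).size +
        (Data.ofList NodeBound.toData (vals i)).size + 1) := by
      refine (List.sum_le_card_nsmul _ ((Data.ofList (Data.ofList Data.ofRat) (points i)).size +
        (Data.ofList NodeBound.toData (vals i)).size + 1) ?_).trans ?_
      · intro k hk
        obtain ⟨z, hz, rfl⟩ := List.mem_map.1 hk
        have h2 := NodeBound.bits_getD_le (vals i) z.1
        have h3 := Data.size_le_size_ofList Data.ofRat (List.of_mem_zip hz).2
        have h4 := (Fraction.ofRat z.2).bits_add_three_le_size
        have h5 : (Fraction.ofRat z.2).toData = Data.ofRat z.2 := rfl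
        have h6 := Data.size_le_size_ofList (Data.ofList Data.ofRat) hpi
        rw [h5] at h4
        omega
      · rw [smul_eq_mul]
        gcongr
        have := Data.length_le_size_ofList Data.ofNat (ch i)
        simp only [List.length_map, List.length_zip]
        omega
    omega
  · have r := refl fun z : Σ i, List ℚ × NodeBound => Data.pair (.pair (o z.1).toData
      (.pair (.ofList NodeBound.toData (vals z.1)) (.ofList .ofNat (ch z.1))))
      (.pair (.ofList .ofRat z.2.1) z.2.2.toData)
    exact join r.fst.fst r.snd.snd (dot r.fst.snd.fst r.fst.snd.snd r.snd.fst)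

theorem evalNode {nd : ∀ i, CSPNNode (n i)} (ho : PolyFrom x fun i => (o i).toData)
    (hvals : PolyFrom x fun i => .ofList NodeBound.toData (vals i))
    (hnd : PolyFrom x fun i => .ofNode (nd i)) :
    PolyFrom x fun i => ((o i).evalNode (vals i) (nd i)).toData := by
  have hnd : PolyFrom x fun i => .pair (.int (nd i).kind) (nd i).payload :=
    hnd.congr fun i => by cases nd i <;> rfl
  -- The signs of the tag and of the tag minus 1 separate the tags 0, 1 and 2.
  refine cond hnd.fst (cond (sub (hnd.fst.reindex _) (int 1)) ?_ ?_) ?_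
  · have h : ∀ i : {i : {i // 0 < (nd i).kind} // 0 < (nd i).kind - 1}, ∃ ch points,
        nd i = .sum ch points := by
      rintro ⟨⟨i, h⟩, h'⟩
      exact (by rintro (_ | _ | _) <;> simp [CSPNNode.kind] : ∀ nd : CSPNNode (n i), 0 < nd.kind →
        0 < nd.kind - 1 → ∃ ch points, nd = .sum ch points) _ h h'
    choose ch points h using h
    have hpay : ∀ i, (nd i.1.1).payload = .pair (.ofList .ofNat (ch i)) (.ofList (.ofList .ofRat)
      (points i)) := fun i => by rw [h]; rfl
    have hnd' := ((hnd.snd.reindex Subtype.val).reindex Subtype.val).congr fun i => (hpay i).symm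
    exact (sumNode ((ho.reindex _).reindex _) ((hvals.reindex _).reindex _) hnd'.fst
      hnd'.snd).congr fun i => by rw [h]
  · have h : ∀ i : {i : {i // 0 < (nd i).kind} // (nd i).kind - 1 ≤ 0}, ∃ ch, nd i = .prod ch := by
      rintro ⟨⟨i, h⟩, h'⟩
      exact (by rintro (_ | _ | _) <;> simp [CSPNNode.kind] : ∀ nd : CSPNNode (n i), 0 < nd.kind →
        nd.kind - 1 ≤ 0 → ∃ ch, nd = .prod ch) _ h h'
    choose ch h using h
    have hpay : ∀ i, (nd i.1.1).payload = .ofList .ofNat (ch i) := fun i => by rw [h]; rfl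
    have hnd' := ((hnd.snd.reindex Subtype.val).reindex Subtype.val).congr fun i => (hpay i).symm
    exact (prodNode ((ho.reindex _).reindex _) ((hvals.reindex _).reindex _) hnd').congr
      fun i => by rw [h]
  · have h : ∀ i : {i // (nd i).kind ≤ 0}, ∃ v b, nd i = .ind v b := by
      rintro ⟨i, h⟩
      exact (by rintro (_ | _ | _) <;> simp [CSPNNode.kind] : ∀ nd : CSPNNode (n i), nd.kind ≤ 0 →
        ∃ v b, nd = .ind v b) _ h
    choose v b h using h
    have hpay : ∀ i, (nd i.1).payload = .pair (.ofNat (v i)) (.ofBool (b i)) := fun i => by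
      rw [h]; rfl
    have hnd' := (hnd.snd.reindex Subtype.val).congr fun i => (hpay i).symm
    exact (leaf (ho.reindex _) hnd'.fst hnd'.snd).congr fun i => by rw [h]; rfl

/-- The bound `W` has to be supplied: in an arbitrary directed acyclic graph, repeated squaring
through shared children produces exponentially many bits. For learned networks it comes from the
tree structure. -/
theorem evalTable {N : ∀ i, List (CSPNNode (n i))} {W : ι → ℕ} (hW : PolyBdd x W)
    (ho : PolyFrom x fun i => (o i).toData) (hN : PolyFrom x fun i => .ofList .ofNode (N i))
    (h : ∀ i, ∀ u ∈ (o i).evalTable (N i), u.bits ≤ W i) :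
    PolyFrom x fun i => .ofList NodeBound.toData ((o i).evalTable (N i)) := by
  refine foldl (h := fun _ => Data.ofList NodeBound.toData) ho hN (int 0) ?_ ?_
  · refine (((PolyBdd.const 1).add (hN.size_bdd.mul (((PolyBdd.const 10).mul hW).add
      (.const 11)))).reindex Prod.fst).mono ?_
    rintro ⟨i, k⟩
    change (Data.ofList NodeBound.toData ((o i).evalTable ((N i).take k))).size ≤ _
    rw [Data.size_ofList]
    refine Nat.add_le_add_left ((List.sum_le_card_nsmul _ (10 * W i + 11) ?_).trans ?_) _
    · intro j hj
      obtain ⟨u, hu, rfl⟩ := List.mem_map.1 hj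
      -- Every intermediate table is a prefix of the final one, so the bound for final entries
      -- covers all states of the fold.
      have h1 := h i u ((foldl_table_prefix _ (List.take_prefix k (N i))).subset hu)
      have h2 := u.size_toData_le
      omega
    · rw [smul_eq_mul, List.length_map]
      gcongr
      have := Data.length_le_size_ofList Data.ofNode (N i)
      rw [Objective.evalTable, length_foldl_table, List.length_take]
      exact (min_le_right _ _).trans this
  · exact append_singleton (refl _).snd.snd (evalNode (refl _).fst (refl _).snd.snd (refl
        _).snd.fst)

end nodes

end PolyFrom

/-! ### Values of unnormalised fractions -/

namespace Fraction

noncomputable def val (a : Fraction) : ℝ := a.1 / a.2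

variable {a b : Fraction}

theorem val_add (ha : 0 < a.2) (hb : 0 < b.2) : (add a b).val = a.val + b.val := by
  have ha' : (a.2 : ℝ) ≠ 0 := by exact_mod_cast ha.ne'
  have hb' : (b.2 : ℝ) ≠ 0 := by exact_mod_cast hb.ne'
  simp only [val, add]
  push_cast
  field_simp

theorem val_mul : (mul a b).val = a.val * b.val := by
  simp only [val, mul]
  push_cast
  rw [mul_div_mul_comm]

theorem le_iff (ha : 0 < a.2) (hb : 0 < b.2) : a.le b ↔ a.val ≤ b.val := by
  have ha' : (0 : ℝ) < a.2 := by exact_mod_cast ha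
  have hb' : (0 : ℝ) < b.2 := by exact_mod_cast hb
  simp only [val, le, decide_eq_true_eq, div_le_div_iff₀ ha' hb']
  exact_mod_cast Iff.rfl

theorem val_ofRat (r : ℚ) : (ofRat r).val = r := by
  rw [val, ofRat]
  exact_mod_cast Rat.num_div_den r

theorem ofRat_den_pos (r : ℚ) : 0 < (ofRat r).2 := by
  simpa [ofRat] using r.den_pos

theorem val_nonneg_iff (ha : 0 < a.2) : 0 ≤ a.val ↔ 0 ≤ a.1 := by
  have ha' : (0 : ℝ) < a.2 := by exact_mod_cast ha
  rw [val, le_div_iff₀ ha', zero_mul]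
  exact_mod_cast Iff.rfl

end Fraction

namespace NodeBound

/-- The entries of `u` are nonnegative fractions. -/
structure WF (u : NodeBound) : Prop where
  fst_den : 0 < u.fst.2
  snd_den : 0 < u.snd.2
  fst_nonneg : 0 ≤ u.fst.val
  snd_nonneg : 0 ≤ u.snd.val

theorem wf_zero : WF zero := ⟨by decide, by decide, by simp [zero, Fraction.val],
  by simp [zero, Fraction.val]⟩

theorem wf_one : WF one := ⟨by decide, by decide, by simp [one, Fraction.val],
  by simp [one, Fraction.val]⟩

theorem WF.addMul {u v : NodeBound} {r : Fraction} (hu : u.WF) (hv : v.WF) (hr : 0 < r.2)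
    (hr' : 0 ≤ r.val) : (u.addMul r v).WF := by
  refine ⟨mul_pos hu.1 (mul_pos hr hv.1), mul_pos hu.2 (mul_pos hr hv.2), ?_, ?_⟩
  · rw [NodeBound.addMul, Fraction.val_add hu.1 (mul_pos hr hv.1), Fraction.val_mul]
    exact add_nonneg hu.3 (mul_nonneg hr' hv.3)
  · rw [NodeBound.addMul, Fraction.val_add hu.2 (mul_pos hr hv.2), Fraction.val_mul]
    exact add_nonneg hu.4 (mul_nonneg hr' hv.4)

end NodeBound

/-! ### Bounds for the values of a node

The three values of a node are those at the target value of the query variable together with the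
evidence, at the other value of the query variable together with the evidence, and at the evidence.
    -/

namespace Objective

variable {n : ℕ} (o : Objective n)

/-- The values `y` respect the bound `u`. -/
def Inside (u : NodeBound) (y : ℝ × ℝ × ℝ) : Prop :=
  0 ≤ y.1 ∧ 0 ≤ y.2.1 ∧
    if u.hasQuery then
      y.2.2 = y.1 + y.2.1 ∧ o.b * y.1 - o.a * y.2.1 ≤ o.b * u.fst.val - o.a * u.snd.val
    else y.2.1 = y.1 ∧ y.2.2 = y.1 ∧ u.fst.val ≤ y.1 ∧ y.1 ≤ u.snd.val

/-- The values `y` are among those by which the bound `u` is attained. -/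
def Attains (u : NodeBound) (y : ℝ × ℝ × ℝ) : Prop :=
  if u.hasQuery then y = (u.fst.val, u.snd.val, u.fst.val + u.snd.val)
  else y = (u.fst.val, u.fst.val, u.fst.val) ∨ y = (u.snd.val, u.snd.val, u.snd.val)

variable {o} {u v : NodeBound} {y z : ℝ × ℝ × ℝ}

theorem val_score {A B : Fraction} (hA : 0 < A.2) (hB : 0 < B.2) :
    (o.score A B).val = o.b * A.val - o.a * B.val := by
  have hA' : (A.2 : ℝ) ≠ 0 := by exact_mod_cast hA.ne'
  have hB' : (B.2 : ℝ) ≠ 0 := by exact_mod_cast hB.ne'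
  simp only [Fraction.val, score]
  push_cast
  field_simp

theorem score_nonneg_iff (hu : u.WF) :
    0 ≤ (o.score u.fst u.snd).1 ↔ 0 ≤ o.b * u.fst.val - o.a * u.snd.val := by
  rw [← Fraction.val_nonneg_iff (mul_pos hu.1 hu.2 : 0 < (o.score u.fst u.snd).2),
    val_score hu.1 hu.2]

theorem hasQuery_scale : (o.scale u v).hasQuery = true := by
  unfold scale; split_ifs <;> rfl

theorem wf_scale (hu : u.WF) (hv : v.WF) : (o.scale u v).WF := by
  unfold scale
  split_ifs
  all_goals
    refine ⟨mul_pos ?_ ?_, mul_pos ?_ ?_, ?_, ?_⟩ <;>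
      first
        | exact hu.1
        | exact hu.2
        | exact hv.1
        | exact hv.2
        | skip
  · rw [Fraction.val_mul]; exact mul_nonneg hu.3 hv.4
  · rw [Fraction.val_mul]; exact mul_nonneg hu.4 hv.4
  · rw [Fraction.val_mul]; exact mul_nonneg hu.3 hv.3
  · rw [Fraction.val_mul]; exact mul_nonneg hu.4 hv.3

/-- The objective is homogeneous in the pair, so scaling by z ≥ 0 multiplies it by z. If the optimum
M is nonnegative, then M * z is largest at the upper value of z; if M is negative, at the lower
value. -/
theorem inside_scale (hu : u.WF) (hu' : u.hasQuery = true) (hv' : v.hasQuery = false)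
    (hy : o.Inside u y) (hz : o.Inside v z) : o.Inside (o.scale u v) (y * z) := by
  obtain ⟨y1, y2, y3⟩ := y
  obtain ⟨z1, z2, z3⟩ := z
  simp only [Inside, hu', hv', if_true, Bool.false_eq_true, if_false] at hy hz
  obtain ⟨h1, h2, h3, h4⟩ := hy
  obtain ⟨hz1, -, rfl, rfl, h6, h7⟩ := hz
  refine ⟨mul_nonneg h1 hz1, mul_nonneg h2 hz1, ?_⟩
  rw [hasQuery_scale, if_pos rfl]
  refine ⟨by simp only [Prod.fst_mul, Prod.snd_mul, h3]; ring, ?_⟩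
  have h8 : (o.b * y1 - o.a * y2) * z3 ≤ (o.b * u.fst.val - o.a * u.snd.val) * z3 :=
    mul_le_mul_of_nonneg_right h4 hz1
  unfold scale
  simp only [score_nonneg_iff hu, Prod.fst_mul, Prod.snd_mul]
  split_ifs with h
  · have h9 := mul_le_mul_of_nonneg_left h7 h
    simp only [Fraction.val_mul]
    linarith
  · have h9 := mul_le_mul_of_nonpos_left h6 (not_le.1 h).le
    simp only [Fraction.val_mul]
    linarith

/-- The extremal product factors into extremal values of the two factors, so it can later be
realised by weights chosen separately below each. -/
theorem attains_scale (hu' : u.hasQuery = true) (hv' : v.hasQuery = false)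
    (hy : Attains (o.scale u v) y) : ∃ s t, Attains u s ∧ Attains v t ∧ y = s * t := by
  rw [Attains, hasQuery_scale, if_pos rfl] at hy
  refine ⟨(u.fst.val, u.snd.val, u.fst.val + u.snd.val), if 0 ≤ (o.score u.fst u.snd).1 then
    (v.snd.val, v.snd.val, v.snd.val) else (v.fst.val, v.fst.val, v.fst.val), by
      rw [Attains, if_pos hu'], ?_, ?_⟩
  · rw [Attains, hv', if_neg Bool.false_ne_true]
    split_ifs <;> simp
  · rw [hy]
    unfold scale
    split_ifs <;> simp [Fraction.val_mul, add_mul]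

theorem hasQuery_mul : (o.mul u v).hasQuery = (u.hasQuery || v.hasQuery) := by
  unfold mul
  split_ifs with h1 h2
  · simp [h1, hasQuery_scale]
  · simp [h2, hasQuery_scale]
  · simp [h1, h2]

theorem wf_mul (hu : u.WF) (hv : v.WF) : (o.mul u v).WF := by
  unfold mul
  split_ifs
  · exact wf_scale hu hv
  · exact wf_scale hv hu
  · refine ⟨mul_pos hu.1 hv.1, mul_pos hu.2 hv.2, ?_, ?_⟩ <;> rw [Fraction.val_mul]
    · exact mul_nonneg hu.3 hv.3
    · exact mul_nonneg hu.4 hv.4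

/-- Without the query variable on either side, this is multiplication of nonnegative intervals. -/
theorem inside_mul (hu : u.WF) (hv : v.WF) (h : ¬ (u.hasQuery = true ∧ v.hasQuery = true))
    (hy : o.Inside u y) (hz : o.Inside v z) : o.Inside (o.mul u v) (y * z) := by
  unfold mul
  split_ifs with h1 h2
  · exact inside_scale hu h1 (by simpa [h1] using h) hy hz
  · rw [mul_comm]
    exact inside_scale hv h2 (by simpa using h1) hz hy
  · rw [Inside, if_neg h1] at hy
    rw [Inside, if_neg h2] at hz
    obtain ⟨h3, -, h4, h5, h6, h7⟩ := hy
    obtain ⟨h3', -, h4', h5', h6', h7'⟩ := hz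
    refine ⟨mul_nonneg h3 h3', by simp only [Prod.fst_mul, Prod.snd_mul, h4, h4']; positivity, ?_⟩
    rw [if_neg Bool.false_ne_true]
    simp only [Prod.fst_mul, Prod.snd_mul, h4, h4', h5, h5', Fraction.val_mul, true_and]
    exact ⟨mul_le_mul h6 h6' hv.3 h3, mul_le_mul h7 h7' h3' hu.4⟩

theorem attains_mul (h : ¬ (u.hasQuery = true ∧ v.hasQuery = true))
    (hy : Attains (o.mul u v) y) : ∃ s t, Attains u s ∧ Attains v t ∧ y = s * t := by
  unfold mul at hy
  split_ifs at hy with h1 h2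
  · exact attains_scale h1 (by simpa [h1] using h) hy
  · obtain ⟨s, t, hs, ht, rfl⟩ := attains_scale h2 (by simpa using h1) hy
    exact ⟨t, s, ht, hs, mul_comm _ _⟩
  · rw [Attains, if_neg Bool.false_ne_true] at hy
    simp only [Attains, if_neg h1, if_neg h2]
    rcases hy with rfl | rfl
    · exact ⟨_, _, .inl rfl, .inl rfl, by simp [Fraction.val_mul]⟩
    · exact ⟨_, _, .inr rfl, .inr rfl, by simp [Fraction.val_mul]⟩

/-- The product of a list of bounds, at most one of which has the query variable below it. -/
theorem foldl_mul_spec (us : List NodeBound) (u : NodeBound) (hu : u.WF) (hus : ∀ v ∈ us, v.WF)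
    (hd : (u :: us).Pairwise fun v v' => ¬ (v.hasQuery = true ∧ v'.hasQuery = true)) :
    (us.foldl o.mul u).WF ∧ (us.foldl o.mul u).hasQuery = (u.hasQuery || us.any NodeBound.hasQuery)
        ∧
    (∀ y ys, o.Inside u y → List.Forall₂ o.Inside us ys →
      o.Inside (us.foldl o.mul u) (y * ys.prod)) ∧
    ∀ t, Attains (us.foldl o.mul u) t → ∃ y ys, Attains u y ∧ List.Forall₂ Attains us ys ∧
      t = y * ys.prod := by
  induction us generalizing u with
  | nil =>
    refine ⟨hu, by simp, fun y ys hy hys => ?_, fun t ht => ⟨t, [], ht, .nil, by simp⟩⟩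
    cases hys
    simpa using hy
  | cons v us ih =>
    rw [List.pairwise_cons, List.pairwise_cons] at hd
    obtain ⟨h1, h2, h3⟩ := hd
    have huv := h1 v (by simp)
    have hv := hus v (by simp)
    obtain ⟨i1, i2, i3, i4⟩ := ih (o.mul u v) (wf_mul hu hv) (fun v' hv' => hus v' (by simp [hv']))
        (by
      refine List.pairwise_cons.2 ⟨fun v' hv' => ?_, h3⟩
      have h4 := h1 v' (by simp [hv'])
      have h5 := h2 v' hv'
      rw [hasQuery_mul]
      rw [Bool.or_eq_true]
      tauto)
    refine ⟨i1, by rw [List.foldl_cons, i2, hasQuery_mul]; simp [Bool.or_assoc],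
      fun y ys hy hys => ?_, fun t ht => ?_⟩
    · cases hys with
      | cons hz hzs =>
        rw [List.foldl_cons, List.prod_cons, ← mul_assoc]
        exact i3 _ _ (inside_mul hu hv huv hy hz) hzs
    · obtain ⟨y, ys, hy, hys, rfl⟩ := i4 t ht
      obtain ⟨s, z, hs, hz, rfl⟩ := attains_mul huv hy
      exact ⟨s, z :: ys, hs, .cons hz hys, by rw [List.prod_cons, mul_assoc]⟩

theorem inside_one : o.Inside .one 1 := by
  simp [Inside, NodeBound.one, Fraction.val]

theorem eq_one_of_attains (h : Attains .one y) : y = 1 := by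
  simpa [Attains, NodeBound.one, Fraction.val, Prod.ext_iff] using h

/-- The join is implied by either bound, and it is attained only by values that attain one of them.
Together, these two properties make it an exact maximum. -/
theorem join_spec (hu : u.WF) (hv : v.WF) (h : u.hasQuery = v.hasQuery) :
    (o.join u v).WF ∧ (o.join u v).hasQuery = v.hasQuery ∧
    (∀ y, o.Inside u y → o.Inside (o.join u v) y) ∧ (∀ y, o.Inside v y → o.Inside (o.join u v) y) ∧
    ∀ y, Attains (o.join u v) y → Attains u y ∨ Attains v y := by
  have hu' : 0 < (o.score u.fst u.snd).2 := mul_pos hu.1 hu.2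
  have hv' : 0 < (o.score v.fst v.snd).2 := mul_pos hv.1 hv.2
  unfold join
  by_cases hq : v.hasQuery = true
  · rw [hq] at h
    simp only [hq, if_true, Fraction.le_iff hu' hv', val_score hu.1 hu.2, val_score hv.1 hv.2]
    split_ifs with hs
    · refine ⟨hv, hq, fun y hy => ?_, fun y hy => hy, fun y hy => .inr hy⟩
      simp only [Inside, h, hq, if_true] at hy ⊢
      exact ⟨hy.1, hy.2.1, hy.2.2.1, hy.2.2.2.trans hs⟩
    · refine ⟨hu, h, fun y hy => hy, fun y hy => ?_, fun y hy => .inl hy⟩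
      simp only [Inside, h, hq, if_true] at hy ⊢
      exact ⟨hy.1, hy.2.1, hy.2.2.1, hy.2.2.2.trans (not_le.1 hs).le⟩
  · rw [if_neg hq]
    rw [Bool.not_eq_true] at hq
    rw [hq] at h
    refine ⟨?_, hq.symm, fun y hy => ?_, fun y hy => ?_, fun y hy => ?_⟩
    · refine ⟨?_, ?_, ?_, ?_⟩ <;> dsimp only <;> split_ifs <;>
      first
        | exact hu.1
        | exact hu.2
        | exact hv.1
        | exact hv.2
        | exact hu.3
        | exact hu.4
        | exact hv.3
        | exact hv.4
    · simp only [Inside, h, Bool.false_eq_true, if_false] at hy ⊢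
      refine ⟨hy.1, hy.2.1, hy.2.2.1, hy.2.2.2.1, ?_, ?_⟩
      · simp only [Fraction.le_iff hv.1 hu.1]
        split_ifs with h1
        · exact h1.trans hy.2.2.2.2.1
        · exact hy.2.2.2.2.1
      · simp only [Fraction.le_iff hu.2 hv.2]
        split_ifs with h1
        · exact hy.2.2.2.2.2.trans h1
        · exact hy.2.2.2.2.2
    · simp only [Inside, hq, Bool.false_eq_true, if_false] at hy ⊢
      refine ⟨hy.1, hy.2.1, hy.2.2.1, hy.2.2.2.1, ?_, ?_⟩
      · simp only [Fraction.le_iff hv.1 hu.1]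
        split_ifs with h1
        · exact hy.2.2.2.2.1
        · exact (not_le.1 h1).le.trans hy.2.2.2.2.1
      · simp only [Fraction.le_iff hu.2 hv.2]
        split_ifs with h1
        · exact hy.2.2.2.2.2
        · exact hy.2.2.2.2.2.trans (not_le.1 h1).le
    · simp only [Attains, h, hq, Bool.false_eq_true, if_false] at hy ⊢
      split_ifs at hy <;> tauto

theorem foldl_join_spec {α : Type*} (D : α → NodeBound) (l : List α) (u : NodeBound) (hu : u.WF)
    (hl : ∀ p ∈ l, (D p).WF ∧ (D p).hasQuery = u.hasQuery) :
    (l.foldl (fun u p => o.join u (D p)) u).WF ∧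
    (l.foldl (fun u p => o.join u (D p)) u).hasQuery = u.hasQuery ∧
    (∀ y, o.Inside u y → o.Inside (l.foldl (fun u p => o.join u (D p)) u) y) ∧
    (∀ p ∈ l, ∀ y, o.Inside (D p) y → o.Inside (l.foldl (fun u p => o.join u (D p)) u) y) ∧
    ∀ y, Attains (l.foldl (fun u p => o.join u (D p)) u) y →
      Attains u y ∨ ∃ p ∈ l, Attains (D p) y := by
  induction l generalizing u with
  | nil => exact ⟨hu, rfl, fun y hy => hy, by simp, fun y hy => .inl hy⟩
  | cons p l ih =>
    obtain ⟨hp, hpu⟩ := hl p (by simp)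
    obtain ⟨j1, j2, j3, j4, j5⟩ := join_spec (o := o) hu hp hpu.symm
    obtain ⟨i1, i2, i3, i4, i5⟩ := ih (o.join u (D p)) j1 fun p' hp' => by
      rw [j2, hpu]; exact hl p' (by simp [hp'])
    refine ⟨i1, by rw [List.foldl_cons, i2, j2, hpu], fun y hy => i3 y (j3 y hy), ?_, fun y hy =>
        ?_⟩
    · intro p' hp' y hy
      rcases List.mem_cons.1 hp' with rfl | hp'
      · exact i3 y (j4 y hy)
      · exact i4 p' hp' y hy
    · rcases i5 y hy with h | ⟨p', hp', h⟩
      · rcases j5 y h with h | h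
        · exact .inl h
        · exact .inr ⟨p, by simp, h⟩
      · exact .inr ⟨p', by simp [hp'], h⟩

/-- For a fixed flag, all constraints are linear equations and inequalities. This carries a bound
from the generators to the whole credal set. -/
theorem convex_inside (u : NodeBound) : Convex ℝ {y | o.Inside u y} := by
  rintro ⟨y1, y2, y3⟩ hy ⟨z1, z2, z3⟩ hz s t hs ht hst
  simp only [Set.mem_ofPred_eq, Inside, Prod.smul_mk, Prod.mk_add_mk, smul_eq_mul] at hy hz ⊢
  obtain ⟨hy1, hy2, hy⟩ := hy
  obtain ⟨hz1, hz2, hz⟩ := hz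
  refine ⟨by positivity, by positivity, ?_⟩
  obtain rfl : t = 1 - s := by linarith
  split_ifs at hy hz ⊢
  · refine ⟨by rw [hy.1, hz.1]; ring, ?_⟩
    nlinarith [mul_le_mul_of_nonneg_left hy.2 hs, mul_le_mul_of_nonneg_left hz.2 ht]
  · obtain ⟨rfl, rfl, hy3, hy4⟩ := hy
    obtain ⟨rfl, rfl, hz3, hz4⟩ := hz
    refine ⟨rfl, rfl, ?_, ?_⟩
    · nlinarith [mul_le_mul_of_nonneg_left hy3 hs, mul_le_mul_of_nonneg_left hz3 ht]
    · nlinarith [mul_le_mul_of_nonneg_left hy4 hs, mul_le_mul_of_nonneg_left hz4 ht]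

end Objective

-- Exactness of the bounds at sum and product nodes

namespace Objective

variable {n : ℕ} {o : Objective n}

/-- The weighted sum of the values `y c` of the children `c`. -/
noncomputable def weightedSum (ch : List ℕ) (p : ℕ → ℝ) (y : ℕ → ℝ × ℝ × ℝ) : ℝ × ℝ × ℝ :=
  ∑ j ∈ Finset.range ch.length, p j • y (ch.getD j 0)

theorem dot_val (vals : List NodeBound) (ch : List ℕ) (p : List ℚ) (hlen : p.length = ch.length)
    (hp : ∀ a ∈ p, 0 ≤ a) (hch : ∀ c ∈ ch, (vals.getD c .zero).WF) :
    (dot vals ch p).WF ∧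
    (dot vals ch p).fst.val =
      ∑ j ∈ Finset.range ch.length, ((p.getD j 0 : ℚ) : ℝ) * (vals.getD (ch.getD j 0)
          .zero).fst.val ∧
    (dot vals ch p).snd.val =
      ∑ j ∈ Finset.range ch.length, ((p.getD j 0 : ℚ) : ℝ) * (vals.getD (ch.getD j 0)
          .zero).snd.val := by
  have key : ∀ (ch : List ℕ) (p : List ℚ) (u : NodeBound), p.length = ch.length → (∀ a ∈ p, 0 ≤ a) →
      (∀ c ∈ ch, (vals.getD c .zero).WF) → u.WF →
      ((ch.zip p).foldl (fun u z => u.addMul (.ofRat z.2) (vals.getD z.1 .zero)) u).WF ∧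
      ((ch.zip p).foldl (fun u z => u.addMul (.ofRat z.2) (vals.getD z.1 .zero)) u).fst.val =
        u.fst.val + ∑ j ∈ Finset.range ch.length,
          ((p.getD j 0 : ℚ) : ℝ) * (vals.getD (ch.getD j 0) .zero).fst.val ∧
      ((ch.zip p).foldl (fun u z => u.addMul (.ofRat z.2) (vals.getD z.1 .zero)) u).snd.val =
        u.snd.val + ∑ j ∈ Finset.range ch.length,
          ((p.getD j 0 : ℚ) : ℝ) * (vals.getD (ch.getD j 0) .zero).snd.val := by
    intro ch
    induction ch with
    | nil => simp
    | cons c ch ih =>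
      rintro (_ | ⟨a, p⟩) u hlen hp hch hu
      · simp at hlen
      have hv := hch c (by simp)
      have ha := Fraction.ofRat_den_pos a
      obtain ⟨h1, h2, h3⟩ := ih p (u.addMul (.ofRat a) (vals.getD c .zero)) (by simpa using hlen)
        (fun a ha => hp a (by simp [ha])) (fun c hc => hch c (by simp [hc]))
        (hu.addMul hv ha (by
          rw [Fraction.val_ofRat]; exact_mod_cast hp a (by simp)))
      refine ⟨h1, ?_, ?_⟩
      · rw [List.zip_cons_cons, List.foldl_cons, h2, List.length_cons, Finset.sum_range_succ',
          NodeBound.addMul, Fraction.val_add hu.1 (mul_pos ha hv.1), Fraction.val_mul,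
          Fraction.val_ofRat]
        simp only [List.getD_cons_zero, List.getD_cons_succ]
        ring
      · rw [List.zip_cons_cons, List.foldl_cons, h3, List.length_cons, Finset.sum_range_succ',
          NodeBound.addMul, Fraction.val_add hu.2 (mul_pos ha hv.2), Fraction.val_mul,
          Fraction.val_ofRat]
        simp only [List.getD_cons_zero, List.getD_cons_succ]
        ring
  have h := key ch p .zero hlen hp hch NodeBound.wf_zero
  have h0 : (NodeBound.zero.fst).val = 0 := by simp [NodeBound.zero, Fraction.val]
  have h0' : (NodeBound.zero.snd).val = 0 := by simp [NodeBound.zero, Fraction.val]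
  rwa [h0, h0', zero_add, zero_add] at h

/-- `addMul` keeps the flag of the new summand, so the flag of the initial `zero` is overwritten as
soon as there is one child. -/
theorem hasQuery_dot {vals : List NodeBound} {ch : List ℕ} {p : List ℚ} {φ : Bool}
    (hlen : p.length = ch.length) (h0 : ch ≠ [])
    (hφ : ∀ c ∈ ch, (vals.getD c .zero).hasQuery = φ) : (dot vals ch p).hasQuery = φ := by
  have key : ∀ (l : List (ℕ × ℚ)) (u : NodeBound), (l = [] → u.hasQuery = φ) →
      (∀ z ∈ l, (vals.getD z.1 .zero).hasQuery = φ) →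
      (l.foldl (fun u z => u.addMul (.ofRat z.2) (vals.getD z.1 .zero)) u).hasQuery = φ := by
    intro l
    induction l with
    | nil => intro u hu _; exact hu rfl
    | cons z l ih =>
      intro u _ hl
      exact ih _ (fun _ => hl z (by simp)) fun z hz => hl z (by simp [hz])
  refine key _ _ (fun h => absurd h ?_) fun z hz => hφ _ (List.of_mem_zip hz).1
  obtain ⟨c, ch, rfl⟩ := List.exists_cons_of_ne_nil h0
  rcases p with _ | ⟨a, p⟩
  · simp at hlen
  · simp

theorem weightedSum_fst (ch : List ℕ) (p : ℕ → ℝ) (y : ℕ → ℝ × ℝ × ℝ) :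
    (weightedSum ch p y).1 = ∑ j ∈ Finset.range ch.length, p j * (y (ch.getD j 0)).1 := by
  simp [weightedSum, Prod.fst_sum]

theorem weightedSum_snd_fst (ch : List ℕ) (p : ℕ → ℝ) (y : ℕ → ℝ × ℝ × ℝ) :
    (weightedSum ch p y).2.1 = ∑ j ∈ Finset.range ch.length, p j * (y (ch.getD j 0)).2.1 := by
  simp [weightedSum, Prod.fst_sum, Prod.snd_sum]

theorem weightedSum_snd_snd (ch : List ℕ) (p : ℕ → ℝ) (y : ℕ → ℝ × ℝ × ℝ) :
    (weightedSum ch p y).2.2 = ∑ j ∈ Finset.range ch.length, p j * (y (ch.getD j 0)).2.2 := by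
  simp [weightedSum, Prod.snd_sum]

theorem getD_mem_of_mem_range {ch : List ℕ} {j : ℕ} (hj : j ∈ Finset.range ch.length) :
    ch.getD j 0 ∈ ch := by
  rw [List.getD_eq_getElem _ _ (Finset.mem_range.1 hj)]
  exact List.getElem_mem _

section dot

variable {vals : List NodeBound} {ch : List ℕ} {p : List ℚ} {φ : Bool}

/-- For fixed nonnegative weights, the weighted sum of the children's optima bounds the objective,
and the interval ends are treated likewise. -/
theorem inside_dot (hlen : p.length = ch.length) (h0 : ch ≠ []) (hp : ∀ a ∈ p, 0 ≤ a)
    (hch : ∀ c ∈ ch, (vals.getD c .zero).WF) (hφ : ∀ c ∈ ch, (vals.getD c .zero).hasQuery = φ)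
    {y : ℕ → ℝ × ℝ × ℝ} (hy : ∀ c ∈ ch, o.Inside (vals.getD c .zero) (y c)) :
    o.Inside (dot vals ch p) (weightedSum ch (fun j => ((p.getD j 0 : ℚ) : ℝ)) y) := by
  obtain ⟨-, h1, h2⟩ := dot_val vals ch p hlen hp hch
  have hp' : ∀ j, (0 : ℝ) ≤ ((p.getD j 0 : ℚ) : ℝ) := by
    intro j
    by_cases hj : j < p.length
    · rw [List.getD_eq_getElem _ _ hj]
      exact_mod_cast hp _ (List.getElem_mem _)
    · rw [List.getD_eq_default _ _ (not_lt.1 hj)]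
      simp
  rw [Inside, hasQuery_dot hlen h0 hφ, weightedSum_fst, weightedSum_snd_fst, weightedSum_snd_snd]
  refine ⟨Finset.sum_nonneg fun j hj => mul_nonneg (hp' j) (hy _ (getD_mem_of_mem_range hj)).1,
    Finset.sum_nonneg fun j hj => mul_nonneg (hp' j) (hy _ (getD_mem_of_mem_range hj)).2.1, ?_⟩
  have hy' : ∀ j ∈ Finset.range ch.length, if φ = true then _ else _ := fun j hj => by
    have := (hy _ (getD_mem_of_mem_range hj)).2.2
    rw [hφ _ (getD_mem_of_mem_range hj)] at this
    exact this
  rw [h1, h2]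
  cases φ with
  | true =>
    simp only [if_true] at hy' ⊢
    constructor
    · rw [← Finset.sum_add_distrib]
      exact Finset.sum_congr rfl fun j hj => by rw [(hy' j hj).1, mul_add]
    · simp only [Finset.mul_sum]
      rw [← Finset.sum_sub_distrib, ← Finset.sum_sub_distrib]
      refine Finset.sum_le_sum fun j hj => ?_
      have := mul_le_mul_of_nonneg_left (hy' j hj).2 (hp' j)
      linarith
  | false =>
    simp only [Bool.false_eq_true, if_false] at hy' ⊢
    refine ⟨Finset.sum_congr rfl fun j hj => by rw [(hy' j hj).1],
      Finset.sum_congr rfl fun j hj => by rw [(hy' j hj).2.1],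
      Finset.sum_le_sum fun j hj => mul_le_mul_of_nonneg_left (hy' j hj).2.2.1 (hp' j),
      Finset.sum_le_sum fun j hj => mul_le_mul_of_nonneg_left (hy' j hj).2.2.2 (hp' j)⟩

/-- With the query variable, every child takes its optimal pair. Without it, all children take their
lower values together, or all take their upper values together. -/
theorem attains_dot (hlen : p.length = ch.length) (h0 : ch ≠ []) (hp : ∀ a ∈ p, 0 ≤ a)
    (hch : ∀ c ∈ ch, (vals.getD c .zero).WF) (hφ : ∀ c ∈ ch, (vals.getD c .zero).hasQuery = φ)
    {t : ℝ × ℝ × ℝ} (ht : Attains (dot vals ch p) t) :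
    ∃ y : ℕ → ℝ × ℝ × ℝ, (∀ c ∈ ch, Attains (vals.getD c .zero) (y c)) ∧
      weightedSum ch (fun j => ((p.getD j 0 : ℚ) : ℝ)) y = t := by
  obtain ⟨-, h1, h2⟩ := dot_val vals ch p hlen hp hch
  rw [Attains, hasQuery_dot hlen h0 hφ, h1, h2] at ht
  cases φ with
  | true =>
    rw [if_pos rfl] at ht
    refine ⟨fun c => ((vals.getD c .zero).fst.val, (vals.getD c .zero).snd.val,
      (vals.getD c .zero).fst.val + (vals.getD c .zero).snd.val), fun c hc => by
        rw [Attains, hφ c hc, if_pos rfl], ?_⟩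
    rw [ht]
    refine Prod.ext ?_ (Prod.ext ?_ ?_)
    · rw [weightedSum_fst]
    · rw [weightedSum_snd_fst]
    · rw [weightedSum_snd_snd]
      simp only [mul_add, Finset.sum_add_distrib]
  | false =>
    rw [if_neg Bool.false_ne_true] at ht
    rcases ht with ht | ht
    · refine ⟨fun c => ((vals.getD c .zero).fst.val, (vals.getD c .zero).fst.val,
        (vals.getD c .zero).fst.val), fun c hc => by
          rw [Attains, hφ c hc, if_neg Bool.false_ne_true]; exact .inl rfl, ?_⟩
      rw [ht]
      refine Prod.ext ?_ (Prod.ext ?_ ?_)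
      · rw [weightedSum_fst]
      · rw [weightedSum_snd_fst]
      · rw [weightedSum_snd_snd]
    · refine ⟨fun c => ((vals.getD c .zero).snd.val, (vals.getD c .zero).snd.val,
        (vals.getD c .zero).snd.val), fun c hc => by
          rw [Attains, hφ c hc, if_neg Bool.false_ne_true]; exact .inr rfl, ?_⟩
      rw [ht]
      refine Prod.ext ?_ (Prod.ext ?_ ?_)
      · rw [weightedSum_fst]
      · rw [weightedSum_snd_fst]
      · rw [weightedSum_snd_snd]

end dot

/-- For fixed values of the children, the value of the node is linear in its weights, so bounds need
to be checked only at the generators, and the best generator attains them. -/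
theorem evalNode_sum_spec {vals : List NodeBound} {ch : List ℕ} {points : List (List ℚ)} {φ : Bool}
    (h0 : ch ≠ []) (hpt : points ≠ [])
    (hp : ∀ p ∈ points, p.length = ch.length ∧ ∀ a ∈ p, 0 ≤ a)
    (hch : ∀ c ∈ ch, (vals.getD c .zero).WF) (hφ : ∀ c ∈ ch, (vals.getD c .zero).hasQuery = φ) :
    (o.evalNode vals (.sum ch points)).WF ∧ (o.evalNode vals (.sum ch points)).hasQuery = φ ∧
    (∀ y : ℕ → ℝ × ℝ × ℝ, (∀ c ∈ ch, o.Inside (vals.getD c .zero) (y c)) →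
      ∀ w ∈ CSPN.credalSet points,
        o.Inside (o.evalNode vals (.sum ch points)) (weightedSum ch w y)) ∧
    ∀ t, Attains (o.evalNode vals (.sum ch points)) t → ∃ y : ℕ → ℝ × ℝ × ℝ,
      (∀ c ∈ ch, Attains (vals.getD c .zero) (y c)) ∧ ∃ w ∈ CSPN.credalSet points,
        weightedSum ch w y = t := by
  have hhead : points.headD [] ∈ points := by
    obtain ⟨p, l, rfl⟩ := List.exists_cons_of_ne_nil hpt
    simp
  have hD : ∀ p ∈ points, (dot vals ch p).WF ∧ (dot vals ch p).hasQuery = φ := fun p hpp =>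
    ⟨(dot_val vals ch p (hp p hpp).1 (hp p hpp).2 hch).1, hasQuery_dot (hp p hpp).1 h0 hφ⟩
  obtain ⟨h1, h2, -, h4, h5⟩ := foldl_join_spec (o := o) (dot vals ch) points
    (dot vals ch (points.headD [])) (hD _ hhead).1 fun p hpp => by
      rw [(hD _ hhead).2]; exact hD p hpp
  refine ⟨h1, h2.trans (hD _ hhead).2, fun y hy w hw => ?_, fun t ht => ?_⟩
  -- The preimage of the convex set of allowed values under this linear map is convex and contains
  -- the generators, hence also their hull.
  · let L : (ℕ → ℝ) →ₗ[ℝ] ℝ × ℝ × ℝ :=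
      ∑ j ∈ Finset.range ch.length, (LinearMap.proj j : (ℕ → ℝ) →ₗ[ℝ] ℝ).smulRight (y (ch.getD j 0))
    have hL : ∀ w, L w = weightedSum ch w y := fun w => by
      simp [L, weightedSum, LinearMap.sum_apply]
    rw [← hL]
    refine convexHull_min (s := _) (t := L ⁻¹' {y | o.Inside (o.evalNode vals (.sum ch points)) y})
      ?_ ((convex_inside _).linear_preimage L) hw
    rintro _ ⟨p, hpp, rfl⟩
    change o.Inside _ (L _)
    rw [hL]
    exact h4 p hpp _ (inside_dot (hp p hpp).1 h0 (hp p hpp).2 hch hφ hy)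
  · have : ∃ p ∈ points, Attains (dot vals ch p) t := by
      rcases h5 t ht with h | h
      · exact ⟨_, hhead, h⟩
      · exact h
    obtain ⟨p, hpp, ht⟩ := this
    obtain ⟨y, hy, hyt⟩ := attains_dot (hp p hpp).1 h0 (hp p hpp).2 hch hφ ht
    exact ⟨y, hy, _, subset_convexHull ℝ _ ⟨p, hpp, rfl⟩, hyt⟩

theorem evalNode_prod_spec {vals : List NodeBound} {ch : List ℕ}
    (hch : ∀ c ∈ ch, (vals.getD c .zero).WF)
    (hd : ch.Pairwise fun c c' => ¬ ((vals.getD c .zero).hasQuery = true ∧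
      (vals.getD c' .zero).hasQuery = true)) :
    (o.evalNode vals (.prod ch)).WF ∧
    (o.evalNode vals (.prod ch)).hasQuery = ch.any (fun c => (vals.getD c .zero).hasQuery) ∧
    (∀ y : ℕ → ℝ × ℝ × ℝ, (∀ c ∈ ch, o.Inside (vals.getD c .zero) (y c)) →
        o.Inside (o.evalNode vals (.prod ch)) (ch.map y).prod) ∧
    ∀ t, Attains (o.evalNode vals (.prod ch)) t → ∃ ys : List (ℝ × ℝ × ℝ),
      List.Forall₂ (fun c y => Attains (vals.getD c .zero) y) ch ys ∧ t = ys.prod := by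
  obtain ⟨h1, h2, h3, h4⟩ := foldl_mul_spec (o := o) (ch.map fun c => vals.getD c .zero) .one
    NodeBound.wf_one (by simpa using hch) (by
      -- The initial factor `one` carries no query variable, so it conflicts with no child.
      refine List.pairwise_cons.2 ⟨fun v _ h => by simp [NodeBound.one] at h, ?_⟩
      rw [List.pairwise_map]
      exact hd)
  rw [List.foldl_map] at h1 h2 h3 h4
  refine ⟨h1, ?_, fun y hy => ?_, fun t ht => ?_⟩
  · rw [evalNode, h2, List.any_map]
    rfl
  · rw [← one_mul (ch.map y).prod]
    refine h3 _ _ inside_one ?_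
    rw [List.forall₂_map_left_iff, List.forall₂_map_right_iff, List.forall₂_same]
    exact hy
  · obtain ⟨y, ys, hy, hys, rfl⟩ := h4 t ht
    rw [List.forall₂_map_left_iff] at hys
    exact ⟨ys, hys, by rw [eq_one_of_attains hy, one_mul]⟩

end Objective

/-! ### Tables and weights -/

section table

variable {α β : Type*} (F : List β → α → β)

theorem getD_foldl_table_of_getElem? {N : List α} {i : ℕ} {a : α} (h : N[i]? = some a) (d : β) :
    (N.foldl (fun vals a => vals ++ [F vals a]) []).getD i d =
      F ((N.take i).foldl (fun vals a => vals ++ [F vals a]) []) a := by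
  obtain ⟨hi, rfl⟩ := List.getElem?_eq_some_iff.1 h
  have hl : (N.take i).length = i := by rw [List.length_take]; omega
  rw [getD_foldl_table_of_prefix F (N := N.take i ++ [N[i]]) (N' := N)
    (by rw [← List.take_succ_eq_append_getElem hi]; exact List.take_prefix _ _) (by simp; omega)]
  have := getD_foldl_table_length F (N.take i) N[i] d
  rwa [hl] at this

end table

namespace CSPN

variable {n : ℕ}

/-- The weights `w` are admissible at the sum nodes of the table `N`. -/
def Admissible (w : ℕ → ℕ → ℝ) (N : List (CSPNNode n)) : Prop :=
  ∀ i ch points, N[i]? = some (CSPNNode.sum ch points) → w i ∈ credalSet points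

theorem admissible_append_singleton {w : ℕ → ℕ → ℝ} {N : List (CSPNNode n)} {nd : CSPNNode n} :
    Admissible w (N ++ [nd]) ↔ Admissible w N ∧
      ∀ ch points, nd = CSPNNode.sum ch points → w N.length ∈ credalSet points := by
  constructor
  · intro h
    refine ⟨fun i ch points hi => h i ch points ?_, fun ch points hnd => h N.length ch points ?_⟩
    · rw [List.getElem?_append_left (List.getElem?_eq_some_iff.1 hi).1, hi]
    · simp [hnd]
  · rintro ⟨h, h'⟩ i ch points hi
    rcases lt_trichotomy i N.length with hlt | rfl | hlt
    · rw [List.getElem?_append_left hlt] at hi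
      exact h i ch points hi
    · exact h' ch points (by simpa using hi)
    · rw [List.getElem?_eq_none (by simp; omega)] at hi
      simp at hi

theorem Admissible.of_prefix {w : ℕ → ℕ → ℝ} {N N' : List (CSPNNode n)} (h : Admissible w N')
    (hN : N <+: N') : Admissible w N := fun i ch points hi =>
  h i ch points (by
    rw [← hi]
    exact (List.prefix_iff_getElem?.1 hN i (List.getElem?_eq_some_iff.1 hi).1).trans
      (List.getElem?_eq_getElem _).symm)

theorem Admissible.congr {w w' : ℕ → ℕ → ℝ} {N : List (CSPNNode n)} (h : Admissible w N)
    (hw : ∀ i < N.length, w' i = w i) : Admissible w' N := fun i ch points hi => by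
  rw [hw i (List.getElem?_eq_some_iff.1 hi).1]
  exact h i ch points hi

theorem nodeValues_congr (lam : Fin n → Bool → ℝ) {w w' : ℕ → ℕ → ℝ} (N : List (CSPNNode n))
    (hw : ∀ i < N.length, w' i = w i) : nodeValues lam w' N = nodeValues lam w N := by
  induction N using List.reverseRecOn with
  | nil => rfl
  | append_singleton N nd ih =>
    have ih := ih fun i hi => hw i (by simp; omega)
    unfold nodeValues at ih ⊢
    rw [List.foldl_append, List.foldl_append, ih, List.foldl_cons, List.foldl_cons,
      length_foldl_table (fun vals nd => nodeValue lam (w vals.length) vals nd),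
      hw N.length (by simp)]
    rfl

end CSPN

-- Values and computed bounds in growing tables

namespace Objective

variable {n : ℕ} (o : Objective n)

/-- The values of the node `i` of the table `N` at the target value of the query variable together
with the evidence, at its other value together with the evidence, and at the evidence. -/
noncomputable def values (w : ℕ → ℕ → ℝ) (N : List (CSPNNode n)) (i : ℕ) : ℝ × ℝ × ℝ :=
  ((CSPN.nodeValues (queryConfig o.evidence o.var o.target) w N).getD i 0,
    (CSPN.nodeValues (queryConfig o.evidence o.var (!o.target)) w N).getD i 0,
    (CSPN.nodeValues (evidenceConfig o.evidence) w N).getD i 0)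

/-- The bound computed for the node `i` of the table `N`. -/
def boundAt (N : List (CSPNNode n)) (i : ℕ) : NodeBound := (o.evalTable N).getD i .zero

variable {o} {w w' : ℕ → ℕ → ℝ} {N N' : List (CSPNNode n)}

theorem values_of_prefix (h : N <+: N') {i : ℕ} (hi : i < N.length) :
    o.values w N' i = o.values w N i := by
  unfold values CSPN.nodeValues
  rw [getD_foldl_table_of_prefix (fun vals nd => CSPN.nodeValue _ (w vals.length) vals nd) h hi,
    getD_foldl_table_of_prefix (fun vals nd => CSPN.nodeValue _ (w vals.length) vals nd) h hi,
    getD_foldl_table_of_prefix (fun vals nd => CSPN.nodeValue _ (w vals.length) vals nd) h hi]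

theorem values_congr (hw : ∀ i < N.length, w' i = w i) (i : ℕ) :
    o.values w' N i = o.values w N i := by
  unfold values
  rw [CSPN.nodeValues_congr _ N hw, CSPN.nodeValues_congr _ N hw, CSPN.nodeValues_congr _ N hw]

theorem boundAt_of_prefix (h : N <+: N') {i : ℕ} (hi : i < N.length) :
    o.boundAt N' i = o.boundAt N i :=
  getD_foldl_table_of_prefix _ h hi _

theorem boundAt_length (nd : CSPNNode n) :
    o.boundAt (N ++ [nd]) N.length = o.evalNode (o.evalTable N) nd :=
  getD_foldl_table_length _ _ _ _

theorem getD_nodeValues_length (lam : Fin n → Bool → ℝ) (nd : CSPNNode n) :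
    (CSPN.nodeValues lam w (N ++ [nd])).getD N.length 0 =
      CSPN.nodeValue lam (w N.length) (CSPN.nodeValues lam w N) nd := by
  unfold CSPN.nodeValues
  rw [getD_foldl_table_length (fun vals nd => CSPN.nodeValue lam (w vals.length) vals nd),
    length_foldl_table (fun vals nd => CSPN.nodeValue lam (w vals.length) vals nd)]

theorem values_prod (ch : List ℕ) :
    o.values w (N ++ [.prod ch]) N.length = (ch.map (o.values w N)).prod := by
  unfold values
  simp only [getD_nodeValues_length, CSPN.nodeValue]
  induction ch with
  | nil => rfl
  | cons c ch ih =>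
    simp only [List.map_cons, List.prod_cons]
    rw [← ih]
    rfl

theorem values_sum (ch : List ℕ) (points : List (List ℚ)) :
    o.values w (N ++ [.sum ch points]) N.length = weightedSum ch (w N.length) (o.values w N) := by
  refine Prod.ext ?_ (Prod.ext ?_ ?_)
  · rw [weightedSum_fst]
    simp only [values, getD_nodeValues_length, CSPN.nodeValue]
  · rw [weightedSum_snd_fst]
    simp only [values, getD_nodeValues_length, CSPN.nodeValue]
  · rw [weightedSum_snd_snd]
    simp only [values, getD_nodeValues_length, CSPN.nodeValue]

theorem boundAt_of_getElem? {i : ℕ} {v : Fin n} {b : Bool} (h : N[i]? = some (.ind v b)) :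
    o.boundAt N i = o.leaf v b :=
  getD_foldl_table_of_getElem? _ h _

theorem values_of_getElem? {i : ℕ} {v : Fin n} {b : Bool} (h : N[i]? = some (.ind v b)) :
    o.values w N i = (queryConfig o.evidence o.var o.target v b,
      queryConfig o.evidence o.var (!o.target) v b, evidenceConfig o.evidence v b) := by
  unfold values CSPN.nodeValues
  rw [getD_foldl_table_of_getElem? (fun vals nd => CSPN.nodeValue _ (w vals.length) vals nd) h,
    getD_foldl_table_of_getElem? (fun vals nd => CSPN.nodeValue _ (w vals.length) vals nd) h,
    getD_foldl_table_of_getElem? (fun vals nd => CSPN.nodeValue _ (w vals.length) vals nd) h]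
  rfl

/-- For an indicator of the query variable, one query value gives 0 and the other gives the evidence
value, so they add up to it. For any other variable the query has no influence and all three values
coincide. -/
theorem leaf_spec (v : Fin n) (b : Bool) :
    (o.leaf v b).WF ∧ (o.leaf v b).hasQuery = decide (o.var = v) ∧
    o.Inside (o.leaf v b) (queryConfig o.evidence o.var o.target v b,
      queryConfig o.evidence o.var (!o.target) v b, evidenceConfig o.evidence v b) ∧
    ∀ y, Attains (o.leaf v b) y → y = (queryConfig o.evidence o.var o.target v b,
      queryConfig o.evidence o.var (!o.target) v b, evidenceConfig o.evidence v b) := by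
  by_cases hv : v = o.var
  · subst hv
    by_cases hb : b = o.target
    · subst hb
      by_cases he : o.evidence o.var = some (!o.target) <;>
      refine ⟨⟨?_, ?_, ?_, ?_⟩, ?_⟩ <;>
        simp [leaf, Inside, Attains, queryConfig, evidenceConfig, Fraction.val, he]
    · obtain rfl : b = !o.target := by cases b <;> cases h : o.target <;> simp_all
      by_cases he : o.evidence o.var = some (o.target) <;>
      refine ⟨⟨?_, ?_, ?_, ?_⟩, ?_⟩ <;>
        simp [leaf, Inside, Attains, queryConfig, evidenceConfig, Fraction.val, he]
  · by_cases he : o.evidence v = some (!b) <;>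
    refine ⟨⟨?_, ?_, ?_, ?_⟩, ?_⟩ <;>
      simp [leaf, Inside, Attains, queryConfig, evidenceConfig, Fraction.val, he, hv, Ne.symm hv]

end Objective

/-! ### Indicator nodes -/

theorem getElem?_flatMap_pair {α β : Type*} (f g : α → β) (l : List α) (k : ℕ) :
    (l.flatMap fun a => [f a, g a])[2 * k]? = l[k]?.map f ∧
      (l.flatMap fun a => [f a, g a])[2 * k + 1]? = l[k]?.map g := by
  induction l generalizing k with
  | nil => simp
  | cons a l ih =>
    rcases k with _ | k
    · simp
    · rw [List.flatMap_cons, show 2 * (k + 1) = 2 * k + 1 + 1 by ring]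
      simpa using ih k

theorem getElem?_indicatorNodes {n : ℕ} (v : Fin n) :
    (indicatorNodes n)[2 * (v : ℕ)]? = some (.ind v true) ∧
      (indicatorNodes n)[2 * (v : ℕ) + 1]? = some (.ind v false) := by
  have h := getElem?_flatMap_pair (fun v => CSPNNode.ind v true) (fun v : Fin n => .ind v false)
    (List.finRange n) v
  have hv : (List.finRange n)[(v : ℕ)]? = some v := by
    rw [List.getElem?_eq_getElem (by simp)]
    simp
  rwa [hv] at h

theorem getElem?_of_prefix {α : Type*} {N N' : List α} (h : N <+: N') {i : ℕ} {a : α}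
    (hi : N[i]? = some a) : N'[i]? = some a := by
  obtain ⟨L, rfl⟩ := h
  rw [List.getElem?_append_left (List.getElem?_eq_some_iff.1 hi).1, hi]

/-! ### The learned networks are evaluated correctly -/

/-- The total size of the nodes of a table. -/
def tableSize {n : ℕ} (N : List (CSPNNode n)) : ℕ := (N.map fun nd => (Data.ofNode nd).size).sum

theorem tableSize_append_singleton {n : ℕ} (N : List (CSPNNode n)) (nd : CSPNNode n) :
    tableSize (N ++ [nd]) = tableSize N + (Data.ofNode nd).size := by
  simp [tableSize]

theorem tableSize_le_of_prefix {n : ℕ} {N N' : List (CSPNNode n)} (h : N <+: N') :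
    tableSize N ≤ tableSize N' := by
  obtain ⟨L, rfl⟩ := h
  simp [tableSize]

namespace Objective

variable {n : ℕ} (o : Objective n)

/-- The table `N` is extended to `N'` in such a way that the bounds at the nodes `roots`
are correct, and attained by weights that may be chosen independently of one another and of the
weights in `N`. -/
structure Children (N N' : List (CSPNNode n)) (roots : List ℕ) : Prop where
  isPrefix : N <+: N'
  lt_length : ∀ r ∈ roots, r < N'.length
  wf : ∀ r ∈ roots, (o.boundAt N' r).WF
  inside : ∀ r ∈ roots, ∀ w, CSPN.Admissible w N' → o.Inside (o.boundAt N' r) (o.values w N' r)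
  attains : ∀ w₀, CSPN.Admissible w₀ N → ∀ ys,
    List.Forall₂ (fun r y => Attains (o.boundAt N' r) y) roots ys →
    ∃ w, CSPN.Admissible w N' ∧ (∀ i < N.length, w i = w₀ i) ∧ roots.map (o.values w N') = ys
  bits_sum : (roots.map fun r => (o.boundAt N' r).bits).sum + tableSize N ≤
    tableSize N' + 2 * roots.length
  bits : ∀ i, N.length ≤ i → i < N'.length → (o.boundAt N' i).bits ≤ tableSize N'

/-- The table `N` is extended to `N'` in such a way that the bound at the node `r` is correct, and
attained by weights that may be chosen independently of the weights in `N`. -/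
structure Subnetwork (φ : Bool) (N N' : List (CSPNNode n)) (r : ℕ) : Prop where
  isPrefix : N <+: N'
  lt_length : r < N'.length
  hasQuery : (o.boundAt N' r).hasQuery = φ
  wf : (o.boundAt N' r).WF
  inside : ∀ w, CSPN.Admissible w N' → o.Inside (o.boundAt N' r) (o.values w N' r)
  attains : ∀ w₀, CSPN.Admissible w₀ N → ∀ y, Attains (o.boundAt N' r) y →
    ∃ w, CSPN.Admissible w N' ∧ (∀ i < N.length, w i = w₀ i) ∧ o.values w N' r = y
  bits_root : (o.boundAt N' r).bits + tableSize N ≤ tableSize N'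
  bits : ∀ i, N.length ≤ i → i < N'.length → (o.boundAt N' i).bits ≤ tableSize N'

variable {o} {N N' N'' : List (CSPNNode n)} {roots : List ℕ}

theorem Children.nil (N : List (CSPNNode n)) : o.Children N N [] where
  isPrefix := List.prefix_rfl
  lt_length := by simp
  wf := by simp
  inside := by simp
  attains w₀ hw₀ ys hys := ⟨w₀, hw₀, fun _ _ => rfl, by cases hys; rfl⟩
  bits_sum := by simp
  bits i h h' := by omega

/-- The remaining children only append nodes. Weights that realise the first child are passed on as
the initial weights for the others, which extend them without changing them; this is where
independence of the subnetworks is used. -/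
theorem Children.cons {φ : Bool} {r : ℕ} (h : o.Subnetwork φ N N' r) (hs : o.Children N' N'' roots)
    :
    o.Children N N'' (r :: roots) := by
  have hr : o.boundAt N'' r = o.boundAt N' r := boundAt_of_prefix hs.isPrefix h.lt_length
  have hv : ∀ w, o.values w N'' r = o.values w N' r := fun w =>
    values_of_prefix hs.isPrefix h.lt_length
  have hlen := hs.isPrefix.length_le
  refine ⟨h.isPrefix.trans hs.isPrefix, ?_, ?_, ?_, ?_, ?_, ?_⟩
  · rw [List.forall_mem_cons]
    exact ⟨h.lt_length.trans_le hlen, hs.lt_length⟩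
  · rw [List.forall_mem_cons, hr]
    exact ⟨h.wf, hs.wf⟩
  · rw [List.forall_mem_cons, hr]
    refine ⟨fun w hw => ?_, hs.inside⟩
    rw [hv]
    exact h.inside w (hw.of_prefix hs.isPrefix)
  · rintro w₀ hw₀ _ (_ | ⟨hy, hys⟩)
    rw [hr] at hy
    obtain ⟨w, hw, hww₀, hwy⟩ := h.attains w₀ hw₀ _ hy
    obtain ⟨w', hw', hww', hwys⟩ := hs.attains w hw _ hys
    refine ⟨w', hw', fun i hi => (hww' i (hi.trans_le h.isPrefix.length_le)).trans (hww₀ i hi), ?_⟩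
    rw [List.map_cons, hwys, hv, values_congr hww', hwy]
  · have h1 := h.bits_root
    have h2 := hs.bits_sum
    rw [List.map_cons, List.sum_cons, hr, List.length_cons]
    omega
  · intro i hi hi'
    by_cases h' : i < N'.length
    · rw [boundAt_of_prefix hs.isPrefix h']
      exact (h.bits i hi h').trans (tableSize_le_of_prefix hs.isPrefix)
    · exact hs.bits i (not_lt.1 h') hi'

/-- Covers what both kinds of parent have in common. The allowance of 2 bits per child in
`Children.bits_sum` is paid back here by the encoding of the parent, so no slack is left in
`bits_root`. -/
theorem Subnetwork.append {φ : Bool} {nd : CSPNNode n} (h : o.Children N N' roots)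
    (hφ : (o.evalNode (o.evalTable N') nd).hasQuery = φ) (hwf : (o.evalNode (o.evalTable N') nd).WF)
    (hinside : ∀ w, CSPN.Admissible w (N' ++ [nd]) →
      o.Inside (o.evalNode (o.evalTable N') nd) (o.values w (N' ++ [nd]) N'.length))
    (hattains : ∀ w₀, CSPN.Admissible w₀ N → ∀ y, Attains (o.evalNode (o.evalTable N') nd) y →
      ∃ w, CSPN.Admissible w (N' ++ [nd]) ∧ (∀ i < N.length, w i = w₀ i) ∧
        o.values w (N' ++ [nd]) N'.length = y)
    (hbits : (o.evalNode (o.evalTable N') nd).bits + 2 * roots.length ≤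
      (roots.map fun r => (o.boundAt N' r).bits).sum + (Data.ofNode nd).size) :
    o.Subnetwork φ N (N' ++ [nd]) N'.length := by
  have h1 := h.bits_sum
  have h2 := tableSize_append_singleton N' nd
  have h3 := tableSize_le_of_prefix h.isPrefix
  refine ⟨h.isPrefix.trans (List.prefix_append _ _), by simp, ?_, ?_, ?_, ?_, ?_, ?_⟩
  · rwa [boundAt_length]
  · rwa [boundAt_length]
  · rwa [boundAt_length]
  · rwa [boundAt_length]
  · rw [boundAt_length]
    omega
  · intro i hi hi'
    by_cases h' : i < N'.length
    · rw [boundAt_of_prefix (List.prefix_append _ _) h']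
      have := h.bits i hi h'
      omega
    · obtain rfl : i = N'.length := by simp at hi'; omega
      rw [boundAt_length]
      omega

theorem Subnetwork.prod (h : o.Children N N' roots)
    (hd : roots.Pairwise fun c c' => ¬ ((o.boundAt N' c).hasQuery = true ∧
      (o.boundAt N' c').hasQuery = true)) :
    o.Subnetwork (roots.any fun c => (o.boundAt N' c).hasQuery) N (N' ++ [.prod roots])
      N'.length := by
  obtain ⟨h1, h2, h3, h4⟩ := evalNode_prod_spec (o := o) h.wf hd
  refine Subnetwork.append h h2 h1 (fun w hw => ?_) (fun w₀ hw₀ y hy => ?_) ?_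
  · rw [values_prod]
    exact h3 _ fun c hc => h.inside c hc w (CSPN.admissible_append_singleton.1 hw).1
  · obtain ⟨ys, hys, rfl⟩ := h4 y hy
    obtain ⟨w, hw, hww, hwy⟩ := h.attains w₀ hw₀ ys hys
    refine ⟨w, CSPN.admissible_append_singleton.2 ⟨hw, by simp⟩, hww, ?_⟩
    rw [values_prod, hwy]
  · have h5 := o.bits_prod_le (o.evalTable N') roots
    -- Each entry of the list of children costs at least 2 in the encoding: one for the pair and one
    -- for the leaf.
    have h6 : 1 + 2 * roots.length ≤ (Data.ofNode (CSPNNode.prod roots : CSPNNode n)).size := by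
      simp only [Data.ofNode, Data.size_pair, Data.size_int, Data.size_ofList]
      have : roots.length * 2 ≤ (roots.map fun a => 1 + (Data.ofNat a).size).sum := by
        rw [← List.length_map (fun a => 1 + (Data.ofNat a).size), ← smul_eq_mul]
        refine List.card_nsmul_le_sum _ _ fun k hk => ?_
        obtain ⟨c, -, rfl⟩ := List.mem_map.1 hk
        simp only [Data.ofNat, Data.size_int]
        omega
      omega
    change (o.evalNode (o.evalTable N') (.prod roots)).bits ≤
      1 + (roots.map fun r => (o.boundAt N' r).bits).sum at h5
    omega

theorem sum_zip_le {α β : Type*} (f : α → ℕ) (g : β → ℕ) (l : List α) (l' : List β) :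
    ((l.zip l').map fun z => f z.1 + g z.2).sum ≤ (l.map f).sum + (l'.map g).sum := by
  induction l generalizing l' with
  | nil => simp
  | cons a l ih =>
    rcases l' with _ | ⟨b, l'⟩
    · simp
    · have := ih l'
      simp only [List.zip_cons_cons, List.map_cons, List.sum_cons]
      omega

theorem Subnetwork.sum {φ : Bool} {points : List (List ℚ)} (h : o.Children N N' roots)
    (h0 : roots ≠ []) (hpt : points ≠ [])
    (hp : ∀ p ∈ points, p.length = roots.length ∧ ∀ a ∈ p, 0 ≤ a)
    (hφ : ∀ c ∈ roots, (o.boundAt N' c).hasQuery = φ) :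
    o.Subnetwork φ N (N' ++ [.sum roots points]) N'.length := by
  obtain ⟨h1, h2, h3, h4⟩ := evalNode_sum_spec (o := o) h0 hpt hp h.wf hφ
  refine Subnetwork.append h h2 h1 (fun w hw => ?_) (fun w₀ hw₀ y hy => ?_) ?_
  · rw [values_sum]
    obtain ⟨hw, hw'⟩ := CSPN.admissible_append_singleton.1 hw
    exact h3 _ (fun c hc => h.inside c hc w hw) _ (hw' _ _ rfl)
  · obtain ⟨ys, hys, p, hpp, rfl⟩ := h4 y hy
    obtain ⟨w, hw, hww, hwy⟩ := h.attains w₀ hw₀ (roots.map ys) (by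
      rw [List.forall₂_map_right_iff, List.forall₂_same]
      exact hys)
    -- The new node has its own position, so its weights can be set to the best generator without
    -- disturbing the children.
    have hupd : ∀ i < N'.length, Function.update w N'.length p i = w i := fun i hi =>
      Function.update_of_ne hi.ne _ _
    refine ⟨Function.update w N'.length p, CSPN.admissible_append_singleton.2
      ⟨hw.congr hupd, fun ch points e => ?_⟩,
      fun i hi => (hupd i (hi.trans_le h.isPrefix.length_le)).trans (hww i hi), ?_⟩
    · obtain ⟨rfl, rfl⟩ := CSPNNode.sum.inj e
      rwa [Function.update_self]
    · rw [values_sum, Function.update_self]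
      have hv := List.map_inj_left.1 hwy
      unfold weightedSum
      refine Finset.sum_congr rfl fun j hj => ?_
      rw [values_congr hupd, hv _ (getD_mem_of_mem_range hj)]
  · have h5 : (o.evalNode (o.evalTable N') (.sum roots points)).bits + 2 * roots.length ≤
        (roots.map fun r => (o.boundAt N' r).bits).sum +
          (Data.ofList (Data.ofList Data.ofRat) points).size := by
      have h6 : ∀ p ∈ points, (dot (o.evalTable N') roots p).bits ≤
          (roots.map fun r => (o.boundAt N' r).bits).sum +
          (Data.ofList (Data.ofList Data.ofRat) points).size - 2 * roots.length := fun p hpp => by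
        have h7 := bits_dot_le (o.evalTable N') roots p
        have h8 := sum_zip_le (fun r => (o.boundAt N' r).bits)
          (fun a => (Fraction.ofRat a).bits + 1) roots p
        have h9 : ((roots.zip p).map fun z => (Fraction.ofRat z.2).bits +
            ((o.evalTable N').getD z.1 .zero).bits + 1).sum = ((roots.zip p).map fun z =>
            (o.boundAt N' z.1).bits + ((Fraction.ofRat z.2).bits + 1)).sum := by
          congr 2
          funext z
          rw [boundAt]
          omega
        have h10 := Data.size_le_size_ofList (Data.ofList Data.ofRat) hpp
        -- The encoding of a generator pays for its bits, for one extra bit per addition, for the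
        -- initial `zero`, and for the allowance of 2 per child.
        have h11 : (p.map fun a => (Fraction.ofRat a).bits + 1).sum + 1 + 2 * p.length ≤
            (Data.ofList Data.ofRat p).size := by
          clear h10 h8 h9 h7 hpp
          induction p with
          | nil => simp [Data.ofList]
          | cons a p ih =>
            have := (Fraction.ofRat a).bits_add_three_le_size
            have h5 : (Fraction.ofRat a).toData = Data.ofRat a := rfl
            rw [h5] at this
            simp only [List.map_cons, List.sum_cons, List.length_cons, Data.ofList, Data.size_pair]
            omega
        have h12 := (hp p hpp).1
        omega
      have h13 := o.bits_sum_le (o.evalTable N') roots hpt h6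
      -- Shows that the subtraction of natural numbers in the bound above is not truncated.
      have h14 : 2 * roots.length ≤ (Data.ofList (Data.ofList Data.ofRat) points).size := by
        obtain ⟨p, l, rfl⟩ := List.exists_cons_of_ne_nil hpt
        have h15 := (hp p (by simp)).1
        have h16 := Data.size_ofList Data.ofRat p
        have h17 : p.length * 2 ≤ (p.map fun a => 1 + (Data.ofRat a).size).sum := by
          rw [← List.length_map (fun a => 1 + (Data.ofRat a).size), ← smul_eq_mul]
          refine List.card_nsmul_le_sum _ _ fun k hk => ?_
          obtain ⟨c, -, rfl⟩ := List.mem_map.1 hk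
          simp only [Data.ofRat, Data.size_pair]
          omega
        simp only [Data.ofList, Data.size_pair]
        omega
      omega
    have h6 : (Data.ofList (Data.ofList Data.ofRat) points).size ≤
        (Data.ofNode (CSPNNode.sum roots points : CSPNNode n)).size := by
      simp only [Data.ofNode, Data.size_pair]
      omega
    omega

end Objective

namespace LearnCSPN

/-- A point with coordinate sum 1 cannot be empty; this is what guarantees that a learned sum node
has a child. -/
theorem IsExtracted.spec {bounds : List (ℚ × ℚ)} {points : List (List ℚ)}
    (h : IsExtracted bounds points) (hb : ∀ lu ∈ bounds, 0 ≤ lu.1) :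
    bounds ≠ [] ∧ ∀ p ∈ points, p.length = bounds.length ∧ ∀ a ∈ p, 0 ≤ a := by
  obtain ⟨h0, h⟩ := h
  constructor
  · rintro rfl
    obtain ⟨p, hp⟩ := List.exists_mem_of_ne_nil _ h0
    obtain ⟨h1, h2⟩ := h p hp
    cases h2
    simp at h1
  · intro p hp
    obtain ⟨-, h2⟩ := h p hp
    refine ⟨h2.length_eq, ?_⟩
    clear h hp
    induction h2 with
    | nil => simp
    | cons hlu _ ih =>
      rw [List.forall_mem_cons] at hb ⊢
      exact ⟨hb.1.trans hlu.1, ih hb.2⟩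

end LearnCSPN

namespace Objective

open LearnCSPN

variable {m n : ℕ} {o : Objective n}

/-- Indicators may be shared because they carry no weights: any given weights already attain their
bounds. They add nothing to the table, so their bits are covered by the allowance per child. -/
theorem children_indicators (v : Fin n) {N : List (CSPNNode n)} (hN : indicatorNodes n <+: N) :
    o.Children N N [2 * (v : ℕ), 2 * (v : ℕ) + 1] ∧
    ∀ c ∈ [2 * (v : ℕ), 2 * (v : ℕ) + 1], (o.boundAt N c).hasQuery = decide (o.var = v) := by
  have h : ∀ c ∈ [2 * (v : ℕ), 2 * (v : ℕ) + 1], ∃ b, N[c]? = some (.ind v b) := by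
    simp only [List.mem_cons, List.not_mem_nil, or_false, forall_eq_or_imp, forall_eq]
    exact ⟨⟨true, getElem?_of_prefix hN (getElem?_indicatorNodes v).1⟩,
      ⟨false, getElem?_of_prefix hN (getElem?_indicatorNodes v).2⟩⟩
  refine ⟨⟨List.prefix_rfl, fun c hc => ?_, fun c hc => ?_, fun c hc w _ => ?_,
    fun w₀ hw₀ ys hys => ⟨w₀, hw₀, fun _ _ => rfl, ?_⟩, ?_, fun i hi hi' => by omega⟩,
    fun c hc => ?_⟩
  · obtain ⟨b, hb⟩ := h c hc
    exact (List.getElem?_eq_some_iff.1 hb).1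
  · obtain ⟨b, hb⟩ := h c hc
    rw [boundAt_of_getElem? hb]
    exact (leaf_spec v b).1
  · obtain ⟨b, hb⟩ := h c hc
    rw [boundAt_of_getElem? hb, values_of_getElem? hb]
    exact (leaf_spec v b).2.2.1
  · generalize [2 * (v : ℕ), 2 * (v : ℕ) + 1] = l at h hys
    induction hys with
    | nil => rfl
    | @cons c _ l _ hy _ ih =>
      rw [List.forall_mem_cons] at h
      obtain ⟨⟨b, hb⟩, h⟩ := h
      rw [boundAt_of_getElem? hb] at hy
      rw [List.map_cons, ih h, values_of_getElem? hb, (leaf_spec v b).2.2.2 _ hy]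
  · have hb : ∀ c ∈ [2 * (v : ℕ), 2 * (v : ℕ) + 1], (o.boundAt N c).bits ≤ 1 := fun c hc => by
      obtain ⟨b, hb⟩ := h c hc
      rw [boundAt_of_getElem? hb]
      exact o.bits_leaf_le v b
    have h1 := hb (2 * (v : ℕ)) (by simp)
    have h2 := hb (2 * (v : ℕ) + 1) (by simp)
    simp only [List.map_cons, List.map_nil, List.sum_cons, List.sum_nil, List.length_cons,
      List.length_nil]
    omega
  · obtain ⟨b, hb⟩ := h c hc
    rw [boundAt_of_getElem? hb]
    exact (leaf_spec v b).2.1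

/-- Mutual induction on runs and lists of runs. The flag of a node records whether the query
variable is in its scope, which supplies the disjointness needed at products and the agreement
needed at sums. -/
theorem subnetwork_of_run {D : Fin m → Fin n → Option Bool} {θ : ℝ} {s : ℚ} (hs : 0 ≤ s)
    {T : Finset (Fin m)} {V : Finset (Fin n)} {N N' : List (CSPNNode n)} {r : ℕ}
    (h : Run D θ s T V N N' r) (hN : indicatorNodes n <+: N) :
    o.Subnetwork (decide (o.var ∈ V)) N N' r := by
  refine Run.rec (D := D) (θ := θ) (s := s)
    (motive_1 := fun _ V N N' r _ => indicatorNodes n <+: N →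
      o.Subnetwork (decide (o.var ∈ V)) N N' r)
    (motive_2 := fun L N N' roots _ => indicatorNodes n <+: N → o.Children N N' roots ∧
      List.Forall₂ (fun z r => (o.boundAt N' r).hasQuery = decide (o.var ∈ z.2)) L roots)
    ?_ ?_ ?_ ?_ ?_ h hN
  · intro T v N points hpt hN
    obtain ⟨h1, h2⟩ := children_indicators (o := o) v hN
    obtain ⟨-, h3⟩ := hpt.spec fun lu hlu => by
      simp only [List.mem_cons, List.not_mem_nil, or_false] at hlu
      rcases hlu with rfl | rfl <;> simp only [valueBounds] <;> positivity
    refine Subnetwork.sum h1 (by simp) hpt.1 h3 fun c hc => ?_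
    rw [h2 c hc]
    simp
  · intro T V N N' Vs roots _ hsplit _ ih hN
    obtain ⟨h1, h2⟩ := ih hN
    rw [List.forall₂_map_left_iff] at h2
    obtain ⟨-, -, hV, hd⟩ := hsplit
    -- The flags of the roots are those of the parts of the partition; as the parts are disjoint, at
    -- most one flag is set.
    have hflags : roots.map (fun c => (o.boundAt N' c).hasQuery) =
        Vs.map fun A => decide (o.var ∈ A) := by
      rw [← List.forall₂_eq_eq_eq, List.forall₂_map_left_iff, List.forall₂_map_right_iff]
      exact h2.flip
    have h3 := Subnetwork.prod h1 (by
      have h4 : (roots.map fun c => (o.boundAt N' c).hasQuery).Pairwise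
          fun p p' => ¬ (p = true ∧ p' = true) := by
        rw [hflags, List.pairwise_map]
        refine hd.imp fun h => ?_
        rw [decide_eq_true_eq, decide_eq_true_eq]
        exact fun h' => Finset.disjoint_left.1 h.1 h'.1 h'.2
      rwa [List.pairwise_map] at h4)
    convert h3 using 1
    have h5 : (roots.any fun c => (o.boundAt N' c).hasQuery) =
        (roots.map fun c => (o.boundAt N' c).hasQuery).any id := by
      rw [List.any_map]; rfl
    rw [h5, hflags, List.any_map, Bool.eq_iff_iff]
    simp [hV]
  · intro T V N N' Ts roots points _ _ _ hpt _ ih hN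
    obtain ⟨h1, h2⟩ := ih hN
    rw [List.forall₂_map_left_iff] at h2
    obtain ⟨h3, h4⟩ := hpt.spec fun lu hlu => by
      obtain ⟨A, -, rfl⟩ := List.mem_map.1 hlu
      simp only [clusterBounds]
      positivity
    have hlen := h2.length_eq
    rw [List.length_map, hlen] at h4
    refine Subnetwork.sum h1 ?_ hpt.1 h4 ?_
    · rintro rfl
      cases h2
      simp at h3
    · have hflags : roots.map (fun c => (o.boundAt N' c).hasQuery) =
          Ts.map fun _ => decide (o.var ∈ V) := by
        rw [← List.forall₂_eq_eq_eq, List.forall₂_map_left_iff, List.forall₂_map_right_iff]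
        exact h2.flip
      intro c hc
      have hc' := List.mem_map_of_mem (f := fun c => (o.boundAt N' c).hasQuery) hc
      rw [hflags] at hc'
      obtain ⟨-, -, h⟩ := List.mem_map.1 hc'
      exact h.symm
  · intro N _
    exact ⟨.nil N, .nil⟩
  · intro T V L N N' N'' r roots _ _ ih ih' hN
    have h1 := ih hN
    obtain ⟨h2, h3⟩ := ih' (hN.trans h1.isPrefix)
    refine ⟨.cons h1 h2, .cons ?_ h3⟩
    rw [boundAt_of_prefix h2.isPrefix h1.lt_length]
    exact h1.hasQuery

end Objective

/-! ### The number of iterations -/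

/-- The iteration of Dinkelbach's method takes a number of steps that is linear in the bit length.
    -/
theorem dinkelbach_steps_le (a b D : ℕ → ℤ) (k K : ℕ) (ha0 : a 0 = 0) (hb0 : b 0 = 1)
    (ha : ∀ j, 0 ≤ a j ∧ a j ≤ 2 ^ k) (hb : ∀ j, 0 ≤ b j ∧ b j ≤ 2 ^ k)
    (hD : ∀ j, 1 ≤ D j ∧ D j ≤ 2 ^ k)
    (hopt : ∀ j, (b j * a (j + 2) - a j * b (j + 2)) * D j ≤
      (b j * a (j + 1) - a j * b (j + 1)) * D (j + 1))
    (hpos : ∀ j ≤ K, 0 < b j * a (j + 1) - a j * b (j + 1)) : 2 * K ≤ 5 * k + 2 := by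
  set c : ℕ → ℝ := fun j => b j * a (j + 1) - a j * b (j + 1) with hc
  set g : ℕ → ℝ := fun j => a j + b j with hg
  have hc1 : ∀ j ≤ K, 1 ≤ c j := fun j hj => by
    have := hpos j hj
    simp only [hc]
    exact_mod_cast this
  have hg1 : ∀ j ≤ K + 1, 1 ≤ g j := by
    rintro (_ | j) hj
    · simp [hg, ha0, hb0]
    · have h1 := hpos j (by omega)
      have h2 : 0 < a (j + 1) := by
        by_contra h
        have h3 : a (j + 1) = 0 := le_antisymm (not_lt.1 h) (ha _).1
        have h4 := mul_nonneg (ha j).1 (hb (j + 1)).1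
        rw [h3] at h1
        linarith
      have h3 := (hb (j + 1)).1
      simp only [hg]
      exact_mod_cast (by omega : 1 ≤ a (j + 1) + b (j + 1))
  have hg2 : ∀ j, g j ≤ 2 ^ (k + 1) := fun j => by
    have h1 := (ha j).2
    have h2 := (hb j).2
    simp only [hg]
    rw [pow_succ]
    have : a j + b j ≤ 2 ^ k * 2 := by linarith
    exact_mod_cast this
  have hD1 : ∀ j, (1 : ℝ) ≤ D j := fun j => by exact_mod_cast (hD j).1
  have hD2 : ∀ j, (D j : ℝ) ≤ 2 ^ k := fun j => by exact_mod_cast (hD j).2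
  -- Put F = c j / (g j * D j), the maximum of A - t * (A + B) at t = a j / g j, and G = g (j + 1) /
  -- D j, the value of A + B at the maximiser. The product F * G drops by a factor of 4, because the
  -- ratios of successive values of F and of G add up to at most 1.
  have hstep : ∀ j, j + 1 ≤ K → c (j + 1) * g (j + 2) / (g (j + 1) * D (j + 1) ^ 2) ≤
      c j * g (j + 1) / (g j * D j ^ 2) / 4 := by
    intro j hj
    have hg0 := hg1 j (by omega)
    have hg1' := hg1 (j + 1) (by omega)
    have hc0 := hc1 j (by omega)
    have hD0 := hD1 j
    have hD1' := hD1 (j + 1)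
    have ho : ((b j : ℝ) * a (j + 2) - a j * b (j + 2)) * D j ≤ c j * D (j + 1) := by
      simp only [hc]
      exact_mod_cast hopt j
    have hid : c (j + 1) * g j = ((b j : ℝ) * a (j + 2) - a j * b (j + 2)) * g (j + 1) -
        c j * g (j + 2) := by
      simp only [hc, hg]
      ring
    rw [div_div, div_le_div_iff₀ (by positivity) (by positivity)]
    have h1 : c (j + 1) * g j * D j ≤ c j * (D (j + 1) * g (j + 1) - D j * g (j + 2)) := by
      rw [hid]
      nlinarith [mul_le_mul_of_nonneg_right ho (zero_le_one.trans hg1')]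
    -- This is 4 * (s - t) * t ≤ s ^ 2, the inequality between arithmetic and geometric means.
    have h2 : 4 * ((D (j + 1) * g (j + 1) - D j * g (j + 2)) * (D j * g (j + 2))) ≤
        (D (j + 1) * g (j + 1)) ^ 2 := by
      nlinarith [sq_nonneg (D (j + 1) * g (j + 1) - 2 * (D j * g (j + 2)))]
    have hg3 : 0 ≤ g (j + 2) := zero_le_one.trans (hg1 (j + 2) (by omega))
    calc c (j + 1) * g (j + 2) * (g j * D j ^ 2 * 4)
        = c (j + 1) * g j * D j * (4 * (D j * g (j + 2))) := by ring
      _ ≤ c j * (D (j + 1) * g (j + 1) - D j * g (j + 2)) * (4 * (D j * g (j + 2))) :=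
          mul_le_mul_of_nonneg_right h1 (by positivity)
      _ = c j * (4 * ((D (j + 1) * g (j + 1) - D j * g (j + 2)) * (D j * g (j + 2)))) := by ring
      _ ≤ c j * (D (j + 1) * g (j + 1)) ^ 2 := mul_le_mul_of_nonneg_left h2 (by positivity)
      _ = c j * g (j + 1) * (g (j + 1) * D (j + 1) ^ 2) := by ring
  have hK : ∀ j ≤ K, c j * g (j + 1) / (g j * D j ^ 2) * 4 ^ j ≤
      c 0 * g 1 / (g 0 * D 0 ^ 2) := by
    intro j
    induction j with
    | zero => simp
    | succ j ih =>
      intro hj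
      refine le_trans ?_ (ih (by omega))
      have h4 : (0 : ℝ) < 4 ^ j := by positivity
      have := mul_le_mul_of_nonneg_right (hstep j hj) h4.le
      rw [pow_succ (4 : ℝ) j]
      linarith
  have h1 := hK K le_rfl
  have hgK := hg1 K (by omega)
  have hDK := hD1 K
  -- Integrality enters here: a positive gain and a positive a + b are at least 1.
  have hlow : 1 / ((2 : ℝ) ^ (k + 1) * (2 ^ k) ^ 2) ≤ c K * g (K + 1) / (g K * D K ^ 2) := by
    refine div_le_div₀ ?_ ?_ (by positivity) ?_
    · have := hc1 K le_rfl
      have := hg1 (K + 1) le_rfl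
      positivity
    · exact one_le_mul_of_one_le_of_one_le (hc1 K le_rfl) (hg1 (K + 1) le_rfl)
    · have := hg2 K
      have := hD2 K
      gcongr
  have hup : c 0 * g 1 / (g 0 * D 0 ^ 2) ≤ 2 ^ k * 2 ^ (k + 1) := by
    have hg0 : g 0 = 1 := by simp [hg, ha0, hb0]
    have hc0 : c 0 = a 1 := by simp [hc, ha0, hb0]
    have h3 : (a 1 : ℝ) ≤ 2 ^ k := by exact_mod_cast (ha 1).2
    have h4 : (0 : ℝ) ≤ a 1 := by exact_mod_cast (ha 1).1
    have h5 := hg2 1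
    have h6 := hg1 1 (by omega)
    rw [hg0, hc0, one_mul]
    refine (div_le_self (by positivity) (one_le_pow₀ (hD1 0))).trans ?_
    gcongr
  have h2 : (2 : ℝ) ^ (2 * K) ≤ 2 ^ (5 * k + 2) := by
    have h3 : 1 / ((2 : ℝ) ^ (k + 1) * (2 ^ k) ^ 2) * 4 ^ K ≤ 2 ^ k * 2 ^ (k + 1) :=
      ((mul_le_mul_of_nonneg_right hlow (by positivity)).trans h1).trans hup
    rw [one_div, inv_mul_le_iff₀ (by positivity)] at h3
    have e1 : (4 : ℝ) ^ K = 2 ^ (2 * K) := by rw [pow_mul]; norm_num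
    have e2 : (2 : ℝ) ^ (k + 1) * (2 ^ k) ^ 2 * (2 ^ k * 2 ^ (k + 1)) = 2 ^ (5 * k + 2) := by ring
    rwa [e1, e2] at h3
  exact (pow_le_pow_iff_right₀ one_lt_two).1 h2

/-! ### Maximising a conditional probability -/

namespace CondExpQuery

variable (Q : CondExpQuery)

/-- The objective `b * A - a * B` for the probabilities `A`, `B` of the evidence together with the
value `x`, and with the other value, of the query variable. -/
def objective (x : Bool) (s : ℤ × ℤ) : Objective Q.n := ⟨Q.evidence, Q.var, x, s.1, s.2⟩

/-- The bound computed at the root. -/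
def rootBound (x : Bool) (s : ℤ × ℤ) : NodeBound :=
  (Q.objective x s).boundAt Q.net.nodes Q.net.root

/-- Integers proportional to the pair that maximises the objective. -/
def next (x : Bool) (s : ℤ × ℤ) : ℤ × ℤ :=
  ((Q.rootBound x s).fst.1 * (Q.rootBound x s).snd.2,
    (Q.rootBound x s).snd.1 * (Q.rootBound x s).fst.2)

/-- A positive multiple of the maximum of the objective. -/
def gain (x : Bool) (s : ℤ × ℤ) : ℤ := s.2 * (Q.next x s).1 - s.1 * (Q.next x s).2

/-- The start (0, 1) makes the first objective simply A. -/
def iter (x : Bool) (k : ℕ) : ℤ × ℤ := (Q.next x)^[k] (0, 1)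

/-- The common denominator that turns the optimal pair at the root into the integers of `next`. -/
def den (x : Bool) (s : ℤ × ℤ) : ℤ := (Q.rootBound x s).fst.2 * (Q.rootBound x s).snd.2

/-- The values of the root. -/
noncomputable def rootValues (x : Bool) (w : ℕ → ℕ → ℝ) : ℝ × ℝ × ℝ :=
  (Q.net.value w (queryConfig Q.evidence Q.var x), Q.net.value w (queryConfig Q.evidence Q.var
      (!x)),
    Q.net.value w (evidenceConfig Q.evidence))

variable {Q}

theorem subnetwork_of_isLearned (hQ : Q.net.IsLearned) (x : Bool) (s : ℤ × ℤ) :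
    (Q.objective x s).Subnetwork true (indicatorNodes Q.n) Q.net.nodes Q.net.root := by
  obtain ⟨m, D, θ, t, ht, hrun⟩ := hQ
  have := Objective.subnetwork_of_run (o := Q.objective x s) ht hrun List.prefix_rfl
  simpa using this

theorem bits_le_of_mem_evalTable (hQ : Q.net.IsLearned) (x : Bool) (s : ℤ × ℤ) :
    ∀ u ∈ (Q.objective x s).evalTable Q.net.nodes, u.bits ≤ tableSize Q.net.nodes + 1 := by
  have h := subnetwork_of_isLearned hQ x s
  intro u hu
  obtain ⟨i, hi, rfl⟩ := List.getElem_of_mem hu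
  rw [← List.getD_eq_getElem _ .zero hi]
  change ((Q.objective x s).boundAt Q.net.nodes i).bits ≤ _
  rw [Objective.evalTable, length_foldl_table] at hi
  by_cases hin : i < (indicatorNodes Q.n).length
  · have hmem : (indicatorNodes Q.n)[i] ∈ indicatorNodes Q.n := List.getElem_mem _
    obtain ⟨v, b, hvb⟩ : ∃ v b, (indicatorNodes Q.n)[i] = .ind v b := by
      obtain ⟨v, -, hv⟩ := List.mem_flatMap.1 hmem
      simp only [List.mem_cons, List.not_mem_nil, or_false] at hv
      rcases hv with hv | hv
      · exact ⟨v, true, hv⟩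
      · exact ⟨v, false, hv⟩
    have hget : (indicatorNodes Q.n)[i]? = some (.ind v b) := by
      rw [List.getElem?_eq_getElem hin, hvb]
    rw [Objective.boundAt_of_getElem? (getElem?_of_prefix h.isPrefix hget)]
    exact ((Q.objective x s).bits_leaf_le v b).trans (Nat.le_add_left _ _)
  · exact (h.bits i (not_lt.1 hin) hi).trans (Nat.le_add_right _ _)

theorem den_pos (hQ : Q.net.IsLearned) (x : Bool) (s : ℤ × ℤ) : 0 < Q.den x s :=
  mul_pos (subnetwork_of_isLearned hQ x s).wf.fst_den (subnetwork_of_isLearned hQ x s).wf.snd_den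

theorem next_nonneg (hQ : Q.net.IsLearned) (x : Bool) (s : ℤ × ℤ) :
    0 ≤ (Q.next x s).1 ∧ 0 ≤ (Q.next x s).2 := by
  have h := (subnetwork_of_isLearned hQ x s).wf
  exact ⟨mul_nonneg ((Fraction.val_nonneg_iff h.fst_den).1 h.fst_nonneg) h.snd_den.le,
    mul_nonneg ((Fraction.val_nonneg_iff h.snd_den).1 h.snd_nonneg) h.fst_den.le⟩

/-- The bound does not involve `s`: the objective only decides which fractions are selected and
never enters them. Hence the numbers stay equally short in all rounds. -/
theorem bitLength_next_le (hQ : Q.net.IsLearned) (x : Bool) (s : ℤ × ℤ) :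
    bitLength (Q.next x s).1 ≤ 2 * tableSize Q.net.nodes ∧
    bitLength (Q.next x s).2 ≤ 2 * tableSize Q.net.nodes ∧
    bitLength (Q.den x s) ≤ 2 * tableSize Q.net.nodes := by
  have h : (Q.rootBound x s).bits + _ ≤ _ := (subnetwork_of_isLearned hQ x s).bits_root
  have h1 := bitLength_mul_le (Q.rootBound x s).fst.1 (Q.rootBound x s).snd.2
  have h2 := bitLength_mul_le (Q.rootBound x s).snd.1 (Q.rootBound x s).fst.2
  have h3 := bitLength_mul_le (Q.rootBound x s).fst.2 (Q.rootBound x s).snd.2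
  simp only [NodeBound.bits, Fraction.bits] at h
  simp only [next, den]
  omega

theorem le_two_pow_of_bitLength_le {a : ℤ} {k : ℕ} (h : bitLength a ≤ k) : a ≤ 2 ^ k := by
  rw [bitLength_le_iff] at h
  have h1 : ((a.natAbs : ℕ) : ℤ) < ((2 ^ k : ℕ) : ℤ) := by exact_mod_cast h
  push_cast at h1
  exact (le_abs_self a).trans (by simpa using h1.le)

theorem exists_weights_next (hQ : Q.net.IsLearned) (x : Bool) (s : ℤ × ℤ) :
    ∃ w ∈ Q.net.weights, (Q.rootValues x w).1 * Q.den x s = (Q.next x s).1 ∧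
      (Q.rootValues x w).2.1 * Q.den x s = (Q.next x s).2 ∧
      (Q.rootValues x w).2.2 = (Q.rootValues x w).1 + (Q.rootValues x w).2.1 := by
  have h := subnetwork_of_isLearned hQ x s
  -- The initial table contains only indicators, so any weights are admissible for it.
  have h0 : CSPN.Admissible (0 : ℕ → ℕ → ℝ) (indicatorNodes Q.n) := fun i ch points hi => by
    obtain ⟨v, -, hv⟩ := List.mem_flatMap.1 (List.mem_of_getElem? hi)
    simp at hv
  obtain ⟨w, hw, -, hv⟩ := h.attains 0 h0 _ (by rw [Objective.Attains, h.hasQuery, if_pos rfl])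
  have h1 : ((Q.rootBound x s).fst.2 : ℝ) ≠ 0 := by exact_mod_cast h.wf.fst_den.ne'
  have h2 : ((Q.rootBound x s).snd.2 : ℝ) ≠ 0 := by exact_mod_cast h.wf.snd_den.ne'
  change Q.rootValues x w = ((Q.rootBound x s).fst.val, (Q.rootBound x s).snd.val,
    (Q.rootBound x s).fst.val + (Q.rootBound x s).snd.val) at hv
  refine ⟨w, hw, ?_, ?_, ?_⟩ <;> rw [hv]
  · simp only [Fraction.val, den, next]
    push_cast
    field_simp
  · simp only [Fraction.val, den, next]
    push_cast
    field_simp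

theorem rootValues_spec (hQ : Q.net.IsLearned) (x : Bool) (s : ℤ × ℤ) {w : ℕ → ℕ → ℝ}
    (hw : w ∈ Q.net.weights) :
    0 ≤ (Q.rootValues x w).1 ∧ 0 ≤ (Q.rootValues x w).2.1 ∧
    (Q.rootValues x w).2.2 = (Q.rootValues x w).1 + (Q.rootValues x w).2.1 ∧
    (s.2 * (Q.rootValues x w).1 - s.1 * (Q.rootValues x w).2.1) * Q.den x s ≤ Q.gain x s := by
  have h := subnetwork_of_isLearned hQ x s
  have h1 : (0 : ℝ) < (Q.rootBound x s).fst.2 := by exact_mod_cast h.wf.fst_den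
  have h2 : (0 : ℝ) < (Q.rootBound x s).snd.2 := by exact_mod_cast h.wf.snd_den
  have hi := h.inside w hw
  rw [Objective.Inside, h.hasQuery, if_pos rfl] at hi
  obtain ⟨i1, i2, i3, i4⟩ := hi
  refine ⟨i1, i2, i3, ?_⟩
  change s.2 * (Q.rootValues x w).1 - s.1 * (Q.rootValues x w).2.1 ≤
    s.2 * (Q.rootBound x s).fst.val - s.1 * (Q.rootBound x s).snd.val at i4
  refine (mul_le_mul_of_nonneg_right i4 (by exact_mod_cast (den_pos hQ x s).le)).trans (le_of_eq ?_)
  simp only [Fraction.val, den, next, gain]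
  push_cast
  field_simp

theorem iter_zero (x : Bool) : Q.iter x 0 = (0, 1) := rfl

theorem iter_succ (x : Bool) (k : ℕ) : Q.iter x (k + 1) = Q.next x (Q.iter x k) :=
  Function.iterate_succ_apply' _ _ _

theorem iter_spec (hQ : Q.net.IsLearned) (x : Bool) (k : ℕ) :
    0 ≤ (Q.iter x k).1 ∧ 0 ≤ (Q.iter x k).2 ∧
    bitLength (Q.iter x k).1 ≤ 2 * tableSize Q.net.nodes + 1 ∧
    bitLength (Q.iter x k).2 ≤ 2 * tableSize Q.net.nodes + 1 := by
  cases k with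
  | zero => simp [iter_zero]
  | succ k =>
    rw [iter_succ]
    have h1 := next_nonneg hQ x (Q.iter x k)
    have h2 := bitLength_next_le hQ x (Q.iter x k)
    exact ⟨h1.1, h1.2, by omega, by omega⟩

/-- With t the table size, positive gains up to K = 5 * t + 5 would give 10 * t + 10 ≤ 5 * (2 * t +
1) + 2, which is false. -/
theorem exists_gain_nonpos (hQ : Q.net.IsLearned) (x : Bool) :
    ∃ K ≤ 5 * tableSize Q.net.nodes + 5, Q.gain x (Q.iter x K) ≤ 0 := by
  by_contra! hcon
  have h := dinkelbach_steps_le (fun j => (Q.iter x j).1) (fun j => (Q.iter x j).2)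
    (fun j => Q.den x (Q.iter x j)) (2 * tableSize Q.net.nodes + 1) (5 * tableSize Q.net.nodes + 5)
    rfl rfl
    (fun j => ⟨(iter_spec hQ x j).1, le_two_pow_of_bitLength_le (iter_spec hQ x j).2.2.1⟩)
    (fun j => ⟨(iter_spec hQ x j).2.1, le_two_pow_of_bitLength_le (iter_spec hQ x j).2.2.2⟩)
    (fun j => ⟨den_pos hQ x _, le_two_pow_of_bitLength_le
      ((bitLength_next_le hQ x _).2.2.trans (Nat.le_succ _))⟩) (fun j => ?_) (fun j hj => ?_)
  · omega
  -- The weights that produce the pair of round j + 2 are competitors in the maximisation that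
  -- starts from the pair of round j.
  · obtain ⟨w, hw, h1, h2, -⟩ := exists_weights_next hQ x (Q.iter x (j + 1))
    have h3 := (rootValues_spec hQ x (Q.iter x j) hw).2.2.2
    rw [← iter_succ] at h1 h2
    have h4 : (0 : ℝ) ≤ Q.den x (Q.iter x (j + 1)) := by exact_mod_cast (den_pos hQ x _).le
    have h5 := mul_le_mul_of_nonneg_right h3 h4
    have h6 : (((Q.iter x j).2 * (Q.iter x (j + 1 + 1)).1 -
        (Q.iter x j).1 * (Q.iter x (j + 1 + 1)).2) * Q.den x (Q.iter x j) : ℝ) ≤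
        (Q.gain x (Q.iter x j)) * Q.den x (Q.iter x (j + 1)) := by
      rw [← h1, ← h2]
      refine le_trans (le_of_eq ?_) h5
      ring
    rw [gain, ← iter_succ] at h6
    exact_mod_cast h6
  · have := hcon j hj
    rwa [gain, ← iter_succ] at this

/-- The number of iterations that are needed. -/
noncomputable def steps (Q : CondExpQuery) (x : Bool) : ℕ := sInf {K | Q.gain x (Q.iter x K) ≤ 0}

theorem gain_steps_nonpos (hQ : Q.net.IsLearned) (x : Bool) : Q.gain x (Q.iter x (Q.steps x)) ≤ 0 :=
  Nat.sInf_mem (s := {K | Q.gain x (Q.iter x K) ≤ 0})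
    ((exists_gain_nonpos hQ x).imp fun _ h => h.2)

theorem gain_pos_of_lt_steps {x : Bool} {k : ℕ} (hk : k < Q.steps x) : 0 < Q.gain x (Q.iter x k) :=
  not_le.1 (Nat.notMem_of_lt_sInf hk)

theorem steps_le (hQ : Q.net.IsLearned) (x : Bool) :
    Q.steps x ≤ 5 * tableSize Q.net.nodes + 5 := by
  obtain ⟨K, hK, h⟩ := exists_gain_nonpos hQ x
  exact (Nat.sInf_le h).trans hK

/-- The result of the iteration is proportional to the pair of probabilities for which the
conditional probability of `x` is greatest. -/
theorem iter_steps_spec (hQ : Q.Valid) (x : Bool) :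
    0 < (Q.iter x (Q.steps x)).1 + (Q.iter x (Q.steps x)).2 ∧
    (∃ w ∈ Q.net.weights, 0 < (Q.rootValues x w).2.2 ∧
      (Q.rootValues x w).2.2 = (Q.rootValues x w).1 + (Q.rootValues x w).2.1 ∧
      (Q.rootValues x w).1 * (Q.iter x (Q.steps x)).2 =
        (Q.rootValues x w).2.1 * (Q.iter x (Q.steps x)).1) ∧
    ∀ w ∈ Q.net.weights, (Q.rootValues x w).2.2 = (Q.rootValues x w).1 + (Q.rootValues x w).2.1 ∧
      (Q.rootValues x w).1 * (Q.iter x (Q.steps x)).2 ≤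
        (Q.rootValues x w).2.1 * (Q.iter x (Q.steps x)).1 := by
  obtain ⟨hL, w₀, hw₀, hpos⟩ := hQ
  have hmax : ∀ w ∈ Q.net.weights, (Q.rootValues x w).1 * (Q.iter x (Q.steps x)).2 ≤
      (Q.rootValues x w).2.1 * (Q.iter x (Q.steps x)).1 := fun w hw => by
    have h1 := (rootValues_spec hL x (Q.iter x (Q.steps x)) hw).2.2.2
    have h2 : (Q.gain x (Q.iter x (Q.steps x)) : ℝ) ≤ 0 := by
      exact_mod_cast gain_steps_nonpos hL x
    have h3 : (0 : ℝ) < Q.den x (Q.iter x (Q.steps x)) := by exact_mod_cast den_pos hL x _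
    have h4 := nonpos_of_mul_nonpos_left (h1.trans h2) h3
    linarith
  have hsum : ∀ w ∈ Q.net.weights, (Q.rootValues x w).2.2 = (Q.rootValues x w).1 +
      (Q.rootValues x w).2.1 := fun w hw => (rootValues_spec hL x (0, 1) hw).2.2.1
  -- If there are no rounds, A is 0 for all admissible weights, and those making the evidence
  -- possible attain the ratio 0 : 1.
  rcases hK : Q.steps x with _ | k
  · rw [hK, iter_zero] at hmax
    rw [iter_zero]
    refine ⟨by norm_num, ⟨w₀, hw₀, hpos, hsum w₀ hw₀, ?_⟩, fun w hw => ⟨hsum w hw, hmax w hw⟩⟩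
    refine le_antisymm (hmax w₀ hw₀) ?_
    have := (rootValues_spec hL x (0, 1) hw₀).1
    simpa using this
  · rw [hK] at hmax
    -- The last pair is attained by some weights. The gain before it was positive, so the pair is
    -- not (0, 0), and the evidence has positive probability under those weights.
    have hgain := gain_pos_of_lt_steps (Q := Q) (x := x) (k := k) (by omega)
    obtain ⟨w, hw, h1, h2, h3⟩ := exists_weights_next hL x (Q.iter x k)
    rw [gain] at hgain
    rw [← iter_succ] at h1 h2 hgain
    have hi := iter_spec hL x k
    have hi' := iter_spec hL x (k + 1)
    have hden : (0 : ℝ) < Q.den x (Q.iter x k) := by exact_mod_cast den_pos hL x _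
    have ha : 0 < (Q.iter x (k + 1)).1 + (Q.iter x (k + 1)).2 := by
      by_contra hcon
      have e1 : (Q.iter x (k + 1)).1 = 0 := by omega
      have e2 : (Q.iter x (k + 1)).2 = 0 := by omega
      simp [e1, e2] at hgain
    refine ⟨ha, ⟨w, hw, ?_, h3, ?_⟩, fun w hw => ⟨hsum w hw, hmax w hw⟩⟩
    · rw [h3]
      refine pos_of_mul_pos_left (b := (Q.den x (Q.iter x k) : ℝ)) ?_ hden.le
      rw [add_mul, h1, h2]
      exact_mod_cast ha
    · rw [← h1, ← h2]
      ring

end CondExpQuery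

namespace CondExpQuery

theorem tableSize_le_size {n : ℕ} (N : List (CSPNNode n)) :
    tableSize N ≤ (Data.ofList Data.ofNode N).size := by
  rw [Data.size_ofList, tableSize]
  refine (List.sum_le_sum fun nd _ => ?_).trans (Nat.le_add_left _ _)
  exact Nat.le_add_left _ _

/-! ### The iteration takes polynomial time -/

section

variable {ι : Type} {y : ι → Data} {Q : ι → CondExpQuery} {x : ι → Bool} {s : ι → ℤ × ℤ}

theorem polyFrom_rootBound (hQ : ∀ i, (Q i).net.IsLearned)
    (hnet : PolyFrom y fun i => .ofCSPN (Q i).net)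
    (hobj : PolyFrom y fun i => ((Q i).objective (x i) (s i)).toData) :
    PolyFrom y fun i => ((Q i).rootBound (x i) (s i)).toData :=
  .getD (.evalTable ((hnet.fst.size_bdd.mono fun _ => tableSize_le_size _).add (.const 1)) hobj
    hnet.fst fun i => bits_le_of_mem_evalTable (hQ i) _ _) hnet.snd (.bound _)

theorem polyFrom_next (hQ : ∀ i, (Q i).net.IsLearned)
    (hnet : PolyFrom y fun i => .ofCSPN (Q i).net)
    (hobj : PolyFrom y fun i => ((Q i).objective (x i) (s i)).toData) :
    PolyFrom y (fun i => .int ((Q i).next (x i) (s i)).1) ∧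
      PolyFrom y fun i => .int ((Q i).next (x i) (s i)).2 :=
  have h := polyFrom_rootBound hQ hnet hobj
  ⟨.mul h.snd.fst.fst h.snd.snd.snd, .mul h.snd.snd.fst h.snd.fst.snd⟩

theorem polyFrom_iter_steps (hQ : ∀ i, (Q i).net.IsLearned)
    (hy : PolyFrom y fun i => (Q i).encode) (hx : PolyFrom y fun i => .ofBool (x i)) :
    PolyFrom y (fun i => .int ((Q i).iter (x i) ((Q i).steps (x i))).1) ∧
      PolyFrom y fun i => .int ((Q i).iter (x i) ((Q i).steps (x i))).2 := by
  have hsize : PolyBdd y fun i => tableSize (Q i).net.nodes :=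
    hy.fst.fst.size_bdd.mono fun _ => tableSize_le_size _
  -- The state is the network with the current objective, whose coefficients are the current pair.
  -- The program stops by testing the sign of the gain, so the number of rounds need not be
  -- computed.
  have main := PolyFrom.loop (x := y) (fun i k => .pair (.ofCSPN (Q i).net)
    ((Q i).objective (x i) ((Q i).iter (x i) k)).toData) (fun i => (Q i).steps (x i))
    (fun i k => (Q i).gain (x i) ((Q i).iter (x i) k)) ?_
    ((((PolyBdd.const 5).mul hsize).add (.const 5)).mono fun i => steps_le (hQ i) (x i)) ?_ ?_
    (fun i k hk => gain_pos_of_lt_steps hk) (fun i => gain_steps_nonpos (hQ i) (x i)) ?_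
  · exact ⟨main.snd.snd.snd.snd.fst, main.snd.snd.snd.snd.snd⟩
  · exact hy.fst.pair (hy.snd.fst.pair (hy.snd.snd.fst.pair (hx.pair (.pair (.int 0) (.int 1)))))
  · let π : {z : ι × ℕ // z.2 ≤ (Q z.1).steps (x z.1)} → ι := fun z => z.1.1
    refine ((((hy.size_bdd.reindex π).add (hx.size_bdd.reindex π)).add
      ((PolyBdd.const 4).mul (hsize.reindex π))).add (.const 20)).mono fun z => ?_
    have h := iter_spec (hQ z.1.1) (x z.1.1) z.1.2
    simp only [π, encode, Objective.toData, objective, Data.size_pair, Data.size_int]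
    omega
  · have r := PolyFrom.refl fun z : {z : ι × ℕ // z.2 ≤ (Q z.1).steps (x z.1)} =>
      Data.pair (.ofCSPN (Q z.1.1).net)
        ((Q z.1.1).objective (x z.1.1) ((Q z.1.1).iter (x z.1.1) z.1.2)).toData
    have h := polyFrom_next (fun _ => hQ _) r.fst r.snd
    exact .sub (.mul r.snd.snd.snd.snd.snd h.1) (.mul r.snd.snd.snd.snd.fst h.2)
  · have r := PolyFrom.refl fun z : {z : ι × ℕ // z.2 < (Q z.1).steps (x z.1)} =>
      Data.pair (.ofCSPN (Q z.1.1).net)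
        ((Q z.1.1).objective (x z.1.1) ((Q z.1.1).iter (x z.1.1) z.1.2)).toData
    have h := polyFrom_next (fun _ => hQ _) r.fst r.snd
    refine (r.fst.pair (r.snd.fst.pair (r.snd.snd.fst.pair (r.snd.snd.snd.fst.pair
      (h.1.pair h.2))))).congr fun z => ?_
    simp only [iter_succ]
    rfl

end

/-! ### Conditional expectations -/

/-- The conditional expectation for the result of the iteration, as a quotient of integers. -/
noncomputable def answer (Q : CondExpQuery) (x : Bool) : ℤ × ℤ :=
  let s := Q.iter x (Q.steps x)
  ((Q.f x).num * (Q.f (!x)).den * s.1 + (Q.f (!x)).num * (Q.f x).den * s.2,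
    (Q.f x).den * (Q.f (!x)).den * (s.1 + s.2))

theorem polyFrom_answer {ι : Type} {y : ι → Data} {Q : ι → CondExpQuery} {x : ι → Bool}
    (hQ : ∀ i, (Q i).net.IsLearned) (hy : PolyFrom y fun i => (Q i).encode)
    (hx : PolyFrom y fun i => .ofBool (x i)) :
    PolyFrom y fun i => .pair (.int ((Q i).answer (x i)).1) (.int ((Q i).answer (x i)).2) := by
  obtain ⟨h1, h2⟩ := polyFrom_iter_steps hQ hy hx
  have hf : ∀ x : ι → Bool, PolyFrom y (fun i => .ofBool (x i)) →
      PolyFrom y fun i => (Fraction.ofRat ((Q i).f (x i))).toData := fun x hx =>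
    (PolyFrom.fractionIte hx (a := fun i => .ofRat ((Q i).f true))
      (b := fun i => .ofRat ((Q i).f false)) hy.snd.snd.snd.fst hy.snd.snd.snd.snd).congr fun i =>
          by
        cases x i <;> rfl
  have hf1 := hf x hx
  have hf2 := hf (fun i => !x i) hx.ofBool_not
  exact .pair (.add (.mul (.mul hf1.fst hf2.snd) h1) (.mul (.mul hf2.fst hf1.snd) h2))
    (.mul (.mul hf1.snd hf2.snd) (.add h1 h2))

theorem condExpectation_eq (Q : CondExpQuery) (x : Bool) (w : ℕ → ℕ → ℝ) :
    condExpectation Q.net w Q.evidence Q.var Q.f =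
      (Q.f x * (Q.rootValues x w).1 + Q.f (!x) * (Q.rootValues x w).2.1) /
        (Q.rootValues x w).2.2 := by
  unfold condExpectation rootValues
  rw [Fintype.sum_bool]
  cases x <;> simp [add_comm]

/-- After clearing positive denominators, the difference between any conditional expectation and the
answer has the sign of (f(¬x) - f(x)) * (B * a - A * b), whose second factor is nonnegative by
optimality. -/
theorem answer_spec {Q : CondExpQuery} (hQ : Q.Valid) (x : Bool) :
    ∃ r : ℚ, Data.Represents (.pair (.int (Q.answer x).1) (.int (Q.answer x).2)) r ∧
      (r : ℝ) ∈ condExpectations Q.net Q.evidence Q.var Q.f ∧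
      ∀ y ∈ condExpectations Q.net Q.evidence Q.var Q.f,
        (Q.f x ≤ Q.f (!x) → (r : ℝ) ≤ y) ∧ (Q.f (!x) ≤ Q.f x → y ≤ r) := by
  obtain ⟨hs, ⟨w, hw, hpos, hsum, heq⟩, hmax⟩ := iter_steps_spec hQ x
  have hd1 : (0 : ℤ) < (Q.f x).den := by exact_mod_cast (Q.f x).den_pos
  have hd2 : (0 : ℤ) < (Q.f (!x)).den := by exact_mod_cast (Q.f (!x)).den_pos
  have hs' : (0 : ℝ) < (Q.iter x (Q.steps x)).1 + (Q.iter x (Q.steps x)).2 := by exact_mod_cast hs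
  have hr : (((Q.answer x).1 / (Q.answer x).2 : ℚ) : ℝ) =
      (Q.f x * (Q.iter x (Q.steps x)).1 + Q.f (!x) * (Q.iter x (Q.steps x)).2) /
        ((Q.iter x (Q.steps x)).1 + (Q.iter x (Q.steps x)).2) := by
    have e1 : (Q.f x : ℝ) = (Q.f x).num / (Q.f x).den := by exact_mod_cast (Rat.num_div_den _).symm
    have e2 : (Q.f (!x) : ℝ) = (Q.f (!x)).num / (Q.f (!x)).den := by
      exact_mod_cast (Rat.num_div_den _).symm
    have hd1' : ((Q.f x).den : ℝ) ≠ 0 := by exact_mod_cast hd1.ne'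
    have hd2' : ((Q.f (!x)).den : ℝ) ≠ 0 := by exact_mod_cast hd2.ne'
    rw [e1, e2]
    simp only [answer]
    push_cast
    field_simp
  refine ⟨(Q.answer x).1 / (Q.answer x).2, ⟨_, _, rfl, mul_pos (mul_pos hd1 hd2) hs, rfl⟩,
    ⟨w, hw, hpos, ?_⟩, ?_⟩
  · rw [hr, Q.condExpectation_eq x, div_eq_div_iff hs'.ne' hpos.ne', hsum]
    linear_combination (Q.f (!x) - Q.f x : ℝ) * heq
  · rintro _ ⟨w', hw', hpos', rfl⟩
    obtain ⟨hsum', hle⟩ := hmax w' hw'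
    change 0 < (Q.rootValues x w').2.2 at hpos'
    rw [hr, Q.condExpectation_eq x, div_le_div_iff₀ hs' hpos', div_le_div_iff₀ hpos' hs', hsum']
    constructor
    · intro h
      have h' : (0 : ℝ) ≤ Q.f (!x) - Q.f x := by rw [sub_nonneg]; exact_mod_cast h
      have := mul_le_mul_of_nonneg_left hle h'
      linarith
    · intro h
      have h' : (0 : ℝ) ≤ Q.f x - Q.f (!x) := by rw [sub_nonneg]; exact_mod_cast h
      have := mul_le_mul_of_nonneg_left hle h'
      linarith

/-- Indexing by the valid queries alone is enough: nothing is required of the program on other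
inputs. -/
theorem solvableInPolyTime_of_answer {correct : CondExpQuery → Data → Prop} (x : CondExpQuery →
    Bool)
    (hx : PolyFrom encode fun Q => .ofBool (x Q))
    (h : ∀ Q : CondExpQuery, Q.Valid →
      correct Q (.pair (.int (Q.answer (x Q)).1) (.int (Q.answer (x Q)).2))) :
    SolvableInPolyTime encode Valid correct := by
  obtain ⟨P, t, hP, ⟨p, hp⟩, -⟩ := polyFrom_answer (ι := {Q : CondExpQuery // Q.Valid})
    (Q := Subtype.val) (x := fun Q => x Q) (fun Q => Q.2.1) (PolyFrom.refl _) (hx.reindex _)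
  exact ⟨P, p, fun Q hQ => ⟨_, t ⟨Q, hQ⟩, hP ⟨Q, hQ⟩, hp ⟨Q, hQ⟩, h Q hQ⟩⟩

theorem fraction_le_ofRat (r s : ℚ) : (Fraction.ofRat r).le (.ofRat s) = decide (r ≤ s) := by
  rw [Bool.eq_iff_iff, Fraction.le_iff (Fraction.ofRat_den_pos r) (Fraction.ofRat_den_pos s),
    Fraction.val_ofRat, Fraction.val_ofRat, decide_eq_true_eq, Rat.cast_le]

theorem polyFrom_le_f :
    PolyFrom encode (fun Q => .ofBool (decide (Q.f true ≤ Q.f false))) ∧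
      PolyFrom encode fun Q => .ofBool (decide (Q.f false ≤ Q.f true)) := by
  have r := PolyFrom.refl encode
  have h1 : PolyFrom encode fun Q => (Fraction.ofRat (Q.f true)).toData := r.snd.snd.snd.fst
  have h2 : PolyFrom encode fun Q => (Fraction.ofRat (Q.f false)).toData := r.snd.snd.snd.snd
  exact ⟨(PolyFrom.fractionLe h1 h2).congr fun Q => by rw [fraction_le_ofRat],
    (PolyFrom.fractionLe h2 h1).congr fun Q => by rw [fraction_le_ofRat]⟩

end CondExpQuery

/-- Lower and upper conditional expectations of a variable in credal sum-product networks learned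
by the algorithm can be computed in polynomial time. -/
theorem mainTheorem4 :
    SolvableInPolyTime CondExpQuery.encode CondExpQuery.Valid CondExpQuery.IsLower ∧
      SolvableInPolyTime CondExpQuery.encode CondExpQuery.Valid CondExpQuery.IsUpper := by
  constructor
  · refine CondExpQuery.solvableInPolyTime_of_answer _ CondExpQuery.polyFrom_le_f.1 fun Q hQ => ?_
    obtain ⟨r, hr, hmem, hle⟩ := CondExpQuery.answer_spec hQ (decide (Q.f true ≤ Q.f false))
    refine ⟨r, hr, hmem, fun y hy => (hle y hy).1 ?_⟩
    rcases le_total (Q.f true) (Q.f false) with h | h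
    · simp [h]
    · by_cases h' : Q.f true ≤ Q.f false <;> simp [h', h]
  · refine CondExpQuery.solvableInPolyTime_of_answer _ CondExpQuery.polyFrom_le_f.2 fun Q hQ => ?_
    obtain ⟨r, hr, hmem, hle⟩ := CondExpQuery.answer_spec hQ (decide (Q.f false ≤ Q.f true))
    refine ⟨r, hr, hmem, fun y hy => (hle y hy).2 ?_⟩
    rcases le_total (Q.f true) (Q.f false) with h | h
    · by_cases h' : Q.f false ≤ Q.f true <;> simp [h', h]
    · simp [h]
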